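/- Setting. Let $E$ be a complex Hilbert space, $d,r$ natural numbers, and let $\mathcal{B}$ be the Banach space of trace class operators on $\mathbb{C}^d\otimes E$ with the trace norm. Let $\Omega=(\Omega_1,\dots,\Omega_r)$ with $\Omega_j>0$, and let $H_t=\hat H(\Omega_1t,\dots,\Omega_rt)$, $t\in\mathbb{R}$, where $\hat H$ is a continuous function on the torus $(\mathbb{R}/2\pi\mathbb{Z})^r$ with values in the Hermitian $d\times d$ matrices. Let $H_E$ be a bounded self-adjoint operator on $E$, $\omega_E$ a density operator on $E$ with $[H_E,\omega_E]=0$, and $H_{\rm int}=\sum_\mu S_\mu\otimes R_\mu$ a self-adjoint finite sum with $S_\mu\in M_d(\mathbb{C})$, $R_\mu\in\mathscr{B}(E)$, $\mathrm{tr}(\omega_ER_\mu)=0$. Put $\mathcal{P}_0(a)=(\mathrm{tr}_E\,a)\otimes\omega_E$, $\mathcal{P}_1=\mathrm{id}-\mathcal{P}_0$, $\mathcal{B}_0=\mathcal{P}_0\mathcal{B}$, $Z_t=-i[H_t\otimes I+I\otimes H_E,\cdot\,]$, $A=-i[H_{\rm int},\cdot\,]$, $A_{jk}=\mathcal{P}_jA\mathcal{P}_k$.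 Let $u_t$ and $U_t$ ($t\in\mathbb{R}$) be the principal fundamental solutions of $\dot u_t=-iH_tu_t$, $u_0=I$, in $M_d(\mathbb{C})$, and of $\dot U_t=Z_tU_t$, $U_0=\mathrm{id}$, in $\mathscr{B}(\mathcal{B})$, and let $U_{t,s}=U_tU_s^{-1}$. Let $$f_{\mu\nu}(t)=\mathrm{tr}\big(e^{iH_Et}R_\mu^*e^{-iH_Et}R_\nu\omega_E\big),\qquad t\in\mathbb{R}.$$ Proposition. Suppose that $f_{\mu\nu}\in L^1(\mathbb{R}_+)$ for all $\mu,\nu$. (1) For every $\lambda>0$ and every $t\in\mathbb{R}$ (in particular $t\ge0$) the integral $$\tilde K_t^\lambda=\int_0^\infty (U_{x+\lambda^{-2}t,\lambda^{-2}t})^{-1}A_{01}\,U_{x+\lambda^{-2}t,\lambda^{-2}t}\,A_{10}\,dx$$ converges absolutely in $\mathscr{B}(\mathcal{B})$, $\tilde K^\lambda_t$ maps $\mathcal{B}_0$ into itself, and $t\mapsto\tilde K^\lambda_t$ is continuous, with values in $\mathscr{B}(\mathcal{B})$ and also (after restriction to $\mathcal{B}_0$) in $\mathscr{B}(\mathcal{B}_0)$.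 (2) Suppose in addition: (i) $\Omega$ is rationally independent: $k\in\mathbb{Z}^r$ and $k\cdot\Omega=0$ imply $k=0$; (ii) the Schrödinger equation is reducible: $u_t=p_te^{-i\bar Ht}$ for $t\ge0$, where $\bar H$ is Hermitian, $p_t=\hat p(\Omega_1t,\dots,\Omega_rt)$ is unitary for $t\ge 0$ with $\hat p$ continuous on the torus, and $p_0=I$; (iii) there are no $\omega_1,\omega_2\in\{\epsilon-\epsilon':\epsilon,\epsilon'\in\mathrm{spec}\,\bar H\}$ and $k\in\mathbb{Z}^r\setminus\{0\}$ with $\omega_1-\omega_2=k\cdot\Omega$. Write $\bar H=\sum_k\epsilon_kP_k$ with rank-one spectral projections $P_k$; let $\hat S_{\mu,n}$, $n\in\mathbb{Z}^r$, be the Fourier coefficients of $\theta\mapsto\hat p(\theta)^*S_\mu\hat p(\theta)$ and $S_{\mu n\omega}=\sum_{\epsilon_k-\epsilon_l=\omega}P_k\hat S_{\mu,n}P_l$. Then $f_{\mu\nu}\in L^1(\mathbb{R})$; put $$h_{\mu\nu}(\omega)=\int_{-\infty}^\infty f_{\mu\nu}(x)e^{-i\omega x}dx,\qquad \int_0^\infty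 f_{\mu\nu}(x)e^{-i\omega x}dx=\tfrac12h_{\mu\nu}(\omega)+i\zeta_{\mu\nu}(\omega).$$ The following series, with $\omega$ running over the finite set in (iii), converge absolutely (sum over $n$ for fixed $\mu,\nu$), and $\Delta H$ is Hermitian: $$\Delta H=\sum_{\mu,\nu}\sum_{n\in\mathbb{Z}^r}\sum_\omega\zeta_{\mu\nu}(\omega+n\cdot\Omega)\,S_{\mu n\omega}^*S_{\nu n\omega},$$ $$\bar D(\rho)=\sum_{\mu,\nu}\sum_{n\in\mathbb{Z}^r}\sum_\omega h_{\mu\nu}(\omega+n\cdot\Omega)\Big(S_{\nu n\omega}\,\rho\,S_{\mu n\omega}^*-\tfrac12\big(S_{\mu n\omega}^*S_{\nu n\omega}\,\rho+\rho\,S_{\mu n\omega}^*S_{\nu n\omega}\big)\Big).$$ Moreover there is one bounded operator $K$ on $\mathcal{B}$ such that for every $\lambda>0$ the local average $$\lim_{\delta\to\infty}\frac1{2\delta}\int_{-\delta}^{\delta}U_{\lambda^{-2}t}^{-1}\,\tilde K^\lambda_t\,U_{\lambda^{-2}t}\,dt$$ exists in the norm of $\mathscr{B}(\mathcal{B})$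 and equals $K$, and for all $a\in\mathcal{B}$, with $\rho=\mathrm{tr}_E\,a$, $$K(a)=\big(-i[\Delta H,\rho]+\bar D(\rho)\big)\otimes\omega_E .$$ -/

import Mathlib

open scoped ENNReal InnerProductSpace
open InnerProductSpace

set_option linter.unusedSectionVars false

theorem exists_regularized_inverse {H : Type*} [NormedAddCommGroup H] [InnerProductSpace ℂ H]
    [CompleteSpace H] (P : H →L[ℂ] H) (hP : 0 ≤ P) (ε : ℝ) (hε : 0 < ε) :
    ∃ R : H →L[ℂ] H, IsSelfAdjoint R ∧ R * P = P * R ∧ P * R + ε • R = 1 ∧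
      ‖P * R‖ ≤ 1 ∧ ‖ε • R‖ ≤ 1 := by
  have hPs : IsSelfAdjoint P := IsSelfAdjoint.of_nonneg hP
  have hsp : ∀ t ∈ spectrum ℝ P, 0 ≤ t := fun t ht => spectrum_nonneg_of_nonneg hP ht
  have hne : ∀ t ∈ spectrum ℝ P, t + ε ≠ 0 := fun t ht => by have := hsp t ht; positivity
  have hc : ContinuousOn (fun t : ℝ => (t + ε)⁻¹) (spectrum ℝ P) :=
    ContinuousOn.inv₀ (by fun_prop) hne
  have hid : cfc (fun t : ℝ => t) P = P := cfc_id' ℝ P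
  have h1 : P * cfc (fun t : ℝ => (t + ε)⁻¹) P = cfc (fun t : ℝ => t * (t + ε)⁻¹) P := by
    rw [cfc_mul (fun t : ℝ => t) (fun t : ℝ => (t + ε)⁻¹) P (by fun_prop) hc, hid]
  have h1' : cfc (fun t : ℝ => (t + ε)⁻¹) P * P = cfc (fun t : ℝ => t * (t + ε)⁻¹) P := by
    have := cfc_mul (fun t : ℝ => (t + ε)⁻¹) (fun t : ℝ => t) P hc (by fun_prop)
    rw [hid] at this
    rw [← this]
    congr 1
    ext t
    ring
  have h2 : ε • cfc (fun t : ℝ => (t + ε)⁻¹) P = cfc (fun t : ℝ => ε * (t + ε)⁻¹) P := by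
    rw [← cfc_smul ε (fun t : ℝ => (t + ε)⁻¹) P hc]
    simp
  refine ⟨cfc (fun t : ℝ => (t + ε)⁻¹) P, cfc_predicate _ P, h1'.trans h1.symm, ?_, ?_, ?_⟩
  · rw [h1, h2, ← cfc_add (a := P) (fun t : ℝ => t * (t + ε)⁻¹) (fun t : ℝ => ε * (t + ε)⁻¹)
      (by fun_prop) (by fun_prop), ← cfc_one ℝ P]
    refine cfc_congr fun t ht => ?_
    have := hne t ht
    simp only [Pi.one_apply]
    field_simp
  · rw [h1]
    refine norm_cfc_le zero_le_one fun t ht => ?_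
    have h0 := hsp t ht
    rw [Real.norm_of_nonneg (by positivity), ← div_eq_mul_inv, div_le_one (by positivity)]
    linarith
  · rw [h2]
    refine norm_cfc_le zero_le_one fun t ht => ?_
    have h0 := hsp t ht
    rw [Real.norm_of_nonneg (by positivity), ← div_eq_mul_inv, div_le_one (by positivity)]
    linarith

theorem norm_abs_apply {H : Type*} [NormedAddCommGroup H] [InnerProductSpace ℂ H]
    [CompleteSpace H] (T : H →L[ℂ] H) (z : H) : ‖CFC.abs T z‖ = ‖T z‖ := by
  have hs : IsSelfAdjoint (CFC.abs T) := IsSelfAdjoint.of_nonneg (CFC.abs_nonneg T)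
  have h := CFC.abs_mul_abs T
  have h1 : (⟪CFC.abs T z, CFC.abs T z⟫_ℂ) = ⟪T z, T z⟫_ℂ := by
    rw [← ContinuousLinearMap.adjoint_inner_right, ← ContinuousLinearMap.star_eq_adjoint,
      hs.star_eq, ← mul_apply_eq_comp, h, mul_apply_eq_comp,
      ContinuousLinearMap.star_eq_adjoint, ContinuousLinearMap.adjoint_inner_right]
  have h2 := congrArg Complex.re h1
  have e1 := @inner_self_eq_norm_sq ℂ H _ _ _ (CFC.abs T z)
  have e2 := @inner_self_eq_norm_sq ℂ H _ _ _ (T z)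
  simp only [RCLike.re_eq_complex_re] at e1 e2
  rw [e1, e2] at h2
  exact (sq_eq_sq₀ (norm_nonneg _) (norm_nonneg _)).1 h2


section TraceNorm
variable {H : Type*} [NormedAddCommGroup H] [InnerProductSpace ℂ H] [CompleteSpace H]

/-- `∑ᵢ ⟨eᵢ, |T| eᵢ⟩`, with `|T| = √(T* T)`, for an orthonormal basis `(eᵢ)`. -/
noncomputable def traceNormIn {J : Type*} (b : HilbertBasis J ℂ H) (T : H →L[ℂ] H) : ℝ≥0∞ :=
  ∑' i, ENNReal.ofReal (⟪b i, CFC.abs T (b i)⟫_ℂ).re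

/-- `|tr (T F)| ≤ M ‖F‖` for every finite-rank operator `F = ∑ₖ |xₖ⟩⟨yₖ|`. -/
def TraceDualBound (T : H →L[ℂ] H) (M : ℝ) : Prop :=
  ∀ (n : ℕ) (x y : Fin n → H),
    ‖∑ k, ⟪y k, T (x k)⟫_ℂ‖ ≤ M * ‖∑ k, rankOne ℂ (x k) (y k)‖

theorem TraceDualBound.fintype {T : H →L[ℂ] H} {M : ℝ} (h : TraceDualBound T M)
    {J : Type*} (s : Finset J) (x y : J → H) :
    ‖∑ k ∈ s, ⟪y k, T (x k)⟫_ℂ‖ ≤ M * ‖∑ k ∈ s, rankOne ℂ (x k) (y k)‖ := by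
  have := h s.card (fun k => x (s.equivFin.symm k)) (fun k => y (s.equivFin.symm k))
  rw [s.equivFin.symm.sum_comp (fun k : s => ⟪y k, T (x k)⟫_ℂ),
    s.equivFin.symm.sum_comp (fun k : s => rankOne ℂ (x k) (y k))] at this
  rw [← Finset.sum_coe_sort s, ← Finset.sum_coe_sort s]
  exact this

theorem re_inner_abs_nonneg (T : H →L[ℂ] H) (z : H) : 0 ≤ (⟪z, CFC.abs T z⟫_ℂ).re :=
  ((ContinuousLinearMap.nonneg_iff_isPositive _).1 (CFC.abs_nonneg T)).re_inner_nonneg_right z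


theorem norm_sum_rankOne_le {J : Type*} {v : J → H} (hv : Orthonormal ℂ v) (s : Finset J)
    (c : J → ℂ) (hc : ∀ i, ‖c i‖ ≤ 1) (W : H →L[ℂ] H) (hW : ‖W‖ ≤ 1) :
    ‖∑ i ∈ s, rankOne ℂ (c i • v i) (W (v i))‖ ≤ 1 := by
  refine ContinuousLinearMap.opNorm_le_bound _ zero_le_one fun z => ?_
  rw [one_mul, sum_apply]
  set a : J → ℂ := fun i => ⟪W (v i), z⟫_ℂ * c i with ha
  have e : ∑ i ∈ s, rankOne ℂ (c i • v i) (W (v i)) z = ∑ i ∈ s, a i • v i := by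
    refine Finset.sum_congr rfl fun i _ => ?_
    rw [rankOne_apply, smul_smul]
  rw [e]
  have h1 : ‖∑ i ∈ s, a i • v i‖ ^ 2 = ∑ i ∈ s, ‖a i‖ ^ 2 := by
    have h := hv.inner_sum a a s
    rw [inner_self_eq_norm_sq_to_K] at h
    have h' : ∀ i, (starRingEnd ℂ) (a i) * a i = ((‖a i‖ ^ 2 : ℝ) : ℂ) := fun i => by
      rw [mul_comm, Complex.mul_conj, Complex.normSq_eq_norm_sq]
    simp only [h'] at h
    have h2 : ((‖∑ i ∈ s, a i • v i‖ ^ 2 : ℝ) : ℂ) = ((∑ i ∈ s, ‖a i‖ ^ 2 : ℝ) : ℂ) := by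
      rw [Complex.ofReal_pow, Complex.ofReal_sum]
      exact h
    exact Complex.ofReal_injective h2
  have h2 : ∑ i ∈ s, ‖a i‖ ^ 2 ≤ ∑ i ∈ s, ‖⟪v i, star W z⟫_ℂ‖ ^ 2 := by
    refine Finset.sum_le_sum fun i _ => ?_
    rw [ContinuousLinearMap.star_eq_adjoint, ContinuousLinearMap.adjoint_inner_right, ha]
    gcongr
    rw [norm_mul]
    exact mul_le_of_le_one_right (norm_nonneg _) (hc i)
  have h3 := hv.sum_inner_products_le (star W z) (s := s)
  have h4 : ‖star W z‖ ≤ ‖z‖ := by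
    refine ((star W).le_opNorm z).trans ?_
    rw [norm_star]
    exact mul_le_of_le_one_left (norm_nonneg _) hW
  have h5 : ‖star W z‖ ^ 2 ≤ ‖z‖ ^ 2 := by gcongr
  exact (sq_le_sq₀ (norm_nonneg _) (norm_nonneg _)).1 (h1.le.trans (h2.trans (h3.trans h5)))

theorem traceNormIn_le_of_dualBound {J : Type*} (b : HilbertBasis J ℂ H) {T : H →L[ℂ] H}
    {M : ℝ} (h : TraceDualBound T M) (hM : 0 ≤ M) : traceNormIn b T ≤ ENNReal.ofReal M := by
  rw [traceNormIn, ENNReal.tsum_eq_iSup_sum]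
  refine iSup_le fun s => ?_
  rw [← ENNReal.ofReal_sum_of_nonneg fun i _ => re_inner_abs_nonneg T _]
  refine ENNReal.ofReal_le_ofReal (le_of_forall_pos_le_add fun δ hδ => ?_)
  obtain ⟨ε, hε, hεs⟩ : ∃ ε > 0, (s.card : ℝ) * ε ≤ δ := by
    refine ⟨δ / (s.card + 1), by positivity, ?_⟩
    rw [mul_div_assoc', div_le_iff₀ (by positivity)]
    nlinarith
  obtain ⟨R, hRs, hcomm, hsum, hPR, hεR⟩ :=
    exists_regularized_inverse (CFC.abs T) (CFC.abs_nonneg T) ε hε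
  set P := CFC.abs T with hP
  have hPs : IsSelfAdjoint P := IsSelfAdjoint.of_nonneg (CFC.abs_nonneg T)
  have hW : ‖T * R‖ ≤ 1 := by
    refine ContinuousLinearMap.opNorm_le_bound _ zero_le_one fun z => ?_
    rw [mul_apply_eq_comp, ← norm_abs_apply, ← hP, ← mul_apply_eq_comp]
    exact (P * R).le_of_opNorm_le hPR z
  have hb := h.fintype s (fun i => b i) (fun i => (T * R) (b i))
  have hn := norm_sum_rankOne_le b.orthonormal s (fun _ => 1) (by simp) (T * R) hW
  simp only [one_smul] at hn
  have hb' := (Complex.re_le_norm _).trans (hb.trans (mul_le_of_le_one_right hM hn))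
  have key : ∀ i, (⟪b i, P (b i)⟫_ℂ).re ≤ (⟪(T * R) (b i), T (b i)⟫_ℂ).re + ε := by
    intro i
    have e1 : ⟪(T * R) (b i), T (b i)⟫_ℂ = ⟪b i, (P - ε • (R * P)) (b i)⟫_ℂ := by
      have : P - ε • (R * P) = star (T * R) * T := by
        rw [star_mul, hRs.star_eq, mul_assoc, ← CFC.abs_mul_abs T, ← hP, ← mul_assoc, hcomm]
        have := congrArg (fun X => X * P) hsum
        simp only [add_mul, one_mul, smul_mul_assoc] at this
        rw [sub_eq_iff_eq_add, ← hcomm, hcomm, ← hcomm]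
        rw [← hcomm] at this
        exact this.symm
      rw [this, ContinuousLinearMap.star_eq_adjoint]
      exact (ContinuousLinearMap.adjoint_inner_right (T * R) (b i) (T (b i))).symm
    have e2 : ‖⟪b i, (ε • (R * P)) (b i)⟫_ℂ‖ ≤ ε := by
      refine (norm_inner_le_norm _ _).trans ?_
      rw [b.orthonormal.1 i, one_mul]
      refine ((ε • (R * P)).le_opNorm _).trans ?_
      rw [b.orthonormal.1 i, mul_one, norm_smul, Real.norm_of_nonneg hε.le, hcomm]
      exact mul_le_of_le_one_right hε.le hPR
    rw [e1, sub_apply, inner_sub_right, Complex.sub_re]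
    have := (Complex.re_le_norm _).trans e2
    linarith
  calc ∑ i ∈ s, (⟪b i, P (b i)⟫_ℂ).re
      ≤ ∑ i ∈ s, ((⟪(T * R) (b i), T (b i)⟫_ℂ).re + ε) := Finset.sum_le_sum fun i _ => key i
    _ = (∑ i ∈ s, ⟪(T * R) (b i), T (b i)⟫_ℂ).re + s.card * ε := by
        rw [Finset.sum_add_distrib, Complex.re_sum]; simp
    _ ≤ M + δ := add_le_add hb' hεs

theorem dualBound_of_traceNormIn {J : Type*} (b : HilbertBasis J ℂ H) {T : H →L[ℂ] H}
    (h : traceNormIn b T ≠ ∞) : TraceDualBound T (traceNormIn b T).toReal := by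
  intro n x y
  set P := CFC.abs T with hP
  have hP0 : 0 ≤ P := CFC.abs_nonneg T
  set A := CFC.sqrt P with hA
  have hAs : IsSelfAdjoint A := IsSelfAdjoint.of_nonneg (CFC.sqrt_nonneg P)
  have hAA : A * A = P := CFC.sqrt_mul_sqrt_self P hP0
  set F : H →L[ℂ] H := ∑ k, rankOne ℂ (x k) (y k) with hF
  have hsq : ∀ i, ‖A (b i)‖ ^ 2 = (⟪b i, P (b i)⟫_ℂ).re := by
    intro i
    rw [← hAA, mul_apply_eq_comp]
    nth_rewrite 2 [← hAs.star_eq]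
    rw [ContinuousLinearMap.star_eq_adjoint, ContinuousLinearMap.adjoint_inner_right]
    exact (inner_self_eq_norm_sq (𝕜 := ℂ) (A (b i))).symm
  have hS : HasSum (fun i => ‖A (b i)‖ ^ 2) (traceNormIn b T).toReal := by
    simp only [hsq]
    have := ENNReal.hasSum_toReal h
    rw [← ENNReal.tsum_toReal_eq fun i => ENNReal.ne_top_of_tsum_ne_top h i] at this
    convert this using 1
    · funext i
      exact (ENNReal.toReal_ofReal (re_inner_abs_nonneg T (b i))).symm
    · rfl
  refine le_of_forall_pos_le_add fun δ hδ => ?_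
  set N : ℝ := ∑ k, ‖y k‖ * ‖x k‖ with hN
  have hN0 : 0 ≤ N := Finset.sum_nonneg fun k _ => by positivity
  obtain ⟨ε, hε, hεs⟩ : ∃ ε > 0, N * ε ≤ δ := by
    refine ⟨δ / (N + 1), by positivity, ?_⟩
    rw [mul_div_assoc', div_le_iff₀ (by positivity)]
    nlinarith
  obtain ⟨R, hRs, hcomm, hsum, hPR, hεR⟩ := exists_regularized_inverse P hP0 ε hε
  set W := T * R with hWdef
  have hW : ‖W‖ ≤ 1 := by
    refine ContinuousLinearMap.opNorm_le_bound _ zero_le_one fun z => ?_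
    rw [hWdef, mul_apply_eq_comp, ← norm_abs_apply, ← hP, ← mul_apply_eq_comp]
    exact (P * R).le_of_opNorm_le hPR z
  have hT : T = W * P + ε • W := by
    have : W * P + ε • W = T * (P * R + ε • R) := by
      rw [mul_add, hWdef, mul_assoc, hcomm, mul_smul_comm]
    rw [this, hsum, mul_one]
  have hfin : ∀ z w, HasSum (fun i => ⟪z, W (A (b i))⟫_ℂ * ⟪A (b i), w⟫_ℂ)
      ⟪z, (W * P) w⟫_ℂ := by
    intro z w
    have := b.hasSum_inner_mul_inner (star (W * A) z) (A w)
    have e1 : ∀ i, ⟪star (W * A) z, b i⟫_ℂ = ⟪z, W (A (b i))⟫_ℂ := fun i => by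
      rw [ContinuousLinearMap.star_eq_adjoint, ContinuousLinearMap.adjoint_inner_left]; rfl
    have e2 : ∀ i, ⟪b i, A w⟫_ℂ = ⟪A (b i), w⟫_ℂ := fun i => by
      nth_rewrite 1 [← hAs.star_eq]
      rw [ContinuousLinearMap.star_eq_adjoint, ContinuousLinearMap.adjoint_inner_right]
    have e3 : ⟪star (W * A) z, A w⟫_ℂ = ⟪z, (W * P) w⟫_ℂ := by
      rw [ContinuousLinearMap.star_eq_adjoint, ContinuousLinearMap.adjoint_inner_left, ← hAA]; rfl
    simpa only [e1, e2, e3] using this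
  have hfs : HasSum (fun i => ⟪A (b i), F (W (A (b i)))⟫_ℂ) (∑ k, ⟪y k, (W * P) (x k)⟫_ℂ) := by
    have := hasSum_sum (s := Finset.univ) fun k _ => hfin (y k) (x k)
    convert this using 1
    funext i
    rw [hF, sum_apply, inner_sum]
    refine Finset.sum_congr rfl fun k _ => ?_
    rw [rankOne_apply, inner_smul_right]
  have hmain : ‖∑ k, ⟪y k, (W * P) (x k)⟫_ℂ‖ ≤ (traceNormIn b T).toReal * ‖F‖ := by
    rw [← hfs.tsum_eq]
    refine tsum_of_norm_bounded (hS.mul_right ‖F‖) fun i => ?_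
    refine (norm_inner_le_norm _ _).trans ?_
    have h1 : ‖F (W (A (b i)))‖ ≤ ‖F‖ * ‖A (b i)‖ :=
      (F.le_opNorm _).trans (by gcongr; simpa using W.le_of_opNorm_le hW (A (b i)))
    nlinarith [norm_nonneg (A (b i))]
  have herr : ‖∑ k, ⟪y k, (ε • W) (x k)⟫_ℂ‖ ≤ N * ε := by
    rw [hN, Finset.sum_mul]
    refine (norm_sum_le _ _).trans (Finset.sum_le_sum fun k _ => ?_)
    refine (norm_inner_le_norm _ _).trans ?_
    have : ‖(ε • W) (x k)‖ ≤ ε * ‖x k‖ := by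
      rw [smul_apply, norm_smul, Real.norm_of_nonneg hε.le]
      gcongr
      simpa using W.le_of_opNorm_le hW (x k)
    nlinarith [norm_nonneg (y k)]
  calc ‖∑ k, ⟪y k, T (x k)⟫_ℂ‖
      = ‖∑ k, ⟪y k, (W * P) (x k)⟫_ℂ + ∑ k, ⟪y k, (ε • W) (x k)⟫_ℂ‖ := by
        rw [← Finset.sum_add_distrib]
        congr 1
        refine Finset.sum_congr rfl fun k _ => ?_
        rw [← inner_add_right, ← add_apply, ← hT]
    _ ≤ _ := (norm_add_le _ _).trans (add_le_add hmain (herr.trans hεs))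

variable (H) in
/-- Index set of a chosen orthonormal basis of `H`. -/
noncomputable def stdIndex : Set H := (exists_hilbertBasis ℂ H).choose

variable (H) in
/-- A chosen orthonormal basis of `H`. -/
noncomputable def stdBasis : HilbertBasis (stdIndex H) ℂ H :=
  (exists_hilbertBasis ℂ H).choose_spec.choose

/-- The trace norm `tr √(T* T)`; it does not depend on the basis (`traceNormIn_eq_traceNorm`). -/
noncomputable def traceNorm (T : H →L[ℂ] H) : ℝ≥0∞ := traceNormIn (stdBasis H) T

theorem traceNormIn_le_traceNormIn {J J' : Type*} (b : HilbertBasis J ℂ H)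
    (b' : HilbertBasis J' ℂ H) (T : H →L[ℂ] H) : traceNormIn b T ≤ traceNormIn b' T := by
  by_cases h : traceNormIn b' T = ∞
  · rw [h]; exact le_top
  · have := traceNormIn_le_of_dualBound b (dualBound_of_traceNormIn b' h) ENNReal.toReal_nonneg
    rwa [ENNReal.ofReal_toReal h] at this

theorem traceNormIn_eq_traceNorm {J : Type*} (b : HilbertBasis J ℂ H) (T : H →L[ℂ] H) :
    traceNormIn b T = traceNorm T :=
  le_antisymm (traceNormIn_le_traceNormIn _ _ T) (traceNormIn_le_traceNormIn _ _ T)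

theorem traceNorm_le {T : H →L[ℂ] H} {M : ℝ} (h : TraceDualBound T M) (hM : 0 ≤ M) :
    traceNorm T ≤ ENNReal.ofReal M := traceNormIn_le_of_dualBound _ h hM

theorem traceNorm_lt_top {T : H →L[ℂ] H} {M : ℝ} (h : TraceDualBound T M) (hM : 0 ≤ M) :
    traceNorm T < ∞ := (traceNorm_le h hM).trans_lt ENNReal.ofReal_lt_top

theorem traceNorm_toReal_le {T : H →L[ℂ] H} {M : ℝ} (h : TraceDualBound T M) (hM : 0 ≤ M) :
    (traceNorm T).toReal ≤ M := ENNReal.toReal_le_of_le_ofReal hM (traceNorm_le h hM)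

theorem dualBound_traceNorm {T : H →L[ℂ] H} (h : traceNorm T < ∞) :
    TraceDualBound T (traceNorm T).toReal := dualBound_of_traceNormIn _ h.ne

theorem TraceDualBound.add {S T : H →L[ℂ] H} {M N : ℝ} (hS : TraceDualBound S M)
    (hT : TraceDualBound T N) : TraceDualBound (S + T) (M + N) := by
  intro n x y
  simp only [add_apply, inner_add_right, Finset.sum_add_distrib, add_mul]
  exact (norm_add_le _ _).trans (add_le_add (hS n x y) (hT n x y))

theorem TraceDualBound.smul {T : H →L[ℂ] H} {M : ℝ} (hT : TraceDualBound T M) (c : ℂ) :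
    TraceDualBound (c • T) (‖c‖ * M) := by
  intro n x y
  simp only [smul_apply, inner_smul_right, ← Finset.mul_sum, norm_mul, mul_assoc]
  gcongr
  exact hT n x y

theorem TraceDualBound.opNorm_le {T : H →L[ℂ] H} {M : ℝ} (hT : TraceDualBound T M) (hM : 0 ≤ M) :
    ‖T‖ ≤ M := by
  refine T.opNorm_le_bound hM fun x => ?_
  have := hT 1 (fun _ => x) (fun _ => T x)
  simp only [Finset.univ_unique, Finset.sum_singleton, norm_rankOne, inner_self_eq_norm_sq_to_K,
    norm_pow, RCLike.norm_ofReal, abs_norm] at this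
  by_contra! hlt
  have h0 : 0 < ‖T x‖ := (by positivity : 0 ≤ M * ‖x‖).trans_lt hlt
  nlinarith

theorem TraceDualBound.comp {K : Type*} [NormedAddCommGroup K] [InnerProductSpace ℂ K]
    [CompleteSpace K] {T : H →L[ℂ] H} {M : ℝ} (hT : TraceDualBound T M) (hM : 0 ≤ M)
    (B : H →L[ℂ] K) (A : K →L[ℂ] H) : TraceDualBound (B ∘L T ∘L A) (‖B‖ * ‖A‖ * M) := by
  intro n x y
  have := hT n (fun k => A (x k)) (fun k => ContinuousLinearMap.adjoint B (y k))
  have e : ∑ k, rankOne ℂ (A (x k)) (ContinuousLinearMap.adjoint B (y k)) =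
      A ∘L (∑ k, rankOne ℂ (x k) (y k)) ∘L B := by
    ext z
    simp [sum_apply, rankOne_apply, ContinuousLinearMap.adjoint_inner_left]
  simp only [ContinuousLinearMap.adjoint_inner_left, e] at this
  refine this.trans ?_
  have h1 : ‖A ∘L (∑ k, rankOne ℂ (x k) (y k)) ∘L B‖ ≤
      ‖A‖ * (‖∑ k, rankOne ℂ (x k) (y k)‖ * ‖B‖) :=
    (ContinuousLinearMap.opNorm_comp_le _ _).trans
      (by gcongr; exact ContinuousLinearMap.opNorm_comp_le _ _)
  calc _ ≤ M * (‖A‖ * (‖∑ k, rankOne ℂ (x k) (y k)‖ * ‖B‖)) := by gcongr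
    _ = _ := by ring

variable (H) in
/-- The bounded operators of finite trace norm. -/
noncomputable def traceClassSubmodule : Submodule ℂ (H →L[ℂ] H) where
  carrier := {T | traceNorm T < ∞}
  zero_mem' := traceNorm_lt_top (M := 0) (fun n x y => by simp) le_rfl
  add_mem' {S T} hS hT := traceNorm_lt_top ((dualBound_traceNorm hS).add (dualBound_traceNorm hT))
    (add_nonneg ENNReal.toReal_nonneg ENNReal.toReal_nonneg)
  smul_mem' c {T} hT := traceNorm_lt_top ((dualBound_traceNorm hT).smul c)
    (mul_nonneg (norm_nonneg _) ENNReal.toReal_nonneg)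

variable (H) in
/-- The Banach space of trace class operators on `H`, with the trace norm. -/
def TraceClass : Type _ := traceClassSubmodule H

namespace TraceClass

noncomputable instance : AddCommGroup (TraceClass H) :=
  inferInstanceAs (AddCommGroup (traceClassSubmodule H))

noncomputable instance : Module ℂ (TraceClass H) :=
  inferInstanceAs (Module ℂ (traceClassSubmodule H))

variable (H) in
/-- A trace class operator as a bounded operator. -/
noncomputable def op : TraceClass H →ₗ[ℂ] (H →L[ℂ] H) := (traceClassSubmodule H).subtype

/-- The element of `TraceClass H` given by a bounded operator of finite trace norm. -/
def mk (T : H →L[ℂ] H) (hT : traceNorm T < ∞) : TraceClass H :=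
  (⟨T, hT⟩ : traceClassSubmodule H)

@[simp] theorem op_mk (T : H →L[ℂ] H) (hT : traceNorm T < ∞) : op H (mk T hT) = T := rfl

theorem op_injective : Function.Injective (op H) := Subtype.val_injective

noncomputable instance : Norm (TraceClass H) := ⟨fun a => (traceNorm (op H a)).toReal⟩

theorem norm_def (a : TraceClass H) : ‖a‖ = (traceNorm (op H a)).toReal := rfl

theorem dualBound (a : TraceClass H) : TraceDualBound (op H a) ‖a‖ := dualBound_traceNorm a.2

theorem norm_nonneg' (a : TraceClass H) : 0 ≤ ‖a‖ := ENNReal.toReal_nonneg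

theorem norm_le_of_dualBound {a : TraceClass H} {M : ℝ} (h : TraceDualBound (op H a) M)
    (hM : 0 ≤ M) : ‖a‖ ≤ M := traceNorm_toReal_le h hM

theorem normCore : NormedSpace.Core ℂ (TraceClass H) where
  norm_nonneg a := norm_nonneg' a
  norm_smul c a := by
    have h1 : ∀ (c : ℂ) (a : TraceClass H), ‖c • a‖ ≤ ‖c‖ * ‖a‖ := fun c a =>
      norm_le_of_dualBound (by rw [map_smul]; exact (dualBound a).smul c)
        (mul_nonneg (norm_nonneg _) (norm_nonneg' a))
    refine le_antisymm (h1 c a) ?_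
    by_cases hc : c = 0
    · subst hc; simpa using norm_nonneg' _
    · have := h1 c⁻¹ (c • a)
      rw [smul_smul, inv_mul_cancel₀ hc, one_smul, norm_inv] at this
      rwa [← le_inv_mul_iff₀ (norm_pos_iff.2 hc)]
  norm_triangle a b := norm_le_of_dualBound
    (by rw [map_add]; exact (dualBound a).add (dualBound b))
    (add_nonneg (norm_nonneg' a) (norm_nonneg' b))
  norm_eq_zero_iff a := by
    constructor
    · intro h
      have := (dualBound a).opNorm_le (norm_nonneg' a)
      rw [h] at this
      exact op_injective ((norm_le_zero_iff.1 this).trans (map_zero _).symm)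
    · rintro rfl
      refine le_antisymm (norm_le_of_dualBound (fun n x y => ?_) le_rfl) (norm_nonneg' _)
      simp

noncomputable instance : NormedAddCommGroup (TraceClass H) := NormedAddCommGroup.ofCore normCore

noncomputable instance : NormedSpace ℂ (TraceClass H) := NormedSpace.ofCore normCore

theorem opNorm_le_norm (a : TraceClass H) : ‖op H a‖ ≤ ‖a‖ := (dualBound a).opNorm_le (norm_nonneg a)

instance : CompleteSpace (TraceClass H) := by
  refine Metric.complete_of_cauchySeq_tendsto fun u hu => ?_
  have hop : CauchySeq fun n => op H (u n) := by
    rw [Metric.cauchySeq_iff] at hu ⊢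
    intro ε hε
    obtain ⟨N, hN⟩ := hu ε hε
    refine ⟨N, fun m hm n hn => lt_of_le_of_lt ?_ (hN m hm n hn)⟩
    rw [dist_eq_norm, dist_eq_norm, ← map_sub]
    exact opNorm_le_norm _
  obtain ⟨T, hT⟩ := cauchySeq_tendsto_of_complete hop
  have hlim : ∀ ε > 0, ∃ N, ∀ n ≥ N, TraceDualBound (T - op H (u n)) ε := by
    intro ε hε
    obtain ⟨N, hN⟩ := Metric.cauchySeq_iff.1 hu ε hε
    refine ⟨N, fun n hn k x y => ?_⟩
    have hc : Filter.Tendsto (fun m => ‖∑ j, ⟪y j, (op H (u m) - op H (u n)) (x j)⟫_ℂ‖)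
        Filter.atTop (nhds ‖∑ j, ⟪y j, (T - op H (u n)) (x j)⟫_ℂ‖) := by
      refine (tendsto_finsetSum _ fun j _ => ?_).norm
      refine Filter.Tendsto.inner tendsto_const_nhds ?_
      exact ((ContinuousLinearMap.apply ℂ H (x j)).continuous.tendsto _).comp
        (hT.sub tendsto_const_nhds)
    refine le_of_tendsto hc (Filter.eventually_atTop.2 ⟨N, fun m hm => ?_⟩)
    rw [← map_sub]
    refine (dualBound (u m - u n) k x y).trans ?_
    have := (hN m hm n hn).le
    rw [dist_eq_norm] at this
    gcongr
  obtain ⟨N, hN⟩ := hlim 1 one_pos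
  have hmem : traceNorm T < ∞ := by
    have := (hN N le_rfl).add (dualBound (u N))
    rw [sub_add_cancel] at this
    exact traceNorm_lt_top this (add_nonneg zero_le_one (norm_nonneg _))
  refine ⟨mk T hmem, Metric.tendsto_atTop.2 fun ε hε => ?_⟩
  obtain ⟨N', hN'⟩ := hlim (ε / 2) (half_pos hε)
  refine ⟨N', fun n hn => ?_⟩
  rw [dist_comm, dist_eq_norm]
  refine lt_of_le_of_lt (norm_le_of_dualBound (M := ε / 2) ?_ (half_pos hε).le) (half_lt_self hε)
  rw [map_sub, op_mk]
  exact hN' n hn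

section Sandwich
variable {K : Type*} [NormedAddCommGroup K] [InnerProductSpace ℂ K] [CompleteSpace K]

/-- `T ↦ B T A` -/
noncomputable def sandwich (B : H →L[ℂ] K) (A : K →L[ℂ] H) : TraceClass H →L[ℂ] TraceClass K :=
  LinearMap.mkContinuous
    { toFun := fun a => mk (B ∘L op H a ∘L A)
        (traceNorm_lt_top ((dualBound a).comp (norm_nonneg a) B A) (by positivity))
      map_add' := fun a b => op_injective (by
        ext z
        simp)
      map_smul' := fun c a => op_injective (by
        ext z
        simp) }
    (‖B‖ * ‖A‖)
    (fun a => norm_le_of_dualBound ((dualBound a).comp (norm_nonneg a) B A) (by positivity))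

@[simp] theorem op_sandwich (B : H →L[ℂ] K) (A : K →L[ℂ] H) (a : TraceClass H) :
    op K (sandwich B A a) = B ∘L op H a ∘L A := rfl

theorem norm_sandwich_le (B : H →L[ℂ] K) (A : K →L[ℂ] H) : ‖sandwich B A‖ ≤ ‖B‖ * ‖A‖ :=
  LinearMap.mkContinuous_norm_le _ (by positivity) _

end Sandwich

variable (H) in
/-- `X ↦ [X, ·]` -/
noncomputable def commutator : (H →L[ℂ] H) →L[ℂ] (TraceClass H →L[ℂ] TraceClass H) :=
  LinearMap.mkContinuous
    { toFun := fun X => sandwich X 1 - sandwich 1 X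
      map_add' := fun X Y => by
        ext a
        refine op_injective (ContinuousLinearMap.ext fun z => ?_)
        simp
        abel
      map_smul' := fun c X => by
        ext a
        refine op_injective (ContinuousLinearMap.ext fun z => ?_)
        simp [smul_sub] }
    2
    (fun X => by
      have h1 : ‖(1 : H →L[ℂ] H)‖ ≤ 1 := ContinuousLinearMap.norm_id_le
      have h2 := norm_sandwich_le X (1 : H →L[ℂ] H)
      have h3 := norm_sandwich_le (1 : H →L[ℂ] H) X
      refine (norm_sub_le _ _).trans ?_
      nlinarith [norm_nonneg X])

theorem op_commutator (X : H →L[ℂ] H) (a : TraceClass H) :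
    op H (commutator H X a) = X * op H a - op H a * X := by
  ext z
  simp [commutator]

end TraceClass

/-- The trace `∑ᵢ ⟨eᵢ, T eᵢ⟩` (used for trace class operators only). -/
noncomputable def opTrace (T : H →L[ℂ] H) : ℂ := ∑' i, ⟪stdBasis H i, T (stdBasis H i)⟫_ℂ

namespace TraceClass

theorem sum_norm_inner_le {J : Type*} (b : HilbertBasis J ℂ H) (a : TraceClass H) (s : Finset J) :
    ∑ i ∈ s, ‖⟪b i, op H a (b i)⟫_ℂ‖ ≤ ‖a‖ := by
  have hc : ∀ w : ℂ, ∃ c : ℂ, ‖c‖ ≤ 1 ∧ c * w = (‖w‖ : ℂ) := by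
    intro w
    by_cases hw : w = 0
    · exact ⟨0, by simp, by simp [hw]⟩
    · refine ⟨(‖w‖ : ℂ) / w, ?_, div_mul_cancel₀ _ hw⟩
      rw [norm_div, Complex.norm_real, norm_norm, div_self (norm_ne_zero_iff.2 hw)]
  choose c hc1 hc2 using hc
  have h1 := (dualBound a).fintype s (fun i => c (⟪b i, op H a (b i)⟫_ℂ) • b i) (fun i => b i)
  have h2 := norm_sum_rankOne_le b.orthonormal s (fun i => c (⟪b i, op H a (b i)⟫_ℂ))
    (fun i => hc1 _) 1 ContinuousLinearMap.norm_id_le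
  have h3 : ∑ i ∈ s, ⟪b i, op H a (c (⟪b i, op H a (b i)⟫_ℂ) • b i)⟫_ℂ
      = ((∑ i ∈ s, ‖⟪b i, op H a (b i)⟫_ℂ‖ : ℝ) : ℂ) := by
    rw [Complex.ofReal_sum]
    refine Finset.sum_congr rfl fun i _ => ?_
    rw [map_smul, inner_smul_right, hc2]
  rw [h3, Complex.norm_real, Real.norm_of_nonneg (Finset.sum_nonneg fun _ _ => norm_nonneg _)] at h1
  exact h1.trans (mul_le_of_le_one_right (norm_nonneg a) h2)

theorem summable_norm_inner {J : Type*} (b : HilbertBasis J ℂ H) (a : TraceClass H) :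
    Summable fun i => ‖⟪b i, op H a (b i)⟫_ℂ‖ :=
  summable_of_sum_le (fun _ => norm_nonneg _) (sum_norm_inner_le b a)

variable (H) in
/-- The trace as a bounded functional on the trace class operators. -/
noncomputable def trace : TraceClass H →L[ℂ] ℂ :=
  LinearMap.mkContinuous
    { toFun := fun a => opTrace (op H a)
      map_add' := fun a b => by
        simp only [opTrace, map_add, add_apply, inner_add_right]
        exact (summable_norm_inner _ a).of_norm.tsum_add (summable_norm_inner _ b).of_norm
      map_smul' := fun c a => by
        simp only [opTrace, map_smul, smul_apply, inner_smul_right, RingHom.id_apply, smul_eq_mul]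
        exact tsum_mul_left }
    1
    (fun a => by
      rw [one_mul]
      refine (norm_tsum_le_tsum_norm (summable_norm_inner _ a)).trans ?_
      exact Real.tsum_le_of_sum_le (fun _ => norm_nonneg _) (sum_norm_inner_le _ a))

@[simp] theorem trace_apply (a : TraceClass H) : trace H a = opTrace (op H a) := rfl

end TraceClass
end TraceNorm

section Bipartite
open TraceClass
open scoped Matrix.Norms.L2Operator

/-- The Hilbert space `ℂᵈ ⊗ E`, realised as the Hilbert sum of `d` copies of `E`
through `eⱼ ⊗ v ↦ (0, …, v, …, 0)`. -/
abbrev Joint (d : ℕ) (E : Type*) [NormedAddCommGroup E] := PiLp 2 fun _ : Fin d => E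

variable {d : ℕ} {E : Type*} [NormedAddCommGroup E] [InnerProductSpace ℂ E] [CompleteSpace E]

/-- `v ↦ eⱼ ⊗ v` -/
noncomputable def slotIn (j : Fin d) : E →L[ℂ] Joint d E :=
  (PiLp.continuousLinearEquiv 2 ℂ fun _ : Fin d => E).symm.toContinuousLinearMap ∘L
    ContinuousLinearMap.single ℂ (fun _ : Fin d => E) j

/-- The adjoint `⟨eⱼ| ⊗ I` of `v ↦ eⱼ ⊗ v`. -/
noncomputable def slotOut (j : Fin d) : Joint d E →L[ℂ] E := PiLp.proj 2 (fun _ : Fin d => E) j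

@[simp] theorem slotIn_apply (j : Fin d) (v : E) : slotIn j v = PiLp.single 2 j v := rfl

@[simp] theorem slotOut_apply (j : Fin d) (v : Joint d E) : slotOut j v = v j := rfl

/-- The operator `m ⊗ R` on `ℂᵈ ⊗ E`. -/
noncomputable def matTensor (m : Matrix (Fin d) (Fin d) ℂ) (R : E →L[ℂ] E) :
    Joint d E →L[ℂ] Joint d E :=
  ∑ j, ∑ k, m j k • (slotIn j ∘L R ∘L slotOut k)

theorem matTensor_apply (m : Matrix (Fin d) (Fin d) ℂ) (R : E →L[ℂ] E) (v : Joint d E) (j : Fin d) :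
    matTensor m R v j = ∑ k, m j k • R (v k) := by
  simp [matTensor, Finset.sum_apply, Pi.single_apply, sum_apply]

/-- The partial trace over `E`: `(tr_E a)ⱼₖ = tr ((⟨eⱼ| ⊗ I) a (|eₖ⟩ ⊗ I))`. -/
noncomputable def partialTrace : TraceClass (Joint d E) →L[ℂ] Matrix (Fin d) (Fin d) ℂ :=
  ∑ j, ∑ k, (trace E ∘L sandwich (slotOut j) (slotIn k)).smulRight (Matrix.single j k (1 : ℂ))

theorem partialTrace_apply (a : TraceClass (Joint d E)) (j k : Fin d) :
    partialTrace a j k = opTrace (slotOut j ∘L op _ a ∘L slotIn k) := by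
  simp [partialTrace, Matrix.sum_apply, Matrix.single_apply, sum_apply, ite_and]

/-- `ρ ↦ ρ ⊗ w` as a map from matrices to trace class operators on `ℂᵈ ⊗ E`. -/
noncomputable def tensorState (w : TraceClass E) :
    Matrix (Fin d) (Fin d) ℂ →L[ℂ] TraceClass (Joint d E) :=
  ∑ j, ∑ k, (LinearMap.toContinuousLinearMap (Matrix.entryLinearMap ℂ ℂ j k)).smulRight
    (sandwich (slotIn j) (slotOut k) w)

theorem op_tensorState (w : TraceClass E) (ρ : Matrix (Fin d) (Fin d) ℂ) :
    op _ (tensorState w ρ) = matTensor ρ (op E w) := by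
  simp [tensorState, matTensor, sum_apply, Matrix.entryLinearMap]
  rfl

theorem continuous_matTensor (R : E →L[ℂ] E) :
    Continuous fun m : Matrix (Fin d) (Fin d) ℂ => matTensor m R := by
  unfold matTensor
  refine continuous_finsetSum _ fun j _ => continuous_finsetSum _ fun k _ => ?_
  exact Continuous.smul (continuous_id.matrix_elem j k) continuous_const

end Bipartite

section ODE
open intervalIntegral
variable {𝔸 : Type*} [NormedRing 𝔸] [NormedAlgebra ℂ 𝔸]

/-- `Φ` is the principal fundamental solution of `Φ' = A Φ`, `Φ 0 = 1`, on the real line. -/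
def IsPrincipalSolution (A Φ : ℝ → 𝔸) : Prop :=
  Φ 0 = 1 ∧ ∀ t, HasDerivAt Φ (A t * Φ t) t

theorem IsPrincipalSolution.unique {A Φ Ψ : ℝ → 𝔸} {M : ℝ} (hA : ∀ t, ‖A t‖ ≤ M)
    (hΦ : IsPrincipalSolution A Φ) (hΨ : IsPrincipalSolution A Ψ) : Φ = Ψ := by
  have hM : 0 ≤ M := (norm_nonneg _).trans (hA 0)
  refine ODE_solution_unique_univ (v := fun t x => A t * x) (s := fun _ => Set.univ) (t₀ := 0)
    (K := ⟨M, hM⟩) (fun t => ?_) (fun t => ⟨hΦ.2 t, trivial⟩) (fun t => ⟨hΨ.2 t, trivial⟩)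
    (hΦ.1.trans hΨ.1.symm)
  refine (LipschitzWith.of_dist_le_mul fun x y => ?_).lipschitzOnWith
  rw [dist_eq_norm, dist_eq_norm, ← mul_sub]
  exact (norm_mul_le _ _).trans (mul_le_mul_of_nonneg_right (hA t) (norm_nonneg _))

/-- The iterated integrals of the Dyson series, used to show that principal solutions exist. -/
noncomputable def dysonTerm (A : ℝ → 𝔸) : ℕ → ℝ → 𝔸
  | 0 => fun _ => 1
  | n + 1 => fun t => ∫ s in (0 : ℝ)..t, A s * dysonTerm A n s

theorem continuous_dysonTerm {A : ℝ → 𝔸} (hA : Continuous A) (n : ℕ) :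
    Continuous (dysonTerm A n) := by
  induction n with
  | zero => exact continuous_const
  | succ n ih =>
    exact intervalIntegral.continuous_primitive
      (fun a b => (hA.mul ih).intervalIntegrable a b) 0

theorem norm_dysonTerm_le {A : ℝ → 𝔸} {M : ℝ} (hM : ∀ t, ‖A t‖ ≤ M) (n : ℕ)
    (t : ℝ) : ‖dysonTerm A n t‖ ≤ ‖(1 : 𝔸)‖ * (M * |t|) ^ n / n.factorial := by
  have hM0 : 0 ≤ M := (norm_nonneg _).trans (hM 0)
  induction n generalizing t with
  | zero => simp [dysonTerm]
  | succ n ih =>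
    have hb : ∀ s, ‖A s * dysonTerm A n s‖ ≤ M * (‖(1 : 𝔸)‖ * (M * |s|) ^ n / n.factorial) :=
      fun s => (norm_mul_le _ _).trans (by gcongr; exacts [hM s, ih s])
    have key : ∀ t : ℝ, |∫ s in (0 : ℝ)..t, M * (‖(1 : 𝔸)‖ * (M * |s|) ^ n / n.factorial)| =
        ‖(1 : 𝔸)‖ * (M * |t|) ^ (n + 1) / (n + 1).factorial := by
      intro t
      have e : ∀ t : ℝ, 0 ≤ t → ∫ s in (0 : ℝ)..t, M * (‖(1 : 𝔸)‖ * (M * |s|) ^ n / n.factorial) =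
          ‖(1 : 𝔸)‖ * (M * |t|) ^ (n + 1) / (n + 1).factorial := by
        intro t ht
        have : ∫ s in (0 : ℝ)..t, M * (‖(1 : 𝔸)‖ * (M * |s|) ^ n / n.factorial) =
            ∫ s in (0 : ℝ)..t, (M ^ (n + 1) * ‖(1 : 𝔸)‖ / n.factorial) * s ^ n := by
          refine intervalIntegral.integral_congr fun s hs => ?_
          rw [Set.uIcc_of_le ht] at hs
          simp only [abs_of_nonneg hs.1, mul_pow]
          ring
        rw [this, intervalIntegral.integral_const_mul, integral_pow, abs_of_nonneg ht,
          Nat.factorial_succ]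
        push_cast
        field_simp
        ring
      rcases le_total 0 t with ht | ht
      · rw [e t ht, abs_of_nonneg (by positivity)]
      · have h := e (-t) (by linarith)
        have h2 := intervalIntegral.integral_comp_neg (a := 0) (b := t)
          (fun s => M * (‖(1 : 𝔸)‖ * (M * |s|) ^ n / n.factorial))
        simp only [abs_neg, neg_zero] at h h2
        rw [h2, intervalIntegral.integral_symm, h, abs_neg, abs_of_nonneg (by positivity)]
    rw [← key t]
    refine intervalIntegral.norm_integral_le_abs_of_norm_le (Filter.Eventually.of_forall fun s => hb s) ?_
    exact Continuous.intervalIntegrable (by fun_prop) _ _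

theorem exists_isPrincipalSolution [CompleteSpace 𝔸] {A : ℝ → 𝔸} (hA : Continuous A) {M : ℝ}
    (hM : ∀ t, ‖A t‖ ≤ M) : ∃ Φ, IsPrincipalSolution A Φ := by
  have hM0 : 0 ≤ M := (norm_nonneg _).trans (hM 0)
  have hder : ∀ n t, HasDerivAt (dysonTerm A (n + 1)) (A t * dysonTerm A n t) t := by
    intro n t
    have hc := hA.mul (continuous_dysonTerm hA n)
    exact intervalIntegral.integral_hasDerivAt_right (hc.intervalIntegrable _ _)
      hc.stronglyMeasurable.stronglyMeasurableAtFilter hc.continuousAt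
  have hsum : ∀ t, Summable fun n => dysonTerm A n t := fun t => by
    refine Summable.of_norm_bounded ((Real.summable_pow_div_factorial (M * |t|)).mul_left
      ‖(1 : 𝔸)‖) fun n => ?_
    rw [mul_div_assoc']
    exact norm_dysonTerm_le hM n t
  refine ⟨fun t => ∑' n, dysonTerm A n t, ?_, fun t => ?_⟩
  · change ∑' n, dysonTerm A n 0 = 1
    rw [tsum_eq_single 0]
    · rfl
    · intro n hn
      obtain ⟨m, rfl⟩ := Nat.exists_eq_succ_of_ne_zero hn
      simp [dysonTerm]
  · set T := |t| + 1 with hT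
    have hder2 : HasDerivAt (fun t => ∑' n, dysonTerm A (n + 1) t)
        (∑' n, A t * dysonTerm A n t) t := by
      refine hasDerivAt_tsum_of_isPreconnected
        (u := fun n : ℕ => M * (‖(1 : 𝔸)‖ * ((M * T) ^ n / n.factorial)))
        (t := Metric.ball 0 T) (y₀ := 0)
        (((Real.summable_pow_div_factorial (M * T)).mul_left _).mul_left _) Metric.isOpen_ball
        (convex_ball _ _).isPreconnected (fun n s _ => hder n s) (fun n s hs => ?_) ?_ ?_ ?_
      · have hs' : |s| ≤ T := by simpa using (Metric.mem_ball.1 hs).le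
        refine (norm_mul_le _ _).trans ?_
        gcongr
        · exact hM s
        · refine (norm_dysonTerm_le hM n s).trans ?_
          rw [mul_div_assoc]
          gcongr
      · simp [hT]; positivity
      · exact (summable_nat_add_iff 1).2 (hsum 0)
      · simp [hT]
    have e : (fun t => ∑' n, dysonTerm A n t) = fun t => 1 + ∑' n, dysonTerm A (n + 1) t := by
      funext t
      exact (hsum t).tsum_eq_zero_add
    have e2 : A t * ∑' n, dysonTerm A n t = ∑' n, A t * dysonTerm A n t :=
      ((hsum t).tsum_mul_left (A t)).symm
    change HasDerivAt (fun t => ∑' n, dysonTerm A n t) (A t * ∑' n, dysonTerm A n t) t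
    rw [e2, e]
    exact hder2.const_add 1

open Classical in
/-- The principal fundamental solution of `Φ' = A Φ`; it exists and is unique for continuous bounded
`A` (`principalSolution_spec`, `IsPrincipalSolution.unique`). -/
noncomputable def principalSolution (A : ℝ → 𝔸) : ℝ → 𝔸 :=
  if h : ∃ Φ, IsPrincipalSolution A Φ then h.choose else 1

theorem principalSolution_spec [CompleteSpace 𝔸] {A : ℝ → 𝔸} (hA : Continuous A) {M : ℝ}
    (hM : ∀ t, ‖A t‖ ≤ M) : IsPrincipalSolution A (principalSolution A) := by
  have h := exists_isPrincipalSolution hA hM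
  rw [principalSolution, dif_pos h]
  exact h.choose_spec
end ODE

open scoped Matrix.Norms.L2Operator

section QuasiPeriodic

/-- The winding `t ↦ (Ω₁ t, …, Ωᵣ t)` of the torus `(ℝ / 2πℤ)ʳ`, where an angle `φ` is represented by
`φ / 2π` in `ℝ / ℤ`. A quasiperiodic function is `t ↦ Â (winding Ω t)` for a continuous `Â`. -/
noncomputable def winding {r : ℕ} (Ω : Fin r → ℝ) (t : ℝ) : UnitAddTorus (Fin r) :=
  fun j => ((Ω j * t / (2 * Real.pi) : ℝ) : UnitAddCircle)

theorem continuous_winding {r : ℕ} (Ω : Fin r → ℝ) : Continuous (winding Ω) :=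
  continuous_pi fun j => (AddCircle.continuous_mk' 1).comp (by fun_prop)

/-- `n · Ω` -/
def intDot {r : ℕ} (n : Fin r → ℤ) (Ω : Fin r → ℝ) : ℝ := ∑ j, (n j : ℝ) * Ω j

def RationallyIndependent {r : ℕ} (Ω : Fin r → ℝ) : Prop :=
  ∀ k : Fin r → ℤ, intDot k Ω = 0 → k = 0

end QuasiPeriodic

section Spectral
variable {d : ℕ} {Hbar : Matrix (Fin d) (Fin d) ℂ}

/-- The Bohr quasi-frequencies: all differences of eigenvalues, i.e. the spectrum of `[Hbar, ·]`. -/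
noncomputable def bohrFreq (hH : Hbar.IsHermitian) : Finset ℝ :=
  Finset.univ.image fun kl : Fin d × Fin d => hH.eigenvalues kl.1 - hH.eigenvalues kl.2

/-- `Ω`-congruence freedom of the Bohr quasi-frequencies. -/
def CongruenceFree {r : ℕ} (Ω : Fin r → ℝ) (hH : Hbar.IsHermitian) : Prop :=
  ∀ ω₁ ∈ bohrFreq hH, ∀ ω₂ ∈ bohrFreq hH, ∀ k : Fin r → ℤ, k ≠ 0 → ω₁ - ω₂ ≠ intDot k Ω

/-- The rank-one spectral projections `Pₖ` in `Hbar = ∑ₖ εₖ Pₖ`. -/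
noncomputable def spectralProj (hH : Hbar.IsHermitian) (k : Fin d) : Matrix (Fin d) (Fin d) ℂ :=
  Matrix.vecMulVec (WithLp.ofLp (hH.eigenvectorBasis k)) (star (WithLp.ofLp (hH.eigenvectorBasis k)))

/-- `∑ Pₖ m Pₗ` over all `(k, l)` with `εₖ - εₗ = ω`. -/
noncomputable def bohrComponent (hH : Hbar.IsHermitian) (ω : ℝ) (m : Matrix (Fin d) (Fin d) ℂ) :
    Matrix (Fin d) (Fin d) ℂ :=
  ∑ k, ∑ l, if hH.eigenvalues k - hH.eigenvalues l = ω then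
    spectralProj hH k * m * spectralProj hH l else 0

end Spectral

/-- A `d`-level system with quasiperiodic Hamiltonian `H_t = ham (Ω₁ t, …, Ωᵣ t)`, coupled to an
environment with Hilbert space `E`. -/
structure OpenSystem (d r : ℕ) (ι : Type*) [Fintype ι] (E : Type*) [NormedAddCommGroup E]
    [InnerProductSpace ℂ E] [CompleteSpace E] where
  /-- the frequencies `Ω` -/
  freq : Fin r → ℝ
  freq_pos : ∀ j, 0 < freq j
  /-- the system Hamiltonian as a function on the torus -/
  ham : C(UnitAddTorus (Fin r), Matrix (Fin d) (Fin d) ℂ)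
  ham_isHermitian : ∀ θ, (ham θ).IsHermitian
  /-- the bounded Hamiltonian of the environment -/
  envHam : E →L[ℂ] E
  envHam_isSelfAdjoint : IsSelfAdjoint envHam
  /-- the stationary density operator of the environment -/
  envState : TraceClass E
  envState_isPositive : (TraceClass.op E envState).IsPositive
  trace_envState : TraceClass.trace E envState = 1
  envState_commute : Commute envHam (TraceClass.op E envState)
  S : ι → Matrix (Fin d) (Fin d) ℂ
  R : ι → E →L[ℂ] E
  /-- `∑ S_μ ⊗ R_μ` is self-adjoint -/
  int_isSelfAdjoint : IsSelfAdjoint (∑ μ, matTensor (S μ) (R μ))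
  /-- `tr (ω_E R_μ) = 0` -/
  trace_envState_R : ∀ μ, opTrace (TraceClass.op E envState * R μ) = 0

namespace OpenSystem

open TraceClass MeasureTheory Filter Topology

variable {d r : ℕ} {ι : Type*} [Fintype ι] {E : Type*} [NormedAddCommGroup E]
  [InnerProductSpace ℂ E] [CompleteSpace E] (M : OpenSystem d r ι E)

/-- The system Hamiltonian `H_t`, for all real `t`. -/
noncomputable def sysHam (t : ℝ) : Matrix (Fin d) (Fin d) ℂ := M.ham (winding M.freq t)

/-- The unitary evolution `u_t` of the system: `u' = -i H_t u`, `u_0 = I`. -/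
noncomputable def sysEvolution : ℝ → Matrix (Fin d) (Fin d) ℂ :=
  principalSolution fun t => (-Complex.I) • M.sysHam t

/-- `H_t ⊗ I + I ⊗ H_E` -/
noncomputable def freeHam (t : ℝ) : Joint d E →L[ℂ] Joint d E :=
  matTensor (M.sysHam t) 1 + matTensor 1 M.envHam

/-- `∑ S_μ ⊗ R_μ` -/
noncomputable def intHam : Joint d E →L[ℂ] Joint d E := ∑ μ, matTensor (M.S μ) (M.R μ)

/-- The Banach space `𝓑` of trace class operators on `ℂᵈ ⊗ E`. -/
abbrev Space (_M : OpenSystem d r ι E) : Type _ := TraceClass (Joint d E)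

/-- `Z_t = -i [H_t ⊗ I + I ⊗ H_E, ·]` -/
noncomputable def freeGen (t : ℝ) : M.Space →L[ℂ] M.Space :=
  (-Complex.I) • commutator (Joint d E) (M.freeHam t)

/-- The principal fundamental solution `U_t` of `x' = Z_t x` on `𝓑`. -/
noncomputable def evolution : ℝ → M.Space →L[ℂ] M.Space := principalSolution M.freeGen

/-- The propagator `U_{t,s} = U_t U_s⁻¹`. -/
noncomputable def propagator (t s : ℝ) : M.Space →L[ℂ] M.Space :=
  M.evolution t * Ring.inverse (M.evolution s)

/-- `A = -i [H_int, ·]` -/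
noncomputable def intGen : M.Space →L[ℂ] M.Space :=
  (-Complex.I) • commutator (Joint d E) M.intHam

/-- The projection `a ↦ (tr_E a) ⊗ ω_E`. -/
noncomputable def proj0 : M.Space →L[ℂ] M.Space := tensorState M.envState ∘L partialTrace

/-- The complementary projection `id - proj0`. -/
noncomputable def proj1 : M.Space →L[ℂ] M.Space := 1 - M.proj0

/-- The subspace `𝓑₀ = M_d ⊗ ω_E`. -/
noncomputable def space0 : Submodule ℂ M.Space :=
  LinearMap.range (M.proj0 : M.Space →ₗ[ℂ] M.Space)

noncomputable def A01 : M.Space →L[ℂ] M.Space := M.proj0 * M.intGen * M.proj1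

noncomputable def A10 : M.Space →L[ℂ] M.Space := M.proj1 * M.intGen * M.proj0

/-- `f_{μν}(t) = tr (e^{i H_E t} R_μ* e^{-i H_E t} R_ν ω_E)` -/
noncomputable def autocorr (μ ν : ι) (t : ℝ) : ℂ :=
  opTrace (NormedSpace.exp ((Complex.I * t) • M.envHam) * star (M.R μ) *
    NormedSpace.exp ((-(Complex.I * t)) • M.envHam) * M.R ν * op E M.envState)

/-- `(U_{x+s,s})⁻¹ A₀₁ U_{x+s,s} A₁₀` -/
noncomputable def kernel (s x : ℝ) : M.Space →L[ℂ] M.Space :=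
  Ring.inverse (M.propagator (x + s) s) * M.A01 * M.propagator (x + s) s * M.A10

/-- `K̃_t^λ`, as an operator on `𝓑`. -/
noncomputable def Ktilde (lam t : ℝ) : M.Space →L[ℂ] M.Space :=
  ∫ x in Set.Ici (0 : ℝ), M.kernel ((lam ^ 2)⁻¹ * t) x

/-- `K` is the local average
`lim_{δ → ∞} (1 / 2δ) ∫_{-δ}^{δ} U_{λ⁻² t}⁻¹ ζ(t) U_{λ⁻² t} dt`, in operator norm. -/
def IsLocalAverage (lam : ℝ) (ζ : ℝ → M.Space →L[ℂ] M.Space) (K : M.Space →L[ℂ] M.Space) : Prop :=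
  (∀ δ, IntervalIntegrable (fun t => Ring.inverse (M.evolution ((lam ^ 2)⁻¹ * t)) * ζ t *
    M.evolution ((lam ^ 2)⁻¹ * t)) volume (-δ) δ) ∧
  Tendsto (fun δ : ℝ => (1 / (2 * δ)) • ∫ t in (-δ)..δ,
    Ring.inverse (M.evolution ((lam ^ 2)⁻¹ * t)) * ζ t * M.evolution ((lam ^ 2)⁻¹ * t))
    atTop (𝓝 K)

/-- Reducibility of the Schrödinger equation: `u_t = p_t e^{-i Hbar t}` for `t ≥ 0`, with
`p_t = p (Ω₁ t, …, Ωᵣ t)` quasiperiodic and unitary, `p_0 = I`, and `Hbar` Hermitian. -/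
structure IsReducedBy (p : C(UnitAddTorus (Fin r), Matrix (Fin d) (Fin d) ℂ))
    (Hbar : Matrix (Fin d) (Fin d) ℂ) : Prop where
  isHermitian : Hbar.IsHermitian
  unitary : ∀ t : ℝ, 0 ≤ t → p (winding M.freq t) ∈ Matrix.unitaryGroup (Fin d) ℂ
  map_zero : p 0 = 1
  eq_mul_exp : ∀ t : ℝ, 0 ≤ t →
    M.sysEvolution t = p (winding M.freq t) * NormedSpace.exp ((-(Complex.I * t)) • Hbar)

/-- `S_{μ n ω}`: the `ω`-component of the `n`-th Fourier coefficient of `p* S_μ p`. -/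
noncomputable def jump (p : C(UnitAddTorus (Fin r), Matrix (Fin d) (Fin d) ℂ))
    {Hbar : Matrix (Fin d) (Fin d) ℂ} (hH : Hbar.IsHermitian) (μ : ι) (n : Fin r → ℤ) (ω : ℝ) :
    Matrix (Fin d) (Fin d) ℂ :=
  bohrComponent hH ω
    (UnitAddTorus.mFourierCoeff (fun θ => (p θ).conjTranspose * M.S μ * p θ) n)

/-- The two-sided Fourier transform `∫_ℝ f_{μν}(x) e^{-iωx} dx`. -/
noncomputable def fourierH (μ ν : ι) (ω : ℝ) : ℂ :=
  ∫ x : ℝ, M.autocorr μ ν x * Complex.exp (-(Complex.I * ω * x))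

/-- `ζ_{μν}(ω)`, given by `∫_0^∞ f_{μν}(x) e^{-iωx} dx = h_{μν}(ω) / 2 + i ζ_{μν}(ω)`. -/
noncomputable def fourierZeta (μ ν : ι) (ω : ℝ) : ℂ :=
  ((∫ x in Set.Ici (0 : ℝ), M.autocorr μ ν x * Complex.exp (-(Complex.I * ω * x))) -
    M.fourierH μ ν ω / 2) / Complex.I

section Generator
variable (p : C(UnitAddTorus (Fin r), Matrix (Fin d) (Fin d) ℂ))
  {Hbar : Matrix (Fin d) (Fin d) ℂ} (hH : Hbar.IsHermitian)

/-- The `(μ, ν, n)` term of the Lamb shift, summed over the Bohr quasi-frequencies. -/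
noncomputable def lambShiftTerm (μ ν : ι) (n : Fin r → ℤ) : Matrix (Fin d) (Fin d) ℂ :=
  ∑ ω ∈ bohrFreq hH, M.fourierZeta μ ν (ω + intDot n M.freq) •
    ((M.jump p hH μ n ω).conjTranspose * M.jump p hH ν n ω)

/-- The Lamb shift `ΔH`. -/
noncomputable def lambShift : Matrix (Fin d) (Fin d) ℂ :=
  ∑ μ, ∑ ν, ∑' n : Fin r → ℤ, M.lambShiftTerm p hH μ ν n

/-- The `(μ, ν, n)` term of the dissipator, summed over the Bohr quasi-frequencies. -/
noncomputable def dissipatorTerm (ρ : Matrix (Fin d) (Fin d) ℂ) (μ ν : ι) (n : Fin r → ℤ) :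
    Matrix (Fin d) (Fin d) ℂ :=
  ∑ ω ∈ bohrFreq hH, M.fourierH μ ν (ω + intDot n M.freq) •
    (M.jump p hH ν n ω * ρ * (M.jump p hH μ n ω).conjTranspose -
      (1 / 2 : ℂ) • ((M.jump p hH μ n ω).conjTranspose * M.jump p hH ν n ω * ρ +
        ρ * ((M.jump p hH μ n ω).conjTranspose * M.jump p hH ν n ω)))

/-- The dissipator `D̄`. -/
noncomputable def dissipator (ρ : Matrix (Fin d) (Fin d) ℂ) : Matrix (Fin d) (Fin d) ℂ :=
  ∑ μ, ∑ ν, ∑' n : Fin r → ℤ, M.dissipatorTerm p hH ρ μ ν n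

end Generator

theorem continuous_sysHam : Continuous M.sysHam :=
  M.ham.continuous.comp (continuous_winding M.freq)

theorem norm_sysHam_le (t : ℝ) : ‖M.sysHam t‖ ≤ ‖M.ham‖ := M.ham.norm_coe_le_norm _

theorem sysEvolution_spec :
    IsPrincipalSolution (fun t => (-Complex.I) • M.sysHam t) M.sysEvolution :=
  principalSolution_spec (M := ‖M.ham‖) ((continuous_const_smul (-Complex.I)).comp M.continuous_sysHam)
    (fun t => by simpa [norm_smul] using M.norm_sysHam_le t)

theorem evolution_spec : IsPrincipalSolution M.freeGen M.evolution := by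
  set G : UnitAddTorus (Fin r) → M.Space →L[ℂ] M.Space := fun θ => (-Complex.I) •
    commutator (Joint d E) (matTensor (M.ham θ) 1 + matTensor 1 M.envHam) with hG
  have hGc : Continuous G := (continuous_const_smul (-Complex.I)).comp
    ((commutator (Joint d E)).continuous.comp
      (((continuous_matTensor 1).comp M.ham.continuous).add continuous_const))
  obtain ⟨C, hC⟩ := (isCompact_range hGc).isBounded.exists_norm_le
  exact principalSolution_spec (hGc.comp (continuous_winding M.freq))
    (fun t => hC _ (Set.mem_range_self (winding M.freq t)))

end OpenSystem

/-!
The uncoupled evolution `U_t` is conjugation by the unitary `u_t ⊗ e^{-i H_E t}`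
(`evolution_eq_sandwich`), and it commutes with the projection `𝒫₀` because `ω_E` is stationary.
Hence in the interaction picture the memory kernel is the partial trace of a double commutator of
`∑ σ_μ(t) ⊗ ρ_μ(t)` at the two times `t = x + s` and `t = s`, where `σ_μ(t) = u_t* S_μ u_t` and
`ρ_μ(t) = e^{iH_E t} R_μ e^{-iH_E t}`. Self-adjointness of the interaction and cyclicity of the
trace (`opTrace_mul_comm`) express its four terms through the scalars `f_{μν}(x)`: `U_s⁻¹ K̃ U_s`
is minus the image, under one fixed bounded real-linear map (`liftedForm`), of the finite array of
scalar integrals `∫_0^∞ f_{μν}(x) conj σ_μ(x + s)_q σ_ν(s)_q' dx`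
(`inverse_evolution_mul_Ktilde_mul`). Convergence and continuity of `K̃` follow by dominated
convergence, and the local average is the image of the averages of these scalars.

Cyclicity of the trace holds since a trace class operator `T` is a product `X √|T|` of two
Hilbert–Schmidt operators, and the trace of a product of two such operators is a double series
that may be summed in either order.

Reducibility makes the couplings quasiperiodic up to phases, `σ_μ(t) = ∑_ω e^{iωt} φ_{μω}(Ωt)`
with `ω` in the spectrum of `[H̄, ·]` (`IsReducedBy.sysCoupling_apply`). It is assumed for `t ≥ 0`
only, but the averages involve all real times; it extends because the integrated equation for `p`
is an identity between continuous functions on the torus, and the forward winding line is dense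
(`IsReducedBy.sysEvolution_eq`). For each delay `x`, twisted equidistribution of the winding
(`tendsto_average_winding`) computes the average over `s`. It kills all pairs of phases `ω₁ ≠ ω₂`,
as `Ω`-congruence freedom excludes every resonance `ω₁ - ω₂ = k · Ω`, and for equal phases it
gives the Haar integral of `conj φ(θ + Ωx) ψ(θ)`. Dominated convergence moves the limit under the
integral over `x`, and Parseval's identity turns the result into a series over the Fourier modes
`n` with coefficients `Γ_{μν}(ω + n · Ω)`, where `Γ_{μν}` is the one-sided Fourier transform of
`f_{μν}` (`tendsto_average_memory`).

Finally `f_{μν}(-x) = conj f_{νμ}(x)`, so that `Γ_{μν} = h_{μν} / 2 + i ζ_{μν}` and `conj Γ_{νμ} =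
h_{μν} / 2 - i ζ_{μν}`. The terms of the series with `ζ` add up to `-i [ΔH, ·]` and those with `h`
to `D̄` (`neg_memoryForm_limitCoeff`).
-/

/-! ### Cyclicity of the trace -/

section HilbertSchmidt
open TraceClass Filter Topology
variable {H : Type*} [NormedAddCommGroup H] [InnerProductSpace ℂ H] [CompleteSpace H]

/-- Parseval's identity in a Hilbert basis. -/
theorem HilbertBasis.hasSum_norm_inner_sq {J : Type*} (b : HilbertBasis J ℂ H) (z : H) :
    HasSum (fun i => ‖⟪b i, z⟫_ℂ‖ ^ 2) (‖z‖ ^ 2) := by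
  have h := Complex.hasSum_re (b.hasSum_inner_mul_inner z z)
  rw [← inner_self_eq_norm_sq (𝕜 := ℂ) z, RCLike.re_eq_complex_re]
  convert h using 1
  funext i
  rw [← inner_conj_symm z (b i), mul_comm, Complex.mul_conj, Complex.ofReal_re,
    Complex.normSq_eq_norm_sq]

/-- `X` is a Hilbert–Schmidt operator, tested in the basis `b`. -/
def IsHilbertSchmidtIn {J : Type*} (b : HilbertBasis J ℂ H) (X : H →L[ℂ] H) : Prop :=
  Summable fun i => ‖X (b i)‖ ^ 2

variable {J : Type*} {b : HilbertBasis J ℂ H}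

theorem IsHilbertSchmidtIn.summable_matrix {X : H →L[ℂ] H} (hX : IsHilbertSchmidtIn b X) :
    Summable fun ij : J × J => ‖⟪b ij.2, X (b ij.1)⟫_ℂ‖ ^ 2 := by
  rw [summable_prod_of_nonneg fun _ => by positivity]
  refine ⟨fun i => (b.hasSum_norm_inner_sq (X (b i))).summable, ?_⟩
  simp only [(b.hasSum_norm_inner_sq _).tsum_eq]
  exact hX

theorem IsHilbertSchmidtIn.left_mul {X : H →L[ℂ] H} (hX : IsHilbertSchmidtIn b X)
    (B : H →L[ℂ] H) : IsHilbertSchmidtIn b (B * X) := by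
  refine Summable.of_nonneg_of_le (fun _ => by positivity) (fun i => ?_) (hX.mul_left (‖B‖ ^ 2))
  rw [← mul_pow]
  exact pow_le_pow_left₀ (norm_nonneg _) (B.le_opNorm _) 2

theorem IsHilbertSchmidtIn.star {X : H →L[ℂ] H} (hX : IsHilbertSchmidtIn b X) :
    IsHilbertSchmidtIn b (star X) := by
  have h := ((Equiv.prodComm J J).summable_iff.2 hX.summable_matrix).prod
  refine h.congr fun i => ?_
  rw [← (b.hasSum_norm_inner_sq (Star.star X (b i))).tsum_eq]
  refine tsum_congr fun j => ?_
  rw [ContinuousLinearMap.star_eq_adjoint, ContinuousLinearMap.adjoint_inner_right,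
    ← inner_conj_symm, RCLike.norm_conj]
  rfl

/-- For Hilbert–Schmidt operators, `tr (X Y) = tr (Y X)`: the double series of the products of the
matrix entries converges absolutely. -/
theorem IsHilbertSchmidtIn.tsum_inner_mul_comm {X Y : H →L[ℂ] H} (hX : IsHilbertSchmidtIn b X)
    (hY : IsHilbertSchmidtIn b Y) :
    ∑' i, ⟪b i, (X * Y) (b i)⟫_ℂ = ∑' i, ⟪b i, (Y * X) (b i)⟫_ℂ := by
  have key : ∀ (X Y : H →L[ℂ] H) (i : J), ∑' j, ⟪b i, X (b j)⟫_ℂ * ⟪b j, Y (b i)⟫_ℂ =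
      ⟪b i, (X * Y) (b i)⟫_ℂ := by
    intro X Y i
    have := b.hasSum_inner_mul_inner (Star.star X (b i)) (Y (b i))
    simp only [ContinuousLinearMap.star_eq_adjoint, ContinuousLinearMap.adjoint_inner_left] at this
    exact this.tsum_eq
  have hs : Summable (Function.uncurry fun i j => ⟪b i, X (b j)⟫_ℂ * ⟪b j, Y (b i)⟫_ℂ) := by
    refine Summable.of_norm_bounded
      (((Equiv.prodComm J J).summable_iff.2 hX.summable_matrix).add hY.summable_matrix)
      fun ij => ?_
    simp only [Function.uncurry, norm_mul, Function.comp, Equiv.prodComm_apply, Prod.fst_swap,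
      Prod.snd_swap]
    nlinarith [sq_nonneg (‖⟪b ij.1, X (b ij.2)⟫_ℂ‖ - ‖⟪b ij.2, Y (b ij.1)⟫_ℂ‖),
      sq_nonneg (‖⟪b ij.1, X (b ij.2)⟫_ℂ‖), sq_nonneg (‖⟪b ij.2, Y (b ij.1)⟫_ℂ‖)]
  calc _ = ∑' i, ∑' j, ⟪b i, X (b j)⟫_ℂ * ⟪b j, Y (b i)⟫_ℂ := tsum_congr fun i => (key X Y i).symm
    _ = ∑' j, ∑' i, ⟪b i, X (b j)⟫_ℂ * ⟪b j, Y (b i)⟫_ℂ := hs.tsum_comm.symm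
    _ = _ := tsum_congr fun j => by
      rw [← key Y X j]
      exact tsum_congr fun i => mul_comm _ _

/-- Every bounded operator factors as `T = X √|T|` with `‖X z‖ = ‖√|T| z‖`. Writing
`R_ε = (|T| + ε)⁻¹`, the factor `X` is the norm limit of `T R_ε √|T|` as `ε → 0`; this replaces the
polar decomposition. -/
theorem exists_mul_sqrt_abs (T : H →L[ℂ] H) :
    ∃ X : H →L[ℂ] H, T = X * CFC.sqrt (CFC.abs T) ∧
      ∀ z, ‖X z‖ = ‖CFC.sqrt (CFC.abs T) z‖ := by
  set P := CFC.abs T with hP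
  have hP0 : 0 ≤ P := CFC.abs_nonneg T
  set A := CFC.sqrt P with hA
  have hAs : IsSelfAdjoint A := IsSelfAdjoint.of_nonneg (CFC.sqrt_nonneg P)
  have hAA : A * A = P := CFC.sqrt_mul_sqrt_self P hP0
  have hpos : ∀ n : ℕ, (0 : ℝ) < 1 / ((n : ℝ) + 1) := fun n => by positivity
  choose R hRs hcomm hsum hPR hεR using
    fun n : ℕ => exists_regularized_inverse P hP0 (1 / ((n : ℝ) + 1)) (hpos n)
  -- `‖ε R_ε A‖² = ‖(ε R_ε) P (ε R_ε)‖ ≤ ε`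
  have hsmall : ∀ n : ℕ, ‖(1 / ((n : ℝ) + 1)) • (R n * A)‖ ^ 2 ≤ 1 / ((n : ℝ) + 1) := by
    intro n
    set ε : ℝ := 1 / ((n : ℝ) + 1) with hε
    have e : (ε • (R n * A)) * star (ε • (R n * A)) = ε • ((ε • R n) * (P * R n)) := by
      rw [star_smul, star_mul, hAs.star_eq, (hRs n).star_eq, ← hAA]
      simp only [star_trivial, smul_mul_assoc, mul_smul_comm, mul_assoc]
    rw [pow_two, ← CStarRing.norm_self_mul_star, e, norm_smul, Real.norm_of_nonneg (hpos n).le]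
    refine mul_le_of_le_one_right (hpos n).le ((norm_mul_le _ _).trans ?_)
    exact mul_le_one₀ (hεR n) (norm_nonneg _) (hPR n)
  have hlim : Tendsto (fun n => P * R n * A) atTop (𝓝 A) := by
    have h0 : Tendsto (fun n : ℕ => (1 / ((n : ℝ) + 1)) • (R n * A)) atTop (𝓝 0) := by
      rw [tendsto_zero_iff_norm_tendsto_zero]
      have h1 := (tendsto_one_div_add_atTop_nhds_zero_nat (𝕜 := ℝ)).sqrt
      rw [Real.sqrt_zero] at h1
      exact squeeze_zero (fun n => norm_nonneg _) (fun n => Real.le_sqrt_of_sq_le (hsmall n)) h1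
    have e : ∀ n : ℕ, P * R n * A = A - (1 / ((n : ℝ) + 1)) • (R n * A) := by
      intro n
      have := congrArg (· * A) (hsum n)
      simp only [add_mul, one_mul, smul_mul_assoc] at this
      exact eq_sub_of_add_eq this
    simp only [e]
    simpa using tendsto_const_nhds.sub h0
  have hnorm : ∀ (Y : H →L[ℂ] H) z, ‖(T * Y) z‖ = ‖(P * Y) z‖ := fun Y z => by
    rw [mul_apply_eq_comp, ← norm_abs_apply T, ← hP, ← mul_apply_eq_comp]
  have hdist : ∀ Y Z : H →L[ℂ] H, dist (T * Y) (T * Z) ≤ dist (P * Y) (P * Z) := by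
    intro Y Z
    rw [dist_eq_norm, dist_eq_norm, ← mul_sub, ← mul_sub]
    refine ContinuousLinearMap.opNorm_le_bound _ (norm_nonneg _) fun z => ?_
    rw [hnorm]
    exact ContinuousLinearMap.le_opNorm _ _
  have hcau : CauchySeq fun n => T * R n * A := by
    have hc := hlim.cauchySeq
    rw [Metric.cauchySeq_iff] at hc ⊢
    intro ε hε
    obtain ⟨N, hN⟩ := hc ε hε
    refine ⟨N, fun m hm n hn => lt_of_le_of_lt ?_ (hN m hm n hn)⟩
    simp only [mul_assoc]
    exact hdist _ _
  obtain ⟨X, hX⟩ := cauchySeq_tendsto_of_complete hcau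
  have heval : ∀ z : H, Continuous fun Y : H →L[ℂ] H => ‖Y z‖ := fun z =>
    (ContinuousLinearMap.apply ℂ H z).continuous.norm
  refine ⟨X, ?_, fun z => ?_⟩
  · have h1 := hX.mul_const A
    have h2 := hlim.mul_const A
    have h3 : Tendsto (fun n => T * R n * A * A) atTop (𝓝 T) := by
      rw [hAA, tendsto_iff_dist_tendsto_zero] at h2
      rw [tendsto_iff_dist_tendsto_zero]
      refine squeeze_zero (fun _ => dist_nonneg) (fun n => ?_) h2
      have := hdist (R n * A * A) 1
      simpa only [mul_one, mul_assoc] using this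
    exact tendsto_nhds_unique h3 h1
  · refine tendsto_nhds_unique (((heval z).tendsto X).comp hX) ?_
    refine (((heval z).tendsto A).comp hlim).congr fun n => ?_
    simp only [Function.comp, mul_assoc]
    exact (hnorm _ z).symm

theorem isHilbertSchmidtIn_sqrt_abs (b : HilbertBasis J ℂ H) (a : TraceClass H) :
    IsHilbertSchmidtIn b (CFC.sqrt (CFC.abs (op H a))) := by
  set P := CFC.abs (op H a) with hP
  have hP0 : 0 ≤ P := CFC.abs_nonneg _
  have hAs : IsSelfAdjoint (CFC.sqrt P) := IsSelfAdjoint.of_nonneg (CFC.sqrt_nonneg P)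
  have hfin : traceNormIn b (op H a) ≠ ∞ := by
    rw [traceNormIn_eq_traceNorm]
    exact (show traceNorm (op H a) < ∞ from a.2).ne
  refine (ENNReal.summable_toReal hfin).congr fun i => ?_
  have hAA := CFC.sqrt_mul_sqrt_self P hP0
  set A := CFC.sqrt P
  rw [ENNReal.toReal_ofReal (re_inner_abs_nonneg _ _), ← hP, ← hAA, mul_apply_eq_comp]
  nth_rewrite 1 [← hAs.star_eq]
  rw [ContinuousLinearMap.star_eq_adjoint, ContinuousLinearMap.adjoint_inner_right]
  exact inner_self_eq_norm_sq (𝕜 := ℂ) (A (b i))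

/-- The trace is cyclic for the product of a trace class operator and a bounded one: with
`T = X √|T|` the three factors `X`, `√|T|`, `B` may be permuted cyclically, since at each step both
factors are Hilbert–Schmidt. -/
theorem opTrace_mul_comm (a : TraceClass H) (B : H →L[ℂ] H) :
    opTrace (op H a * B) = opTrace (B * op H a) := by
  obtain ⟨X, hT, hX⟩ := exists_mul_sqrt_abs (op H a)
  have hA := isHilbertSchmidtIn_sqrt_abs (stdBasis H) a
  set A := CFC.sqrt (CFC.abs (op H a)) with hAdef
  have hAs : IsSelfAdjoint A := IsSelfAdjoint.of_nonneg (CFC.sqrt_nonneg _)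
  have hXs : IsHilbertSchmidtIn (stdBasis H) X := by
    simp only [IsHilbertSchmidtIn, hX]
    exact hA
  have hAB : IsHilbertSchmidtIn (stdBasis H) (A * B) := by
    have := (hA.left_mul (Star.star B)).star
    rwa [star_mul, star_star, hAs.star_eq] at this
  have h1 := hXs.tsum_inner_mul_comm hAB
  have h2 := (hXs.left_mul B).tsum_inner_mul_comm hA
  rw [opTrace, opTrace, hT, mul_assoc, h1, ← mul_assoc B, h2, mul_assoc]

theorem opTrace_star (T : H →L[ℂ] H) : opTrace (star T) = (starRingEnd ℂ) (opTrace T) := by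
  rw [opTrace, opTrace, Complex.conj_tsum]
  refine tsum_congr fun i => ?_
  rw [ContinuousLinearMap.star_eq_adjoint, ContinuousLinearMap.adjoint_inner_right,
    inner_conj_symm]

end HilbertSchmidt

/-! ### Two-sided multiplication, tensor products and the partial trace -/

section SandwichAlgebra
open TraceClass
variable {H : Type*} [NormedAddCommGroup H] [InnerProductSpace ℂ H] [CompleteSpace H]

namespace TraceClass

theorem sandwich_mul (B B' A A' : H →L[ℂ] H) :
    (sandwich B A * sandwich B' A' : TraceClass H →L[ℂ] TraceClass H) =
      sandwich (B * B') (A' * A) := rfl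

theorem sandwich_one : (sandwich 1 1 : TraceClass H →L[ℂ] TraceClass H) = 1 := rfl

variable (H) in
/-- `(B, A) ↦ sandwich B A` as a bounded bilinear map. -/
noncomputable def sandwichBilin : (H →L[ℂ] H) →L[ℂ] (H →L[ℂ] H) →L[ℂ]
    (TraceClass H →L[ℂ] TraceClass H) :=
  LinearMap.mkContinuous₂
    (LinearMap.mk₂ ℂ (fun B A => sandwich B A)
      (fun B B' A => by ext a; exact op_injective (ContinuousLinearMap.ext fun z => by simp))
      (fun c B A => by ext a; exact op_injective (ContinuousLinearMap.ext fun z => by simp))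
      (fun B A A' => by ext a; exact op_injective (ContinuousLinearMap.ext fun z => by simp))
      (fun c B A => by ext a; exact op_injective (ContinuousLinearMap.ext fun z => by simp)))
    1 (fun B A => by rw [one_mul]; exact norm_sandwich_le B A)

theorem sandwichBilin_apply (B A : H →L[ℂ] H) : sandwichBilin H B A = sandwich B A := rfl

theorem commutator_eq_sandwich (X : H →L[ℂ] H) :
    commutator H X = sandwich X 1 - sandwich 1 X := rfl

/-- `tr (B a A) = tr (A B a)`. -/
theorem trace_sandwich (B A : H →L[ℂ] H) (a : TraceClass H) :
    trace H (sandwich B A a) = opTrace (A * B * op H a) := by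
  have h := opTrace_mul_comm (sandwich B 1 a) A
  rw [mul_assoc]
  exact h

end TraceClass
end SandwichAlgebra

section BipartiteAlgebra
open TraceClass
variable {d : ℕ} {E : Type*} [NormedAddCommGroup E] [InnerProductSpace ℂ E] [CompleteSpace E]

theorem matTensor_mul (m n : Matrix (Fin d) (Fin d) ℂ) (R S : E →L[ℂ] E) :
    matTensor m R * matTensor n S = matTensor (m * n) (R * S) := by
  ext v j
  rw [mul_apply_eq_comp, matTensor_apply, matTensor_apply]
  simp only [matTensor_apply, map_sum, map_smul, Finset.smul_sum, Matrix.mul_apply, Finset.sum_smul,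
    smul_smul, mul_apply_eq_comp]
  exact Finset.sum_comm

theorem matTensor_one_one : (matTensor 1 1 : Joint d E →L[ℂ] Joint d E) = 1 := by
  ext v j
  simp [matTensor_apply, Matrix.one_apply]

theorem star_matTensor (m : Matrix (Fin d) (Fin d) ℂ) (R : E →L[ℂ] E) :
    star (matTensor m R) = matTensor m.conjTranspose (star R) := by
  rw [ContinuousLinearMap.star_eq_adjoint, ContinuousLinearMap.star_eq_adjoint, eq_comm,
    ContinuousLinearMap.eq_adjoint_iff]
  intro v w
  simp only [PiLp.inner_apply, matTensor_apply, sum_inner, inner_sum, inner_smul_left,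
    inner_smul_right, ContinuousLinearMap.adjoint_inner_left, Matrix.conjTranspose_apply,
    RCLike.star_def, Complex.conj_conj]
  exact Finset.sum_comm

theorem HasDerivAt.matrix_entry {m : ℝ → Matrix (Fin d) (Fin d) ℂ}
    {m' : Matrix (Fin d) (Fin d) ℂ} {t : ℝ} (hm : HasDerivAt m m' t) (j k : Fin d) :
    HasDerivAt (fun s => m s j k) (m' j k) t :=
  ((LinearMap.toContinuousLinearMap
    (Matrix.entryLinearMap ℝ ℂ j k)).hasFDerivAt.comp_hasDerivAt t hm :)

set_option synthInstance.maxHeartbeats 400000 in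
set_option maxHeartbeats 1000000 in
theorem HasDerivAt.matTensor {m : ℝ → Matrix (Fin d) (Fin d) ℂ}
    {m' : Matrix (Fin d) (Fin d) ℂ} {R : ℝ → E →L[ℂ] E} {R' : E →L[ℂ] E} {t : ℝ}
    (hm : HasDerivAt m m' t) (hR : HasDerivAt R R' t) :
    HasDerivAt (fun s => matTensor (m s) (R s)) (matTensor m' (R t) + matTensor (m t) R') t := by
  have hC : ∀ j k : Fin d, HasDerivAt
      (fun s => (slotIn j ∘L R s ∘L slotOut k : Joint d E →L[ℂ] Joint d E))
      (slotIn j ∘L R' ∘L slotOut k) t := fun j k =>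
    (((ContinuousLinearMap.compL ℂ (Joint d E) E (Joint d E) (slotIn j) ∘L
      (ContinuousLinearMap.compL ℂ (Joint d E) E E).flip
        (slotOut k)).restrictScalars ℝ).hasFDerivAt.comp_hasDerivAt t hR :)
  have h := HasDerivAt.fun_sum (u := Finset.univ) fun j (_ : j ∈ Finset.univ) =>
    HasDerivAt.fun_sum (u := Finset.univ) fun k (_ : k ∈ Finset.univ) =>
      (hm.matrix_entry j k).fun_smul (hC j k)
  refine h.congr_deriv ?_
  simp only [_root_.matTensor, Finset.sum_add_distrib]
  exact add_comm _ _

theorem partialTrace_apply_eq_trace (a : TraceClass (Joint d E)) (j k : Fin d) :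
    partialTrace a j k = trace E (sandwich (slotOut j) (slotIn k) a) :=
  partialTrace_apply a j k

theorem slotOut_comp_matTensor (m : Matrix (Fin d) (Fin d) ℂ) (R : E →L[ℂ] E) (j : Fin d) :
    slotOut j ∘L matTensor m R = ∑ l, m j l • (R ∘L slotOut l) := by
  ext v
  simp [matTensor_apply, sum_apply]

theorem matTensor_comp_slotIn (m : Matrix (Fin d) (Fin d) ℂ) (R : E →L[ℂ] E) (k : Fin d) :
    matTensor m R ∘L slotIn k = ∑ l, m l k • (slotIn l ∘L R) := by
  ext v j
  simp [matTensor_apply, sum_apply, Pi.single_apply, apply_ite R]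

/-- `tr_E ((m ⊗ R) a (n ⊗ S)) = m (tr_E a) n` if `S R = 1`. -/
theorem partialTrace_sandwich (m n : Matrix (Fin d) (Fin d) ℂ) {R S : E →L[ℂ] E} (h : S * R = 1)
    (a : TraceClass (Joint d E)) :
    partialTrace (sandwich (matTensor m R) (matTensor n S) a) = m * partialTrace a * n := by
  ext j k
  have e : sandwich (slotOut j) (slotIn k) (sandwich (matTensor m R) (matTensor n S) a) =
      ∑ i, ∑ l, (m j l * n i k) • sandwich R S (sandwich (slotOut l) (slotIn i) a) := by
    refine op_injective (ContinuousLinearMap.ext fun v => ?_)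
    have h1 := fun w : Joint d E => DFunLike.congr_fun (slotOut_comp_matTensor m R j) w
    have h2 := DFunLike.congr_fun (matTensor_comp_slotIn n S k) v
    simp only [ContinuousLinearMap.comp_apply] at h1 h2
    simp only [op_sandwich, ContinuousLinearMap.comp_apply, h1, h2, map_sum, map_smul, sum_apply,
      smul_apply, Finset.smul_sum, smul_smul]
    refine Finset.sum_congr rfl fun x _ => Finset.sum_congr rfl fun y _ => ?_
    rw [mul_comm]
  rw [partialTrace_apply_eq_trace, e, Matrix.mul_apply]
  simp only [map_sum, map_smul, trace_sandwich R S, h, one_mul, Matrix.mul_apply, Finset.sum_mul,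
    partialTrace_apply_eq_trace, smul_eq_mul, trace_apply]
  exact Finset.sum_congr rfl fun i _ => Finset.sum_congr rfl fun l _ => by ring

theorem sandwich_tensorState (m n : Matrix (Fin d) (Fin d) ℂ) (R S : E →L[ℂ] E) (w : TraceClass E)
    (ρ : Matrix (Fin d) (Fin d) ℂ) :
    sandwich (matTensor m R) (matTensor n S) (tensorState w ρ) =
      tensorState (sandwich R S w) (m * ρ * n) := by
  refine op_injective ?_
  rw [op_sandwich, op_tensorState, op_tensorState, op_sandwich]
  change matTensor m R * (matTensor ρ (op E w) * matTensor n S) = matTensor _ (R * (op E w * S))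
  rw [matTensor_mul, matTensor_mul, mul_assoc]

theorem partialTrace_tensorState (w : TraceClass E) (ρ : Matrix (Fin d) (Fin d) ℂ) :
    partialTrace (tensorState w ρ) = trace E w • ρ := by
  ext j k
  have e : sandwich (slotOut j) (slotIn k) (tensorState w ρ) = ρ j k • w := by
    refine op_injective (ContinuousLinearMap.ext fun v => ?_)
    rw [op_sandwich, op_tensorState, map_smul]
    simp [matTensor_apply, apply_ite (op E w)]
  rw [partialTrace_apply_eq_trace, e, map_smul, Matrix.smul_apply, smul_eq_mul, smul_eq_mul,
    mul_comm]

theorem partialTrace_sandwich_tensorState (m n : Matrix (Fin d) (Fin d) ℂ) (R S : E →L[ℂ] E)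
    (w : TraceClass E) (ρ : Matrix (Fin d) (Fin d) ℂ) :
    partialTrace (sandwich (matTensor m R) (matTensor n S) (tensorState w ρ)) =
      opTrace (S * R * op E w) • (m * ρ * n) := by
  rw [sandwich_tensorState, partialTrace_tensorState, trace_sandwich]

end BipartiteAlgebra

/-! ### The evolution of the uncoupled system -/

section Exponential
variable {𝔸 : Type*} [NormedRing 𝔸] [NormedAlgebra ℂ 𝔸] [CompleteSpace 𝔸]

theorem hasDerivAt_exp_neg_I_smul (X : 𝔸) (t : ℝ) :
    HasDerivAt (fun t : ℝ => NormedSpace.exp ((-(Complex.I * t)) • X))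
      ((-Complex.I) • (X * NormedSpace.exp ((-(Complex.I * t)) • X))) t := by
  have h := (hasDerivAt_exp_smul_const' (𝕂 := ℂ) ((-Complex.I) • X) (t : ℂ)).scomp t
    Complex.ofRealCLM.hasDerivAt
  have e : ∀ s : ℝ, (s : ℂ) • (-Complex.I) • X = (-(Complex.I * s)) • X := fun s => by
    rw [smul_smul]; congr 1; ring
  have e2 : (fun u : ℂ => NormedSpace.exp (u • (-Complex.I) • X)) ∘ Complex.ofReal =
      fun t : ℝ => NormedSpace.exp ((-(Complex.I * t)) • X) := by
    funext s
    simp only [Function.comp, e]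
  rw [e2] at h
  refine h.congr_deriv ?_
  rw [e, Complex.ofRealCLM_apply, Complex.ofReal_one, one_smul, smul_mul_assoc]

theorem exp_mul_exp_neg_I_smul (X : 𝔸) (t : ℝ) :
    NormedSpace.exp ((Complex.I * t) • X) * NormedSpace.exp ((-(Complex.I * t)) • X) = 1 := by
  let _ : NormedAlgebra ℚ 𝔸 := NormedAlgebra.restrictScalars ℚ ℂ _
  rw [← NormedSpace.exp_add_of_commute (((Commute.refl _).smul_left _).smul_right _), ← add_smul]
  simp

theorem exp_neg_mul_exp_I_smul (X : 𝔸) (t : ℝ) :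
    NormedSpace.exp ((-(Complex.I * t)) • X) * NormedSpace.exp ((Complex.I * t) • X) = 1 := by
  have h := exp_mul_exp_neg_I_smul X (-t)
  push_cast at h
  rwa [mul_neg, neg_neg] at h

theorem exp_mul_of_mul_eq_smul {A P : 𝔸} {c : ℂ} (h : A * P = c • P) :
    NormedSpace.exp A * P = Complex.exp c • P := by
  have hpow : ∀ n : ℕ, A ^ n * P = c ^ n • P := by
    intro n
    induction n with
    | zero => simp
    | succ n ih => rw [pow_succ, mul_assoc, h, mul_smul_comm, ih, smul_smul, pow_succ, mul_comm]
  have h1 := (NormedSpace.exp_series_hasSum_exp' (𝕂 := ℂ) A).mul_right P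
  have h2 := (NormedSpace.exp_series_hasSum_exp' (𝕂 := ℂ) c).smul_const P
  rw [← Complex.exp_eq_exp_ℂ] at h2
  refine h1.unique (h2.congr_fun fun n => ?_)
  rw [smul_mul_assoc, hpow, smul_assoc]

theorem mul_exp_of_mul_eq_smul {A P : 𝔸} {c : ℂ} (h : P * A = c • P) :
    P * NormedSpace.exp A = Complex.exp c • P := by
  have hpow : ∀ n : ℕ, P * A ^ n = c ^ n • P := by
    intro n
    induction n with
    | zero => simp
    | succ n ih => rw [pow_succ, ← mul_assoc, ih, smul_mul_assoc, h, smul_smul, pow_succ]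
  have h1 := (NormedSpace.exp_series_hasSum_exp' (𝕂 := ℂ) A).mul_left P
  have h2 := (NormedSpace.exp_series_hasSum_exp' (𝕂 := ℂ) c).smul_const P
  rw [← Complex.exp_eq_exp_ℂ] at h2
  refine h1.unique (h2.congr_fun fun n => ?_)
  rw [mul_smul_comm, hpow, smul_assoc]

end Exponential

namespace OpenSystem
open TraceClass MeasureTheory Filter Topology

variable {d r : ℕ} {ι : Type*} [Fintype ι] {E : Type*} [NormedAddCommGroup E]
  [InnerProductSpace ℂ E] [CompleteSpace E] (M : OpenSystem d r ι E)

/-- The evolution `e^{-i H_E t}` of the environment. -/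
noncomputable def envEvolution (t : ℝ) : E →L[ℂ] E :=
  NormedSpace.exp ((-(Complex.I * t)) • M.envHam)

theorem star_envEvolution (t : ℝ) :
    star (M.envEvolution t) = NormedSpace.exp ((Complex.I * t) • M.envHam) := by
  rw [envEvolution, NormedSpace.star_exp, star_smul, M.envHam_isSelfAdjoint.star_eq]
  simp

theorem envEvolution_add (s t : ℝ) :
    M.envEvolution (s + t) = M.envEvolution s * M.envEvolution t := by
  let _ : NormedAlgebra ℚ (E →L[ℂ] E) := NormedAlgebra.restrictScalars ℚ ℂ _
  rw [envEvolution, envEvolution, envEvolution, ← NormedSpace.exp_add_of_commute, ← add_smul]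
  · push_cast; ring_nf
  · exact ((Commute.refl _).smul_left _).smul_right _

theorem envEvolution_zero : M.envEvolution 0 = 1 := by simp [envEvolution]

theorem star_envEvolution_eq_neg (t : ℝ) : star (M.envEvolution t) = M.envEvolution (-t) := by
  rw [star_envEvolution, envEvolution]
  simp

theorem star_envEvolution_mul (t : ℝ) : star (M.envEvolution t) * M.envEvolution t = 1 := by
  rw [star_envEvolution_eq_neg, ← envEvolution_add, neg_add_cancel, envEvolution_zero]

theorem envEvolution_mul_star (t : ℝ) : M.envEvolution t * star (M.envEvolution t) = 1 := by
  rw [star_envEvolution_eq_neg, ← envEvolution_add, add_neg_cancel, envEvolution_zero]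

theorem commute_envEvolution_envState (t : ℝ) :
    Commute (M.envEvolution t) (op E M.envState) :=
  (M.envState_commute.smul_left _).exp_left

theorem hasDerivAt_envEvolution (t : ℝ) :
    HasDerivAt M.envEvolution ((-Complex.I) • (M.envHam * M.envEvolution t)) t :=
  hasDerivAt_exp_neg_I_smul M.envHam t

theorem star_sysEvolution_mul (t : ℝ) : star (M.sysEvolution t) * M.sysEvolution t = 1 := by
  have hd : ∀ s, HasDerivAt (fun s => star (M.sysEvolution s) * M.sysEvolution s) 0 s := by
    intro s
    have h := M.sysEvolution_spec.2 s
    refine (h.star.mul h).congr_deriv ?_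
    have hh : star (M.sysHam s) = M.sysHam s := M.ham_isHermitian _
    rw [star_mul, star_smul, hh]
    simp [mul_assoc]
  have h := is_const_of_deriv_eq_zero (fun s => (hd s).differentiableAt) (fun s => (hd s).deriv) t 0
  simpa only [M.sysEvolution_spec.1, star_one, mul_one] using h

theorem sysEvolution_mul_star (t : ℝ) : M.sysEvolution t * star (M.sysEvolution t) = 1 :=
  mul_eq_one_comm.1 (M.star_sysEvolution_mul t)

theorem continuous_sysEvolution : Continuous M.sysEvolution :=
  continuous_iff_continuousAt.2 fun t => (M.sysEvolution_spec.2 t).continuousAt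

/-- The unitary evolution `u_t ⊗ e^{-i H_E t}` of the uncoupled joint system. -/
noncomputable def jointEvolution (t : ℝ) : Joint d E →L[ℂ] Joint d E :=
  matTensor (M.sysEvolution t) (M.envEvolution t)

theorem star_jointEvolution (t : ℝ) : star (M.jointEvolution t) =
    matTensor (star (M.sysEvolution t)) (star (M.envEvolution t)) := star_matTensor _ _

theorem star_jointEvolution_mul (t : ℝ) : star (M.jointEvolution t) * M.jointEvolution t = 1 := by
  rw [star_jointEvolution, jointEvolution, matTensor_mul, star_sysEvolution_mul,
    star_envEvolution_mul, matTensor_one_one]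

theorem jointEvolution_mul_star (t : ℝ) : M.jointEvolution t * star (M.jointEvolution t) = 1 := by
  rw [star_jointEvolution, jointEvolution, matTensor_mul, sysEvolution_mul_star,
    envEvolution_mul_star, matTensor_one_one]

theorem hasDerivAt_jointEvolution (t : ℝ) :
    HasDerivAt M.jointEvolution ((-Complex.I) • (M.freeHam t * M.jointEvolution t)) t := by
  refine ((M.sysEvolution_spec.2 t).matTensor (M.hasDerivAt_envEvolution t)).congr_deriv ?_
  have e1 : ∀ (c : ℂ) (m : Matrix (Fin d) (Fin d) ℂ) (R : E →L[ℂ] E),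
      matTensor (c • m) R = c • matTensor m R := fun c m R => by
    ext v j; simp [matTensor_apply, Finset.smul_sum, smul_smul]
  have e2 : ∀ (c : ℂ) (m : Matrix (Fin d) (Fin d) ℂ) (R : E →L[ℂ] E),
      matTensor m (c • R) = c • matTensor m R := fun c m R => by
    ext v j; simp [matTensor_apply, Finset.smul_sum, smul_smul, mul_comm]
  rw [smul_mul_assoc, e1, e2, freeHam, jointEvolution, add_mul, matTensor_mul, matTensor_mul,
    one_mul, one_mul, smul_add]

theorem freeHam_isSelfAdjoint (t : ℝ) : star (M.freeHam t) = M.freeHam t := by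
  rw [freeHam, ContinuousLinearMap.star_eq_adjoint, map_add, ← ContinuousLinearMap.star_eq_adjoint,
    ← ContinuousLinearMap.star_eq_adjoint, star_matTensor, star_matTensor,
    M.envHam_isSelfAdjoint.star_eq, star_one,
    Matrix.conjTranspose_one, (show (M.sysHam t).conjTranspose = M.sysHam t from
    M.ham_isHermitian _)]

theorem exists_norm_freeGen_le : ∃ C, ∀ t, ‖M.freeGen t‖ ≤ C := by
  have hGc : Continuous fun θ : UnitAddTorus (Fin r) => (-Complex.I) •
      commutator (Joint d E) (matTensor (M.ham θ) 1 + matTensor 1 M.envHam) :=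
    (continuous_const_smul (-Complex.I)).comp ((commutator (Joint d E)).continuous.comp
      (((continuous_matTensor 1).comp M.ham.continuous).add continuous_const))
  obtain ⟨C, hC⟩ := (isCompact_range hGc).isBounded.exists_norm_le
  exact ⟨C, fun t => hC _ (Set.mem_range_self (winding M.freq t))⟩

set_option synthInstance.maxHeartbeats 400000 in
set_option maxHeartbeats 1000000 in
/-- The evolution of the uncoupled system is conjugation by the unitary `u_t ⊗ e^{-i H_E t}`. -/
theorem evolution_eq_sandwich (t : ℝ) :
    M.evolution t = sandwich (M.jointEvolution t) (star (M.jointEvolution t)) := by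
  obtain ⟨C, hC⟩ := M.exists_norm_freeGen_le
  have h : IsPrincipalSolution M.freeGen
      fun t => sandwich (M.jointEvolution t) (star (M.jointEvolution t)) := by
    refine ⟨?_, fun t => ?_⟩
    · have : M.jointEvolution 0 = 1 := by
        rw [jointEvolution, M.sysEvolution_spec.1, envEvolution_zero, matTensor_one_one]
      simp only [this, star_one, sandwich_one]
    · have hV := M.hasDerivAt_jointEvolution t
      have h := ((sandwichBilin (Joint d E)).bilinearRestrictScalars ℝ).hasDerivAt_of_bilinear
        (fun _ => hV) (fun _ => hV.star)
      refine h.congr_deriv ?_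
      set V := M.jointEvolution t
      change sandwichBilin _ _ _ + sandwichBilin _ _ _ = _
      rw [freeGen, commutator_eq_sandwich, star_smul, star_mul, freeHam_isSelfAdjoint]
      simp only [map_smul, smul_apply, sandwichBilin_apply, smul_mul_assoc, sub_mul, sandwich_mul,
        one_mul, mul_one, star_neg, smul_sub]
      simp
      abel
  exact congrFun (IsPrincipalSolution.unique hC M.evolution_spec h) t

theorem evolution_mul_sandwich (t : ℝ) :
    M.evolution t * sandwich (star (M.jointEvolution t)) (M.jointEvolution t) = 1 := by
  rw [evolution_eq_sandwich, sandwich_mul, jointEvolution_mul_star, sandwich_one]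

theorem sandwich_mul_evolution (t : ℝ) :
    sandwich (star (M.jointEvolution t)) (M.jointEvolution t) * M.evolution t = 1 := by
  rw [evolution_eq_sandwich, sandwich_mul, star_jointEvolution_mul, sandwich_one]

theorem isUnit_evolution (t : ℝ) : IsUnit (M.evolution t) :=
  ⟨⟨_, _, M.evolution_mul_sandwich t, M.sandwich_mul_evolution t⟩, rfl⟩

theorem inverse_evolution (t : ℝ) : Ring.inverse (M.evolution t) =
    sandwich (star (M.jointEvolution t)) (M.jointEvolution t) :=
  Ring.inverse_unit ⟨_, _, M.evolution_mul_sandwich t, M.sandwich_mul_evolution t⟩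

theorem continuous_evolution : Continuous M.evolution :=
  continuous_iff_continuousAt.2 fun t => (M.evolution_spec.2 t).continuousAt

theorem continuous_inverse_evolution : Continuous fun t => Ring.inverse (M.evolution t) := by
  refine continuous_iff_continuousAt.2 fun t => ?_
  obtain ⟨u, hu⟩ := M.isUnit_evolution t
  have := NormedRing.inverse_continuousAt u
  rw [hu] at this
  exact ContinuousAt.comp this M.continuous_evolution.continuousAt

theorem proj0_apply (a : M.Space) : M.proj0 a = tensorState M.envState (partialTrace a) := rfl

theorem commute_evolution_proj0 (t : ℝ) : Commute (M.evolution t) M.proj0 := by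
  refine ContinuousLinearMap.ext fun a => ?_
  have hw : sandwich (M.envEvolution t) (star (M.envEvolution t)) M.envState = M.envState := by
    refine op_injective ?_
    rw [op_sandwich]
    change M.envEvolution t * (op E M.envState * star (M.envEvolution t)) = _
    rw [← mul_assoc, (M.commute_envEvolution_envState t).eq, mul_assoc, envEvolution_mul_star,
      mul_one]
  rw [mul_apply_eq_comp, mul_apply_eq_comp, proj0_apply, proj0_apply, evolution_eq_sandwich,
    star_jointEvolution, jointEvolution, sandwich_tensorState, hw,
    partialTrace_sandwich _ _ (M.star_envEvolution_mul t)]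

end OpenSystem

/-! ### The memory kernel in the interaction picture -/

section MemoryForm
variable {d : ℕ}

/-- The products `conj X_q Y_q'` of the entries of two matrices: the coordinates of `conj X ⊗ Y`.
Integrals and averages over time are taken of these finitely many scalars, and carried over to
operators by the bounded real-linear map `memoryForm`. -/
def entryProducts (X Y : Matrix (Fin d) (Fin d) ℂ) : (Fin d × Fin d) × (Fin d × Fin d) → ℂ :=
  fun q => (starRingEnd ℂ) (X q.1.1 q.1.2) * Y q.2.1 q.2.2

/-- `ρ ↦ X* Y ρ - Y ρ X*` -/
noncomputable def leftForm (X Y : Matrix (Fin d) (Fin d) ℂ) :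
    Matrix (Fin d) (Fin d) ℂ →L[ℂ] Matrix (Fin d) (Fin d) ℂ :=
  LinearMap.toContinuousLinearMap (LinearMap.mulLeft ℂ (X.conjTranspose * Y) -
    LinearMap.mulLeft ℂ Y ∘ₗ LinearMap.mulRight ℂ X.conjTranspose)

/-- `ρ ↦ ρ Y* X - X ρ Y*` -/
noncomputable def rightForm (X Y : Matrix (Fin d) (Fin d) ℂ) :
    Matrix (Fin d) (Fin d) ℂ →L[ℂ] Matrix (Fin d) (Fin d) ℂ :=
  LinearMap.toContinuousLinearMap (LinearMap.mulRight ℂ (Y.conjTranspose * X) -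
    LinearMap.mulLeft ℂ X ∘ₗ LinearMap.mulRight ℂ Y.conjTranspose)

theorem leftForm_apply (X Y ρ : Matrix (Fin d) (Fin d) ℂ) :
    leftForm X Y ρ = X.conjTranspose * Y * ρ - Y * ρ * X.conjTranspose := by
  simp [leftForm, mul_assoc]

theorem rightForm_apply (X Y ρ : Matrix (Fin d) (Fin d) ℂ) :
    rightForm X Y ρ = ρ * (Y.conjTranspose * X) - X * ρ * Y.conjTranspose := by
  simp [rightForm, mul_assoc]

/-- The real-linear map of the entry products under which `z conj X ⊗ Y` goes to
`ρ ↦ z (X* Y ρ - Y ρ X*) + conj z (ρ Y* X - X ρ Y*)`, see `memoryForm_smul_entryProducts`. -/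
noncomputable def memoryForm : ((Fin d × Fin d) × (Fin d × Fin d) → ℂ) →L[ℝ]
    (Matrix (Fin d) (Fin d) ℂ →L[ℂ] Matrix (Fin d) (Fin d) ℂ) :=
  LinearMap.toContinuousLinearMap
    { toFun := fun c => ∑ q, (c q • leftForm (Matrix.single q.1.1 q.1.2 1)
          (Matrix.single q.2.1 q.2.2 1) +
        (starRingEnd ℂ) (c q) • rightForm (Matrix.single q.1.1 q.1.2 1)
          (Matrix.single q.2.1 q.2.2 1))
      map_add' := fun c c' => by
        rw [← Finset.sum_add_distrib]
        refine Finset.sum_congr rfl fun q _ => ?_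
        ext1 ρ
        simp only [Pi.add_apply, map_add, add_smul, add_apply, smul_apply]
        abel
      map_smul' := fun x c => by
        rw [Finset.smul_sum]
        refine Finset.sum_congr rfl fun q _ => ?_
        ext1 ρ
        simp only [Pi.smul_apply, Complex.real_smul, map_mul, Complex.conj_ofReal, mul_smul,
          RingHom.id_apply, smul_add, add_apply, smul_apply, Complex.coe_smul] }

theorem memoryForm_apply (c : (Fin d × Fin d) × (Fin d × Fin d) → ℂ) :
    memoryForm c = ∑ q, (c q • leftForm (Matrix.single q.1.1 q.1.2 1)
        (Matrix.single q.2.1 q.2.2 1) +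
      (starRingEnd ℂ) (c q) • rightForm (Matrix.single q.1.1 q.1.2 1)
        (Matrix.single q.2.1 q.2.2 1)) := rfl

theorem sum_smul_single (X : Matrix (Fin d) (Fin d) ℂ) :
    ∑ q : Fin d × Fin d, X q.1 q.2 • Matrix.single q.1 q.2 (1 : ℂ) = X := by
  rw [Fintype.sum_prod_type]
  simp only [Matrix.smul_single, smul_eq_mul, mul_one]
  exact (Matrix.matrix_eq_sum_single X).symm

theorem sum_entryProducts_smul_leftForm (X Y : Matrix (Fin d) (Fin d) ℂ) :
    ∑ q, entryProducts X Y q • leftForm (Matrix.single q.1.1 q.1.2 1)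
      (Matrix.single q.2.1 q.2.2 1) = leftForm X Y := by
  ext1 ρ
  simp only [sum_apply, smul_apply, leftForm_apply, entryProducts]
  conv_rhs => rw [← sum_smul_single X, ← sum_smul_single Y]
  simp only [Matrix.conjTranspose_sum, Matrix.conjTranspose_smul, Finset.sum_mul, Finset.mul_sum,
    smul_mul_assoc, mul_smul_comm, smul_sub, RCLike.star_def, Finset.smul_sum, smul_smul,
    Finset.sum_sub_distrib]
  congr 1
  · rw [Fintype.sum_prod_type, Finset.sum_comm]
    simp only [mul_comm]
  · rw [Fintype.sum_prod_type]

theorem sum_entryProducts_smul_rightForm (X Y : Matrix (Fin d) (Fin d) ℂ) :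
    ∑ q, (starRingEnd ℂ) (entryProducts X Y q) • rightForm (Matrix.single q.1.1 q.1.2 1)
      (Matrix.single q.2.1 q.2.2 1) = rightForm X Y := by
  ext1 ρ
  simp only [sum_apply, smul_apply, rightForm_apply, entryProducts]
  conv_rhs => rw [← sum_smul_single X, ← sum_smul_single Y]
  simp only [Matrix.conjTranspose_sum, Matrix.conjTranspose_smul, Finset.sum_mul, Finset.mul_sum,
    smul_mul_assoc, mul_smul_comm, smul_sub, RCLike.star_def, Finset.smul_sum, smul_smul,
    Finset.sum_sub_distrib, map_mul, Complex.conj_conj]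
  congr 1
  · rw [Fintype.sum_prod_type]
  · rw [Fintype.sum_prod_type, Finset.sum_comm]
    simp only [mul_comm]

theorem memoryForm_smul_entryProducts (z : ℂ) (X Y : Matrix (Fin d) (Fin d) ℂ) :
    memoryForm (z • entryProducts X Y) =
      z • leftForm X Y + (starRingEnd ℂ) z • rightForm X Y := by
  rw [memoryForm_apply, Finset.sum_add_distrib, ← sum_entryProducts_smul_leftForm X Y,
    ← sum_entryProducts_smul_rightForm X Y, Finset.smul_sum, Finset.smul_sum]
  simp only [Pi.smul_apply, smul_eq_mul, map_mul, mul_smul]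

end MemoryForm

section DoubleCommutator
open TraceClass
variable {d : ℕ} {ι : Type*} [Fintype ι] {E : Type*} [NormedAddCommGroup E]
  [InnerProductSpace ℂ E] [CompleteSpace E]

theorem commutator_commutator_apply {H : Type*} [NormedAddCommGroup H] [InnerProductSpace ℂ H]
    [CompleteSpace H] (S T : H →L[ℂ] H) (b : TraceClass H) :
    commutator H S (commutator H T b) =
      sandwich (S * T) 1 b - sandwich T S b - sandwich S T b + sandwich 1 (T * S) b := by
  refine op_injective ?_
  simp only [op_commutator, map_sub, map_add, op_sandwich]
  change _ = (S * T) * (op H b * 1) - T * (op H b * S) - S * (op H b * T) + 1 * (op H b * (T * S))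
  noncomm_ring

theorem star_sum_matTensor (X : ι → Matrix (Fin d) (Fin d) ℂ) (B : ι → E →L[ℂ] E) :
    star (∑ μ, matTensor (X μ) (B μ)) = ∑ μ, matTensor (X μ).conjTranspose (star (B μ)) := by
  rw [ContinuousLinearMap.star_eq_adjoint, map_sum]
  simp only [← ContinuousLinearMap.star_eq_adjoint, star_matTensor]

theorem sandwich_sum_sum {H : Type*} [NormedAddCommGroup H] [InnerProductSpace ℂ H]
    [CompleteSpace H] (f g : ι → H →L[ℂ] H) (b : TraceClass H) :
    sandwich (∑ μ, f μ) (∑ ν, g ν) b = ∑ μ, ∑ ν, sandwich (f μ) (g ν) b := by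
  simp only [← sandwichBilin_apply, map_sum, sum_apply]
  exact Finset.sum_comm

/-- The partial trace of `[S, [T, ρ ⊗ w]]` for self-adjoint `S = ∑ X_μ ⊗ B_μ`, `T = ∑ Y_ν ⊗ C_ν`.
Using `S = S*` or `T = T*` in each of the four terms, all coefficients become the correlations
`tr (B_μ* C_ν w)` or their conjugates. -/
theorem partialTrace_commutator_commutator (X Y : ι → Matrix (Fin d) (Fin d) ℂ)
    (B C : ι → E →L[ℂ] E) (hX : IsSelfAdjoint (∑ μ, matTensor (X μ) (B μ)))
    (hY : IsSelfAdjoint (∑ μ, matTensor (Y μ) (C μ))) (w : TraceClass E)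
    (hw : IsSelfAdjoint (op E w)) (ρ : Matrix (Fin d) (Fin d) ℂ) :
    partialTrace (commutator (Joint d E) (∑ μ, matTensor (X μ) (B μ))
      (commutator (Joint d E) (∑ ν, matTensor (Y ν) (C ν)) (tensorState w ρ))) =
    ∑ μ, ∑ ν, memoryForm (opTrace (star (B μ) * C ν * op E w) •
      entryProducts (X μ) (Y ν)) ρ := by
  have hX' := hX.star_eq
  have hY' := hY.star_eq
  rw [star_sum_matTensor] at hX' hY'
  have mulsum : ∀ f g : ι → Joint d E →L[ℂ] Joint d E,
      (∑ μ, f μ) * ∑ ν, g ν = ∑ μ, ∑ ν, f μ * g ν := fun f g => Finset.sum_mul_sum _ _ _ _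
  -- `S = S*` is used in the first two terms and `T = T*` in the last two
  have t1 : partialTrace (sandwich ((∑ μ, matTensor (X μ) (B μ)) * ∑ ν, matTensor (Y ν) (C ν)) 1
      (tensorState w ρ)) = ∑ μ, ∑ ν, opTrace (star (B μ) * C ν * op E w) •
        ((X μ).conjTranspose * Y ν * ρ) := by
    rw [← hX', mulsum]
    simp only [matTensor_mul, ← sandwichBilin_apply, map_sum, sum_apply]
    simp only [sandwichBilin_apply]
    refine Finset.sum_congr rfl fun μ _ => Finset.sum_congr rfl fun ν _ => ?_
    rw [← matTensor_one_one, partialTrace_sandwich_tensorState, one_mul, mul_one]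
  have t2 : partialTrace (sandwich (∑ ν, matTensor (Y ν) (C ν)) (∑ μ, matTensor (X μ) (B μ))
      (tensorState w ρ)) = ∑ μ, ∑ ν, opTrace (star (B μ) * C ν * op E w) •
        (Y ν * ρ * (X μ).conjTranspose) := by
    rw [← hX', sandwich_sum_sum, Finset.sum_comm]
    simp only [map_sum, partialTrace_sandwich_tensorState]
  have hconj : ∀ μ ν, opTrace (star (C ν) * B μ * op E w) =
      (starRingEnd ℂ) (opTrace (star (B μ) * C ν * op E w)) := by
    intro μ ν
    rw [← opTrace_star, star_mul, star_mul, star_star, hw.star_eq, opTrace_mul_comm]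
  have t3 : partialTrace (sandwich (∑ μ, matTensor (X μ) (B μ)) (∑ ν, matTensor (Y ν) (C ν))
      (tensorState w ρ)) = ∑ μ, ∑ ν, (starRingEnd ℂ) (opTrace (star (B μ) * C ν * op E w)) •
        (X μ * ρ * (Y ν).conjTranspose) := by
    rw [← hY', sandwich_sum_sum]
    simp only [map_sum, partialTrace_sandwich_tensorState, hconj]
  have t4 : partialTrace (sandwich 1 ((∑ ν, matTensor (Y ν) (C ν)) * ∑ μ, matTensor (X μ) (B μ))
      (tensorState w ρ)) = ∑ μ, ∑ ν, (starRingEnd ℂ) (opTrace (star (B μ) * C ν * op E w)) •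
        (ρ * ((Y ν).conjTranspose * X μ)) := by
    rw [← hY', mulsum]
    simp only [matTensor_mul, ← sandwichBilin_apply, map_sum, sum_apply]
    simp only [sandwichBilin_apply]
    rw [Finset.sum_comm]
    refine Finset.sum_congr rfl fun μ _ => Finset.sum_congr rfl fun ν _ => ?_
    rw [← matTensor_one_one, partialTrace_sandwich_tensorState, one_mul, mul_one, hconj]
  rw [commutator_commutator_apply, map_add, map_sub, map_sub, t1, t2, t3, t4]
  simp only [memoryForm_smul_entryProducts, add_apply, smul_apply, leftForm_apply, rightForm_apply,
    smul_sub, Finset.sum_add_distrib, Finset.sum_sub_distrib]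
  abel

end DoubleCommutator

namespace OpenSystem
open TraceClass MeasureTheory Filter Topology

variable {d r : ℕ} {ι : Type*} [Fintype ι] {E : Type*} [NormedAddCommGroup E]
  [InnerProductSpace ℂ E] [CompleteSpace E] (M : OpenSystem d r ι E)

/-- The coupling `u_t* S_μ u_t` in the interaction picture. -/
noncomputable def sysCoupling (μ : ι) (t : ℝ) : Matrix (Fin d) (Fin d) ℂ :=
  star (M.sysEvolution t) * M.S μ * M.sysEvolution t

/-- The coupling `e^{i H_E t} R_μ e^{-i H_E t}` in the interaction picture. -/
noncomputable def envCoupling (μ : ι) (t : ℝ) : E →L[ℂ] E :=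
  star (M.envEvolution t) * M.R μ * M.envEvolution t

/-- `H_int` in the interaction picture. -/
noncomputable def intHamAt (t : ℝ) : Joint d E →L[ℂ] Joint d E :=
  ∑ μ, matTensor (M.sysCoupling μ t) (M.envCoupling μ t)

theorem intHamAt_eq (t : ℝ) :
    M.intHamAt t = star (M.jointEvolution t) * M.intHam * M.jointEvolution t := by
  rw [intHam, Finset.mul_sum, Finset.sum_mul, intHamAt, star_jointEvolution]
  simp only [jointEvolution, matTensor_mul, sysCoupling, envCoupling]

theorem intHamAt_isSelfAdjoint (t : ℝ) : IsSelfAdjoint (M.intHamAt t) := by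
  have h : star M.intHam = M.intHam := M.int_isSelfAdjoint.star_eq
  rw [intHamAt_eq]
  change star _ = _
  rw [star_mul, star_mul, star_star, h, mul_assoc]

theorem envState_isSelfAdjoint : IsSelfAdjoint (op E M.envState) :=
  M.envState_isPositive.isSelfAdjoint

/-- The condition `tr (ω_E R_μ) = 0` removes the diagonal block of `A` on `𝓑₀`. -/
theorem proj0_mul_intGen_mul_proj0 : M.proj0 * M.intGen * M.proj0 = 0 := by
  refine ContinuousLinearMap.ext fun a => ?_
  set ρ := partialTrace a
  have h1 : partialTrace (sandwich M.intHam 1 (tensorState M.envState ρ)) = 0 := by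
    rw [intHam, ← sandwichBilin_apply, map_sum, sum_apply, sum_apply, map_sum]
    refine Finset.sum_eq_zero fun μ _ => ?_
    rw [sandwichBilin_apply, ← matTensor_one_one, partialTrace_sandwich_tensorState, one_mul,
      ← opTrace_mul_comm, M.trace_envState_R, zero_smul]
  have h2 : partialTrace (sandwich 1 M.intHam (tensorState M.envState ρ)) = 0 := by
    rw [intHam, ← sandwichBilin_apply, map_sum, sum_apply, map_sum]
    refine Finset.sum_eq_zero fun μ _ => ?_
    rw [sandwichBilin_apply, ← matTensor_one_one, partialTrace_sandwich_tensorState, mul_one,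
      ← opTrace_mul_comm, M.trace_envState_R, zero_smul]
  change tensorState M.envState (partialTrace (M.intGen (tensorState M.envState ρ))) = 0
  rw [intGen, commutator_eq_sandwich, smul_apply, sub_apply, map_smul, map_sub, h1, h2]
  simp

theorem A01_eq : M.A01 = M.proj0 * M.intGen := by
  rw [A01, proj1, mul_sub, mul_one, proj0_mul_intGen_mul_proj0, sub_zero]

theorem A10_eq : M.A10 = M.intGen * M.proj0 := by
  rw [A10, proj1, sub_mul, sub_mul, one_mul, proj0_mul_intGen_mul_proj0, sub_zero]

theorem inverse_evolution_mul_intGen_mul (t : ℝ) :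
    Ring.inverse (M.evolution t) * M.intGen * M.evolution t =
      (-Complex.I) • commutator (Joint d E) (M.intHamAt t) := by
  rw [intGen, commutator_eq_sandwich, commutator_eq_sandwich, inverse_evolution,
    evolution_eq_sandwich, mul_smul_comm, smul_mul_assoc, mul_sub, sub_mul, sandwich_mul,
    sandwich_mul, sandwich_mul, sandwich_mul, intHamAt_eq, mul_one, one_mul, star_jointEvolution_mul,
    mul_assoc (star (M.jointEvolution t))]

/-- The correlations of the environment are stationary, since `ω_E` commutes with `H_E`. -/
theorem opTrace_envCoupling (μ ν : ι) (s x : ℝ) :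
    opTrace (star (M.envCoupling μ (x + s)) * M.envCoupling ν s * op E M.envState) =
      M.autocorr μ ν x := by
  set w := op E M.envState
  have hc : Commute (M.envEvolution s) w := M.commute_envEvolution_envState s
  have e1 : M.envEvolution (x + s) * star (M.envEvolution s) = M.envEvolution x := by
    rw [star_envEvolution_eq_neg, ← envEvolution_add, add_neg_cancel_right]
  have e2 : M.envEvolution s * star (M.envEvolution (x + s)) = star (M.envEvolution x) := by
    rw [← e1, star_mul, star_star]
  have e3 : star (M.envCoupling μ (x + s)) * M.envCoupling ν s * w =
      (star (M.envEvolution (x + s)) * star (M.R μ) * M.envEvolution x * M.R ν) *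
        (w * M.envEvolution s) := by
    rw [← hc.eq, ← e1, envCoupling, envCoupling, star_mul, star_mul, star_star]
    simp only [mul_assoc]
  have e4 := opTrace_mul_comm (sandwich (star (M.envEvolution (x + s)) * star (M.R μ) *
    M.envEvolution x * M.R ν) 1 M.envState) (M.envEvolution s)
  have e5 : op E (sandwich (star (M.envEvolution (x + s)) * star (M.R μ) *
    M.envEvolution x * M.R ν) 1 M.envState) = (star (M.envEvolution (x + s)) * star (M.R μ) *
    M.envEvolution x * M.R ν) * w := rfl
  rw [e3, ← mul_assoc, ← e5, e4, e5, autocorr, ← star_envEvolution]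
  simp only [← mul_assoc, e2]
  rfl

theorem autocorr_neg (μ ν : ι) (x : ℝ) :
    M.autocorr μ ν (-x) = (starRingEnd ℂ) (M.autocorr ν μ x) := by
  have h := M.opTrace_envCoupling μ ν x (-x)
  rw [← h, ← M.opTrace_envCoupling ν μ 0 x, ← opTrace_star, neg_add_cancel, add_zero, star_mul,
    star_mul, star_star, M.envState_isSelfAdjoint.star_eq, opTrace_mul_comm]

/-- An operator on matrices, extended to the joint system through the projection onto `𝓑₀`. -/
noncomputable def lift : (Matrix (Fin d) (Fin d) ℂ →L[ℂ] Matrix (Fin d) (Fin d) ℂ) →ₗ[ℂ]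
    (M.Space →L[ℂ] M.Space) where
  toFun T := tensorState M.envState ∘L T ∘L partialTrace
  map_add' S T := by ext1 a; simp
  map_smul' c T := by ext1 a; simp

/-- In the interaction picture the kernel is the double commutator of the couplings at the times
`x + s` and `s`, projected onto `𝓑₀`. The evolution leaves the projection invariant, so that it can be
moved past the propagators. -/
theorem inverse_evolution_mul_kernel_mul (s x : ℝ) :
    Ring.inverse (M.evolution s) * M.kernel s x * M.evolution s =
      -M.lift (∑ μ, ∑ ν, memoryForm (M.autocorr μ ν x •
        entryProducts (M.sysCoupling μ (x + s)) (M.sysCoupling ν s))) := by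
  obtain ⟨u, hu⟩ := M.isUnit_evolution s
  obtain ⟨v, hv⟩ := M.isUnit_evolution (x + s)
  have hcu := (M.commute_evolution_proj0 s).eq
  have hcv : ∀ T, ↑v⁻¹ * (M.proj0 * T) = M.proj0 * (↑v⁻¹ * T) := by
    intro T
    have := (M.commute_evolution_proj0 (x + s)).eq
    rw [← hv] at this
    rw [Units.inv_mul_eq_iff_eq_mul, ← mul_assoc, this, mul_assoc, Units.mul_inv_cancel_left]
  have e : Ring.inverse (M.evolution s) * M.kernel s x * M.evolution s =
      M.proj0 * (Ring.inverse (M.evolution (x + s)) * M.intGen * M.evolution (x + s)) *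
        (Ring.inverse (M.evolution s) * M.intGen * M.evolution s) * M.proj0 := by
    rw [kernel, A01_eq, A10_eq, propagator]
    simp only [mul_assoc, ← hcu]
    simp only [← hu, ← hv, Ring.inverse_unit, ← Units.val_mul, mul_inv_rev, inv_inv]
    simp only [Units.val_mul, mul_assoc, Units.inv_mul_cancel_left, hcv]
  rw [e, inverse_evolution_mul_intGen_mul, inverse_evolution_mul_intGen_mul]
  refine ContinuousLinearMap.ext fun a => ?_
  change tensorState M.envState (partialTrace ((-Complex.I) • commutator (Joint d E)
    (M.intHamAt (x + s)) ((-Complex.I) • commutator (Joint d E) (M.intHamAt s)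
      (tensorState M.envState (partialTrace a))))) =
    -tensorState M.envState ((∑ μ, ∑ ν, memoryForm (M.autocorr μ ν x •
      entryProducts (M.sysCoupling μ (x + s)) (M.sysCoupling ν s))) (partialTrace a))
  rw [map_smul (commutator (Joint d E) (M.intHamAt (x + s))), smul_smul,
    neg_mul_neg, Complex.I_mul_I, neg_smul, one_smul, map_neg, map_neg, intHamAt, intHamAt,
    partialTrace_commutator_commutator _ _ _ _ (M.intHamAt_isSelfAdjoint (x + s))
      (M.intHamAt_isSelfAdjoint s) _ M.envState_isSelfAdjoint]
  simp only [opTrace_envCoupling, sum_apply]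

end OpenSystem

/-! ### Equidistribution and Fourier series on the torus -/

section Torus
open MeasureTheory Filter Topology UnitAddTorus
open scoped ComplexConjugate
variable {r : ℕ}

variable (r) in
/-- The normalised Haar measure of the torus, with respect to which `mFourierCoeff` is defined. -/
noncomputable def torusHaar : Measure (UnitAddTorus (Fin r)) :=
  Measure.pi fun _ => AddCircle.haarAddCircle

instance : IsProbabilityMeasure (torusHaar r) :=
  inferInstanceAs (IsProbabilityMeasure (Measure.pi fun _ => AddCircle.haarAddCircle))

instance : (torusHaar r).IsAddHaarMeasure :=
  inferInstanceAs (Measure.IsAddHaarMeasure (Measure.pi fun _ => AddCircle.haarAddCircle))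

theorem mFourierCoeff_eq_integral_torusHaar {V : Type*} [NormedAddCommGroup V] [NormedSpace ℂ V]
    (F : UnitAddTorus (Fin r) → V) (n : Fin r → ℤ) :
    mFourierCoeff F n = ∫ θ, mFourier (-n) θ • F θ ∂torusHaar r := rfl

theorem integrable_torusHaar {V : Type*} [NormedAddCommGroup V] {F : UnitAddTorus (Fin r) → V}
    (hF : Continuous F) : Integrable F (torusHaar r) := by
  have h := hF.continuousOn.integrableOn_compact (μ := torusHaar r) isCompact_univ
  rwa [integrableOn_univ] at h

theorem winding_add (Ω : Fin r → ℝ) (s t : ℝ) :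
    winding Ω (s + t) = winding Ω s + winding Ω t := by
  funext j
  simp only [winding, Pi.add_apply, ← AddCircle.coe_add]
  congr 1
  ring

theorem winding_zero (Ω : Fin r → ℝ) : winding Ω 0 = 0 := by
  funext j
  simp [winding]

theorem intDot_zero (Ω : Fin r → ℝ) : intDot 0 Ω = 0 := by simp [intDot]

theorem mFourier_winding (Ω : Fin r → ℝ) (n : Fin r → ℤ) (t : ℝ) :
    mFourier n (winding Ω t) = Complex.exp (Complex.I * intDot n Ω * t) := by
  simp only [mFourier, ContinuousMap.coe_mk, winding, fourier_coe_apply, intDot]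
  rw [← Complex.exp_sum]
  congr 1
  push_cast
  rw [Finset.mul_sum, Finset.sum_mul]
  refine Finset.sum_congr rfl fun j _ => ?_
  have : (Real.pi : ℂ) ≠ 0 := by exact_mod_cast Real.pi_ne_zero
  field_simp

theorem norm_exp_I_mul (α t : ℝ) : ‖Complex.exp (Complex.I * α * t)‖ = 1 := by
  rw [mul_assoc, mul_comm, ← Complex.ofReal_mul, Complex.norm_exp_ofReal_mul_I]

theorem integral_mFourier (n : Fin r → ℤ) :
    ∫ θ, mFourier n θ ∂torusHaar r = if n = 0 then 1 else 0 := by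
  have h := orthonormal_iff_ite.1 (orthonormal_mFourier (d := Fin r)) 0 n
  rw [ContinuousMap.inner_toLp] at h
  simp only [mFourier_zero, ContinuousMap.one_apply, map_one, mul_one,
    eq_comm (a := (0 : Fin r → ℤ))] at h
  exact h

section Average
variable {κ : Type*} {l : Filter κ} {a b : κ → ℝ}

theorem tendsto_average_exp (hab : Tendsto (fun i => b i - a i) l atTop) (β : ℝ) :
    Tendsto (fun i => (b i - a i)⁻¹ • ∫ t in a i..b i, Complex.exp (Complex.I * β * t)) l
      (𝓝 (if β = 0 then 1 else 0)) := by
  split_ifs with hβ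
  · subst hβ
    refine tendsto_const_nhds.congr' ?_
    filter_upwards [hab.eventually_gt_atTop 0] with i hi
    simp only [Complex.ofReal_zero, mul_zero, zero_mul, Complex.exp_zero,
      intervalIntegral.integral_const, smul_smul]
    rw [inv_mul_cancel₀ hi.ne', one_smul]
  · have hc : Complex.I * (β : ℂ) ≠ 0 := mul_ne_zero Complex.I_ne_zero (by exact_mod_cast hβ)
    have hb : ∀ i, ‖∫ t in a i..b i, Complex.exp (Complex.I * β * t)‖ ≤ 2 / |β| := by
      intro i
      rw [integral_exp_mul_complex hc, norm_div]
      have h1 : ‖Complex.I * (β : ℂ)‖ = |β| := by simp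
      rw [h1]
      gcongr
      refine (norm_sub_le _ _).trans ?_
      rw [norm_exp_I_mul, norm_exp_I_mul]
      norm_num
    have h0 := (tendsto_inv_atTop_zero.comp hab).mul_const (2 / |β|)
    rw [zero_mul] at h0
    refine squeeze_zero_norm' ?_ h0
    filter_upwards [hab.eventually_gt_atTop 0] with i hi
    rw [norm_smul, Real.norm_of_nonneg (inv_nonneg.2 hi.le)]
    exact mul_le_mul_of_nonneg_left (hb i) (inv_nonneg.2 hi.le)

/-- Twisted equidistribution of the winding line: averages of `e^{iαt} F(Ωt)` over intervals of
growing length converge, by approximation of `F` with trigonometric polynomials. -/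
theorem tendsto_average_winding (hab : Tendsto (fun i => b i - a i) l atTop) {Ω : Fin r → ℝ}
    (hΩ : RationallyIndependent Ω) {α : ℝ} (hα : α = 0 ∨ ∀ k, α + intDot k Ω ≠ 0)
    (F : C(UnitAddTorus (Fin r), ℂ)) :
    Tendsto (fun i => (b i - a i)⁻¹ •
      ∫ t in a i..b i, Complex.exp (Complex.I * α * t) * F (winding Ω t)) l
      (𝓝 (if α = 0 then ∫ θ, F θ ∂torusHaar r else 0)) := by
  set A : κ → C(UnitAddTorus (Fin r), ℂ) → ℂ := fun i F => (b i - a i)⁻¹ •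
    ∫ t in a i..b i, Complex.exp (Complex.I * α * t) * F (winding Ω t) with hA
  set Λ : C(UnitAddTorus (Fin r), ℂ) → ℂ := fun F =>
    if α = 0 then ∫ θ, F θ ∂torusHaar r else 0 with hΛ
  have hcont : ∀ F : C(UnitAddTorus (Fin r), ℂ),
      Continuous fun t : ℝ => Complex.exp (Complex.I * α * t) * F (winding Ω t) := fun F => by
    have := continuous_winding Ω
    fun_prop
  have hAsub : ∀ i F G, A i (F - G) = A i F - A i G := fun i F G => by
    simp only [hA, ContinuousMap.sub_apply, mul_sub]
    rw [intervalIntegral.integral_sub ((hcont F).intervalIntegrable _ _)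
      ((hcont G).intervalIntegrable _ _), smul_sub]
  have hAadd : ∀ i F G, A i (F + G) = A i F + A i G := fun i F G => by
    simp only [hA, ContinuousMap.add_apply, mul_add]
    rw [intervalIntegral.integral_add ((hcont F).intervalIntegrable _ _)
      ((hcont G).intervalIntegrable _ _), smul_add]
  have hAsmul : ∀ i (c : ℂ) F, A i (c • F) = c * A i F := fun i c F => by
    simp only [hA, ContinuousMap.smul_apply, smul_eq_mul, mul_left_comm _ c]
    rw [intervalIntegral.integral_const_mul, mul_smul_comm]
  have hAn : ∀ i F, 0 < b i - a i → ‖A i F‖ ≤ ‖F‖ := fun i F hi => by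
    have h1 : ‖∫ t in a i..b i, Complex.exp (Complex.I * α * t) * F (winding Ω t)‖ ≤
        ‖F‖ * |b i - a i| := intervalIntegral.norm_integral_le_of_norm_le_const fun t _ => by
      rw [norm_mul, norm_exp_I_mul, one_mul]
      exact F.norm_coe_le_norm _
    rw [abs_of_pos hi] at h1
    simp only [hA]
    rw [norm_smul, norm_inv, Real.norm_of_nonneg hi.le, inv_mul_le_iff₀ hi, mul_comm (b i - a i)]
    exact h1
  have hΛsub : ∀ F G, Λ (F - G) = Λ F - Λ G := fun F G => by
    simp only [hΛ]
    split_ifs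
    · simp only [ContinuousMap.sub_apply]
      exact integral_sub (integrable_torusHaar F.continuous) (integrable_torusHaar G.continuous)
    · simp
  have hΛadd : ∀ F G, Λ (F + G) = Λ F + Λ G := fun F G => by
    simp only [hΛ]
    split_ifs
    · simp only [ContinuousMap.add_apply]
      exact integral_add (integrable_torusHaar F.continuous) (integrable_torusHaar G.continuous)
    · simp
  have hΛsmul : ∀ (c : ℂ) F, Λ (c • F) = c * Λ F := fun c F => by
    simp only [hΛ]
    split_ifs
    · simp only [ContinuousMap.smul_apply, smul_eq_mul]
      exact integral_const_mul _ _
    · simp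
  have hΛn : ∀ F, ‖Λ F‖ ≤ ‖F‖ := fun F => by
    simp only [hΛ]
    split_ifs
    · refine (norm_integral_le_of_norm_le_const (Eventually.of_forall fun θ =>
        F.norm_coe_le_norm θ)).trans ?_
      simp
    · simp
  have hspan : ∀ G ∈ Submodule.span ℂ (Set.range (mFourier (d := Fin r))),
      Tendsto (fun i => A i G) l (𝓝 (Λ G)) := by
    intro G hG
    induction hG using Submodule.span_induction with
    | mem G hG =>
      obtain ⟨n, rfl⟩ := hG
      have h := tendsto_average_exp hab (α + intDot n Ω)
      have e1 : (if α + intDot n Ω = 0 then (1 : ℂ) else 0) = Λ (mFourier n) := by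
        simp only [hΛ, integral_mFourier]
        rcases hα with rfl | hα
        · by_cases hn : n = 0
          · subst hn; simp [intDot_zero]
          · have : intDot n Ω ≠ 0 := fun h => hn (hΩ n h)
            simp [this, hn]
        · have h0 : α ≠ 0 := by simpa [intDot_zero] using hα 0
          simp [hα n, h0]
      rw [e1] at h
      refine h.congr fun i => ?_
      simp only [hA]
      congr 1
      refine intervalIntegral.integral_congr fun t _ => ?_
      simp only [mFourier_winding, ← Complex.exp_add]
      congr 1
      push_cast
      ring
    | zero =>
      have h0 : ∀ i, A i 0 = 0 := fun i => by simp [hA]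
      have h1 : Λ 0 = 0 := by simp [hΛ]
      simp only [h0, h1]
      exact tendsto_const_nhds
    | add F G _ _ hF hG =>
      simp only [hAadd, hΛadd]
      exact hF.add hG
    | smul c F _ hF =>
      simp only [hAsmul, hΛsmul]
      exact hF.const_mul c
  have hd : F ∈ closure (Submodule.span ℂ (Set.range (mFourier (d := Fin r))) :
      Set C(UnitAddTorus (Fin r), ℂ)) := by
    have : F ∈ (Submodule.span ℂ (Set.range (mFourier (d := Fin r)))).topologicalClosure := by
      rw [span_mFourier_closure_eq_top]
      trivial
    exact this
  rw [Metric.tendsto_nhds]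
  intro ε hε
  obtain ⟨G, hG, hFG⟩ := Metric.mem_closure_iff.1 hd (ε / 3) (by positivity)
  rw [dist_eq_norm] at hFG
  filter_upwards [hab.eventually_gt_atTop 0,
    Metric.tendsto_nhds.1 (hspan G hG) (ε / 3) (by positivity)] with i hi hiG
  rw [dist_eq_norm] at hiG ⊢
  have e : A i F - Λ F = A i (F - G) + (A i G - Λ G) - Λ (F - G) := by
    rw [hAsub, hΛsub]; ring
  change ‖A i F - Λ F‖ < ε
  rw [e]
  have h1 := hAn i (F - G) hi
  have h2 := hΛn (F - G)
  have h3 := norm_sub_le (A i (F - G) + (A i G - Λ G)) (Λ (F - G))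
  have h4 := norm_add_le (A i (F - G)) (A i G - Λ G)
  linarith

end Average

/-- A continuous function on the torus vanishes if it does so on the forward winding line: by
equidistribution the integral of its norm is zero. -/
theorem eq_zero_of_winding_eq_zero {V : Type*} [NormedAddCommGroup V] {Ω : Fin r → ℝ}
    (hΩ : RationallyIndependent Ω) {F : UnitAddTorus (Fin r) → V} (hF : Continuous F)
    (h0 : ∀ t : ℝ, 0 ≤ t → F (winding Ω t) = 0) (θ : UnitAddTorus (Fin r)) : F θ = 0 := by
  have hab : Tendsto (fun T : ℝ => T - 0) atTop atTop := by
    simp only [sub_zero]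
    exact tendsto_id
  have h := tendsto_average_winding hab hΩ (Or.inl rfl)
    ⟨fun θ => ((‖F θ‖ : ℝ) : ℂ), Complex.continuous_ofReal.comp hF.norm⟩
  have h' : ∫ θ, ‖F θ‖ ∂torusHaar r = 0 := by
    have e : (∫ θ, ((‖F θ‖ : ℝ) : ℂ) ∂torusHaar r) = 0 := by
      refine tendsto_nhds_unique (by simpa using h) (tendsto_const_nhds.congr' ?_)
      filter_upwards [eventually_ge_atTop 0] with T hT
      rw [intervalIntegral.integral_zero_ae]
      · simp
      · refine Eventually.of_forall fun t ht => ?_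
        rw [Set.uIoc_of_le hT] at ht
        simp [h0 t ht.1.le]
    have e2 : ((∫ θ, ‖F θ‖ ∂torusHaar r : ℝ) : ℂ) = 0 :=
      (integral_ofReal (𝕜 := ℂ)).symm.trans e
    exact_mod_cast e2
  by_contra hne
  have := hF.norm.integral_pos_of_hasCompactSupport_nonneg_nonzero (μ := torusHaar r)
    (HasCompactSupport.of_compactSpace _) (fun _ => norm_nonneg _) (norm_ne_zero_iff.2 hne)
  exact this.ne' h'

theorem mFourierCoeff_toLp_torusHaar (φ : C(UnitAddTorus (Fin r), ℂ)) (n : Fin r → ℤ) :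
    mFourierCoeff (ContinuousMap.toLp (E := ℂ) 2 (torusHaar r) ℂ φ) n = mFourierCoeff φ n :=
  mFourierCoeff_toLp φ n

/-- Parseval's identity for continuous functions on the torus. -/
theorem hasSum_conj_mFourierCoeff_mul (φ ψ : C(UnitAddTorus (Fin r), ℂ)) :
    HasSum (fun n => conj (mFourierCoeff φ n) * mFourierCoeff ψ n)
      (∫ θ, conj (φ θ) * ψ θ ∂torusHaar r) := by
  set F := ContinuousMap.toLp (E := ℂ) 2 (torusHaar r) ℂ φ with hF
  set G := ContinuousMap.toLp (E := ℂ) 2 (torusHaar r) ℂ ψ with hG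
  have h : HasSum (fun n => conj (mFourierCoeff F n) * mFourierCoeff G n)
    (∫ θ, conj (F θ) * G θ ∂torusHaar r) := hasSum_prod_mFourierCoeff F G
  simp only [hF, hG, mFourierCoeff_toLp_torusHaar] at h
  convert h using 1
  refine integral_congr_ae ?_
  filter_upwards [ContinuousMap.coeFn_toLp (p := 2) (𝕜 := ℂ) (torusHaar r) φ,
    ContinuousMap.coeFn_toLp (p := 2) (𝕜 := ℂ) (torusHaar r) ψ] with θ h1 h2
  rw [← h1, ← h2]

theorem summable_sq_mFourierCoeff (φ : C(UnitAddTorus (Fin r), ℂ)) :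
    Summable fun n => ‖mFourierCoeff φ n‖ ^ 2 := by
  have h : Summable fun n =>
      ‖mFourierCoeff (ContinuousMap.toLp (E := ℂ) 2 (torusHaar r) ℂ φ) n‖ ^ 2 :=
    (hasSum_sq_mFourierCoeff (ContinuousMap.toLp (E := ℂ) 2 (torusHaar r) ℂ φ)).summable
  simpa only [mFourierCoeff_toLp_torusHaar] using h

theorem summable_norm_mFourierCoeff_mul (φ ψ : C(UnitAddTorus (Fin r), ℂ)) :
    Summable fun n => ‖mFourierCoeff φ n‖ * ‖mFourierCoeff ψ n‖ := by
  refine Summable.of_nonneg_of_le (fun _ => by positivity) (fun n => ?_)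
    ((summable_sq_mFourierCoeff φ).add (summable_sq_mFourierCoeff ψ))
  nlinarith [sq_nonneg (‖mFourierCoeff φ n‖ - ‖mFourierCoeff ψ n‖),
    sq_nonneg ‖mFourierCoeff φ n‖, sq_nonneg ‖mFourierCoeff ψ n‖]

theorem mFourierCoeff_comp_add (φ : UnitAddTorus (Fin r) → ℂ) (τ : UnitAddTorus (Fin r))
    (n : Fin r → ℤ) :
    mFourierCoeff (fun θ => φ (θ + τ)) n = mFourier n τ * mFourierCoeff φ n := by
  rw [mFourierCoeff_eq_integral_torusHaar, mFourierCoeff_eq_integral_torusHaar,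
    ← integral_add_right_eq_self (fun θ => mFourier (-n) θ • φ θ) τ, ← integral_const_mul]
  refine integral_congr_ae (Eventually.of_forall fun θ => ?_)
  have e : mFourier n τ * mFourier (-n) (θ + τ) = mFourier (-n) θ := by
    simp only [mFourier, ContinuousMap.coe_mk, ← Finset.prod_mul_distrib, Pi.neg_apply, Pi.add_apply]
    refine Finset.prod_congr rfl fun j _ => ?_
    simp only [fourier_apply, neg_smul, smul_add, AddCircle.toCircle_add, Circle.coe_mul,
      AddCircle.toCircle_neg, Circle.coe_inv]
    have := Circle.coe_ne_zero (AddCircle.toCircle (n j • τ j))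
    field_simp
  simp only [smul_eq_mul]
  rw [← mul_assoc, e]

end Torus

/-! ### Averages of quasiperiodic memory integrals -/

section MemoryAverage
open MeasureTheory Filter Topology UnitAddTorus
open scoped ComplexConjugate
variable {r : ℕ}

/-- The one-sided Fourier transform `∫_0^∞ f(x) e^{-iωx} dx`. -/
noncomputable def halfFourier (f : ℝ → ℂ) (ω : ℝ) : ℂ :=
  ∫ x in Set.Ici (0 : ℝ), f x * Complex.exp (-(Complex.I * ω * x))

theorem norm_exp_neg_I_mul (α t : ℝ) : ‖Complex.exp (-(Complex.I * α * t))‖ = 1 := by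
  rw [Complex.exp_neg, norm_inv, norm_exp_I_mul, inv_one]

theorem conj_exp_I_mul (α t : ℝ) :
    conj (Complex.exp (Complex.I * α * t)) = Complex.exp (-(Complex.I * α * t)) := by
  rw [← Complex.exp_conj]
  simp

theorem norm_halfFourier_le (f : ℝ → ℂ) (ω : ℝ) :
    ‖halfFourier f ω‖ ≤ ∫ x in Set.Ici (0 : ℝ), ‖f x‖ := by
  refine (norm_integral_le_integral_norm _).trans (le_of_eq ?_)
  refine integral_congr_ae (Eventually.of_forall fun x => ?_)
  simp only [norm_mul, norm_exp_neg_I_mul, mul_one]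

theorem MeasureTheory.IntegrableOn.mul_exp {f : ℝ → ℂ} {s : Set ℝ} (hf : IntegrableOn f s)
    (ω : ℝ) : IntegrableOn (fun x : ℝ => f x * Complex.exp (-(Complex.I * ω * x))) s := by
  refine Integrable.mul_bdd (c := 1) hf ?_ (Eventually.of_forall fun x => ?_)
  · exact (by fun_prop : Continuous fun x : ℝ =>
      Complex.exp (-(Complex.I * ω * x))).aestronglyMeasurable
  · rw [norm_exp_neg_I_mul]

/-- `∫_0^∞ f(x) e^{-iαx} ∫_T conj φ(θ + Ωx) ψ(θ) dθ dx`, expanded by Parseval's identity. -/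
theorem integral_mul_integral_torus {f : ℝ → ℂ} (hf : IntegrableOn f (Set.Ici 0))
    (Ω : Fin r → ℝ) (α : ℝ) (φ ψ : C(UnitAddTorus (Fin r), ℂ)) :
    ∫ x in Set.Ici (0 : ℝ), f x * (Complex.exp (-(Complex.I * α * x)) *
      ∫ θ, conj (φ (θ + winding Ω x)) * ψ θ ∂torusHaar r) =
    ∑' n, conj (mFourierCoeff φ n) * mFourierCoeff ψ n * halfFourier f (α + intDot n Ω) := by
  set c : (Fin r → ℤ) → ℂ := fun n => conj (mFourierCoeff φ n) * mFourierCoeff ψ n with hc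
  have hcs : Summable fun n => ‖c n‖ := by
    simpa only [hc, norm_mul, RCLike.norm_conj] using summable_norm_mFourierCoeff_mul φ ψ
  set G : (Fin r → ℤ) → ℝ → ℂ := fun n x =>
    c n * (f x * Complex.exp (-(Complex.I * ((α + intDot n Ω : ℝ) : ℂ) * x))) with hG
  have hsum : ∀ x, HasSum (fun n => G n x) (f x * (Complex.exp (-(Complex.I * α * x)) *
      ∫ θ, conj (φ (θ + winding Ω x)) * ψ θ ∂torusHaar r)) := by
    intro x
    have h := (hasSum_conj_mFourierCoeff_mul (φ.comp ⟨fun θ => θ + winding Ω x, by fun_prop⟩)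
      ψ).mul_left (f x * Complex.exp (-(Complex.I * α * x)))
    rw [mul_assoc (f x)] at h
    refine h.congr_fun fun n => ?_
    have e : mFourierCoeff (φ.comp ⟨fun θ => θ + winding Ω x, by fun_prop⟩) n =
        mFourier n (winding Ω x) * mFourierCoeff φ n := mFourierCoeff_comp_add φ (winding Ω x) n
    rw [e, mFourier_winding, map_mul, conj_exp_I_mul, hG, hc]
    have e2 : Complex.exp (-(Complex.I * ((α + intDot n Ω : ℝ) : ℂ) * x)) =
        Complex.exp (-(Complex.I * α * x)) * Complex.exp (-(Complex.I * intDot n Ω * x)) := by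
      rw [← Complex.exp_add]
      congr 1
      push_cast
      ring
    simp only [e2]
    ring
  have hint : ∀ n, IntegrableOn (G n) (Set.Ici 0) := fun n => (hf.mul_exp _).const_mul (c n)
  have hnorm : ∀ n, ∫ x in Set.Ici (0 : ℝ), ‖G n x‖ = ‖c n‖ * ∫ x in Set.Ici (0 : ℝ), ‖f x‖ := by
    intro n
    rw [← integral_const_mul]
    refine integral_congr_ae (Eventually.of_forall fun x => ?_)
    simp only [hG, norm_mul, norm_exp_neg_I_mul, mul_one]
  have h := hasSum_integral_of_summable_integral_norm hint (by
    simpa only [hnorm] using hcs.mul_right _)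
  rw [← integral_congr_ae (Eventually.of_forall fun x => (hsum x).tsum_eq), ← h.tsum_eq]
  refine tsum_congr fun n => ?_
  rw [hG, integral_const_mul]
  rfl

/-- The average over `s` of the memory integral of two quasiperiodic functions with phases
`e^{iαs}`, `e^{iβs}`. For almost every delay the average is computed by equidistribution;
Fubini and dominated convergence exchange it with the integral over the delay. -/
theorem tendsto_average_memory {Ω : Fin r → ℝ} (hΩ : RationallyIndependent Ω) {f : ℝ → ℂ}
    (hf : IntegrableOn f (Set.Ici 0)) (φ ψ : C(UnitAddTorus (Fin r), ℂ)) {α β : ℝ}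
    (hαβ : α = β ∨ ∀ k, β - α + intDot k Ω ≠ 0) :
    Tendsto (fun δ : ℝ => (1 / (2 * δ)) • ∫ s in (-δ)..δ, ∫ x in Set.Ici (0 : ℝ),
      f x * (conj (Complex.exp (Complex.I * α * ((x + s : ℝ) : ℂ)) * φ (winding Ω (x + s))) *
        (Complex.exp (Complex.I * β * s) * ψ (winding Ω s)))) atTop
      (𝓝 (if α = β then ∑' n, conj (mFourierCoeff φ n) * mFourierCoeff ψ n *
        halfFourier f (α + intDot n Ω) else 0)) := by
  set B : ℝ → ℝ → ℂ := fun s x =>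
    conj (Complex.exp (Complex.I * α * ((x + s : ℝ) : ℂ)) * φ (winding Ω (x + s))) *
        (Complex.exp (Complex.I * β * s) * ψ (winding Ω s)) with hB
  have hBc : Continuous fun q : ℝ × ℝ => B q.1 q.2 := by
    have := continuous_winding Ω
    have h1 : Continuous fun q : ℝ × ℝ => winding Ω (q.2 + q.1) := this.comp (by fun_prop)
    have h2 : Continuous fun q : ℝ × ℝ => winding Ω q.1 := this.comp (by fun_prop)
    simp only [hB]
    fun_prop
  have hBn : ∀ s x, ‖B s x‖ ≤ ‖φ‖ * ‖ψ‖ := fun s x => by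
    simp only [hB]
    rw [norm_mul, RCLike.norm_conj, norm_mul, norm_mul, norm_exp_I_mul, norm_exp_I_mul, one_mul,
      one_mul]
    exact mul_le_mul (φ.norm_coe_le_norm _) (ψ.norm_coe_le_norm _) (norm_nonneg _) (norm_nonneg _)
  -- the average at a fixed delay
  have hpt : ∀ x, Tendsto (fun δ : ℝ => (1 / (2 * δ)) • ∫ s in (-δ)..δ, B s x) atTop
      (𝓝 (if α = β then Complex.exp (-(Complex.I * α * x)) *
        ∫ θ, conj (φ (θ + winding Ω x)) * ψ θ ∂torusHaar r else 0)) := by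
    intro x
    have hab : Tendsto (fun δ : ℝ => δ - -δ) atTop atTop := by
      simp only [sub_neg_eq_add]
      exact tendsto_id.atTop_add_atTop tendsto_id
    have hα : β - α = 0 ∨ ∀ k, β - α + intDot k Ω ≠ 0 :=
      hαβ.imp (fun h => by rw [h, sub_self]) id
    have h := (tendsto_average_winding hab hΩ hα
      ⟨fun θ => conj (φ (θ + winding Ω x)) * ψ θ, by fun_prop⟩).const_mul
        (Complex.exp (-(Complex.I * α * x)))
    have e : Complex.exp (-(Complex.I * α * x)) * (if β - α = 0 then
        ∫ θ, (⟨fun θ => conj (φ (θ + winding Ω x)) * ψ θ, by fun_prop⟩ :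
          C(UnitAddTorus (Fin r), ℂ)) θ ∂torusHaar r else 0) =
        if α = β then Complex.exp (-(Complex.I * α * x)) *
        ∫ θ, conj (φ (θ + winding Ω x)) * ψ θ ∂torusHaar r else 0 := by
      by_cases h : α = β
      · subst h; simp
      · rw [if_neg h, if_neg (fun h' => h (sub_eq_zero.1 h').symm), mul_zero]
    rw [e] at h
    refine h.congr fun δ => ?_
    rw [mul_smul_comm, ← intervalIntegral.integral_const_mul]
    congr 1
    · rw [one_div]; ring_nf
    · refine intervalIntegral.integral_congr fun s _ => ?_
      simp only [hB, ContinuousMap.coe_mk, map_mul, conj_exp_I_mul]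
      have e1 : Complex.exp (-(Complex.I * α * ((x + s : ℝ) : ℂ))) *
          Complex.exp (Complex.I * β * s) = Complex.exp (-(Complex.I * α * x)) *
          Complex.exp (Complex.I * ((β - α : ℝ) : ℂ) * s) := by
        rw [← Complex.exp_add, ← Complex.exp_add]
        congr 1
        push_cast
        ring
      rw [winding_add Ω x s, add_comm (winding Ω s)]
      linear_combination (-(conj (φ (winding Ω x + winding Ω s)) * ψ (winding Ω s))) * e1
  have hprod : ∀ δ : ℝ, Integrable (Function.uncurry fun s x => f x * B s x)
      ((volume.restrict (Set.Ioc (-δ) δ)).prod (volume.restrict (Set.Ici (0 : ℝ)))) := by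
    intro δ
    refine Integrable.mul_bdd (c := ‖φ‖ * ‖ψ‖) (Integrable.comp_snd hf _) ?_ ?_
    · exact hBc.aestronglyMeasurable
    · exact Eventually.of_forall fun q => hBn _ _
  have hswap : ∀ δ : ℝ, 0 < δ → (1 / (2 * δ)) • ∫ s in (-δ)..δ, ∫ x in Set.Ici (0 : ℝ),
      f x * B s x = ∫ x in Set.Ici (0 : ℝ), f x * ((1 / (2 * δ)) • ∫ s in (-δ)..δ, B s x) := by
    intro δ hδ
    have hle : -δ ≤ δ := by linarith
    rw [intervalIntegral.integral_of_le hle, integral_integral_swap (hprod δ), ← integral_smul]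
    refine integral_congr_ae (Eventually.of_forall fun x => ?_)
    simp only [intervalIntegral.integral_of_le hle]
    rw [integral_const_mul, mul_smul_comm]
  have hlim : Tendsto (fun δ : ℝ => ∫ x in Set.Ici (0 : ℝ),
      f x * ((1 / (2 * δ)) • ∫ s in (-δ)..δ, B s x)) atTop
      (𝓝 (∫ x in Set.Ici (0 : ℝ), f x * (if α = β then Complex.exp (-(Complex.I * α * x)) *
        ∫ θ, conj (φ (θ + winding Ω x)) * ψ θ ∂torusHaar r else 0))) := by
    refine tendsto_integral_filter_of_dominated_convergence (fun x => ‖f x‖ * (‖φ‖ * ‖ψ‖)) ?_ ?_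
      (hf.norm.mul_const _) (Eventually.of_forall fun x => (hpt x).const_mul (f x))
    · filter_upwards [eventually_gt_atTop 0] with δ hδ
      have hle : -δ ≤ δ := by linarith
      have h := ((hprod δ).integral_prod_right.const_mul ((1 / (2 * δ) : ℝ) : ℂ)).aestronglyMeasurable
      refine h.congr (Eventually.of_forall fun x => ?_)
      simp only [intervalIntegral.integral_of_le hle, Function.uncurry]
      rw [integral_const_mul, Complex.real_smul]
      ring
    · filter_upwards [eventually_gt_atTop 0] with δ hδ
      refine Eventually.of_forall fun x => ?_
      rw [norm_mul]
      refine mul_le_mul_of_nonneg_left ?_ (norm_nonneg _)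
      have h1 := intervalIntegral.norm_integral_le_of_norm_le_const (a := -δ) (b := δ)
        (f := fun s => B s x) (C := ‖φ‖ * ‖ψ‖) fun s _ => hBn s x
      have h2 : |δ - -δ| = 2 * δ := by rw [abs_of_pos (by linarith)]; ring
      rw [h2] at h1
      rw [norm_smul, Real.norm_of_nonneg (by positivity), one_div, inv_mul_le_iff₀ (by positivity)]
      linarith
  have e : (∫ x in Set.Ici (0 : ℝ), f x * (if α = β then Complex.exp (-(Complex.I * α * x)) *
      ∫ θ, conj (φ (θ + winding Ω x)) * ψ θ ∂torusHaar r else 0)) =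
      if α = β then ∑' n, conj (mFourierCoeff φ n) * mFourierCoeff ψ n *
        halfFourier f (α + intDot n Ω) else 0 := by
    split_ifs
    · exact integral_mul_integral_torus hf Ω α φ ψ
    · simp
  rw [e] at hlim
  refine hlim.congr' ?_
  filter_upwards [eventually_gt_atTop 0] with δ hδ
  exact (hswap δ hδ).symm

theorem norm_phase_mul_le (φ : C(UnitAddTorus (Fin r), ℂ)) (Ω : Fin r → ℝ) (α t : ℝ) :
    ‖Complex.exp (Complex.I * α * t) * φ (winding Ω t)‖ ≤ ‖φ‖ := by
  rw [norm_mul, norm_exp_I_mul, one_mul]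
  exact φ.norm_coe_le_norm _

theorem continuous_phase_mul (φ : C(UnitAddTorus (Fin r), ℂ)) (Ω : Fin r → ℝ) (α : ℝ) :
    Continuous fun t : ℝ => Complex.exp (Complex.I * α * t) * φ (winding Ω t) := by
  have := continuous_winding Ω
  fun_prop

theorem integrableOn_mul_conj_mul {f g : ℝ → ℂ} (hf : IntegrableOn f (Set.Ici 0))
    (hg : Continuous g) {C : ℝ} (hC : ∀ t, ‖g t‖ ≤ C) (s : ℝ) (z : ℂ) :
    IntegrableOn (fun x => f x * (conj (g (x + s)) * z)) (Set.Ici 0) := by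
  refine Integrable.mul_bdd (c := C * ‖z‖) hf ?_ (Eventually.of_forall fun x => ?_)
  · exact ((Complex.continuous_conj.comp (hg.comp (continuous_id.add continuous_const))).mul
      continuous_const).aestronglyMeasurable
  · rw [norm_mul, RCLike.norm_conj]
    exact mul_le_mul_of_nonneg_right (hC _) (norm_nonneg _)

theorem continuous_integral_mul_conj_mul {f g k : ℝ → ℂ} (hf : IntegrableOn f (Set.Ici 0))
    (hg : Continuous g) {C : ℝ} (hC : ∀ t, ‖g t‖ ≤ C) (hk : Continuous k) :
    Continuous fun s => ∫ x in Set.Ici (0 : ℝ), f x * (conj (g (x + s)) * k s) := by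
  have e : ∀ s, ∫ x in Set.Ici (0 : ℝ), f x * (conj (g (x + s)) * k s) =
      (∫ x in Set.Ici (0 : ℝ), f x * conj (g (x + s))) * k s := fun s => by
    rw [← integral_mul_const]
    simp only [mul_assoc]
  simp only [e]
  refine Continuous.mul ?_ hk
  refine continuous_of_dominated (F := fun s x => f x * conj (g (x + s)))
    (bound := fun x => ‖f x‖ * C) (fun s => ?_) (fun s => Eventually.of_forall fun x => ?_)
    (hf.norm.mul_const C) (Eventually.of_forall fun x => ?_)
  · exact hf.aestronglyMeasurable.mul (Complex.continuous_conj.comp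
      (hg.comp (continuous_id.add continuous_const))).aestronglyMeasurable
  · rw [norm_mul, RCLike.norm_conj]
    exact mul_le_mul_of_nonneg_left (hC _) (norm_nonneg _)
  · exact continuous_const.mul (Complex.continuous_conj.comp
      (hg.comp (continuous_const.add continuous_id)))

/-- The average of a memory integral of two finite sums of quasiperiodic functions with phases; only
equal phases contribute when no two of them differ by a combination of the frequencies. -/
theorem tendsto_average_memory_sum {Ω : Fin r → ℝ} (hΩ : RationallyIndependent Ω) {f : ℝ → ℂ}
    (hf : IntegrableOn f (Set.Ici 0)) (F : Finset ℝ) (φ ψ : ℝ → C(UnitAddTorus (Fin r), ℂ))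
    (hF : ∀ α ∈ F, ∀ β ∈ F, α = β ∨ ∀ k, β - α + intDot k Ω ≠ 0) {X Y : ℝ → ℂ}
    (hX : ∀ t, X t = ∑ ω ∈ F, Complex.exp (Complex.I * ω * t) * φ ω (winding Ω t))
    (hY : ∀ t, Y t = ∑ ω ∈ F, Complex.exp (Complex.I * ω * t) * ψ ω (winding Ω t)) :
    Tendsto (fun δ : ℝ => (1 / (2 * δ)) • ∫ s in (-δ)..δ, ∫ x in Set.Ici (0 : ℝ),
      f x * (conj (X (x + s)) * Y s)) atTop
      (𝓝 (∑ ω ∈ F, ∑' n, conj (mFourierCoeff (φ ω) n) * mFourierCoeff (ψ ω) n *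
        halfFourier f (ω + intDot n Ω))) := by
  set G : ℝ → ℝ → ℝ → ℝ → ℂ := fun α β s x => f x *
    (conj (Complex.exp (Complex.I * α * ((x + s : ℝ) : ℂ)) * φ α (winding Ω (x + s))) *
      (Complex.exp (Complex.I * β * s) * ψ β (winding Ω s))) with hG
  have hGi : ∀ α β s, IntegrableOn (G α β s) (Set.Ici 0) := fun α β s =>
    integrableOn_mul_conj_mul hf (continuous_phase_mul (φ α) Ω α) (norm_phase_mul_le (φ α) Ω α) s _
  have hGc : ∀ α β, Continuous fun s => ∫ x in Set.Ici (0 : ℝ), G α β s x := fun α β =>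
    continuous_integral_mul_conj_mul hf (continuous_phase_mul (φ α) Ω α)
      (norm_phase_mul_le (φ α) Ω α) (continuous_phase_mul (ψ β) Ω β)
  have hsum : ∀ s, ∫ x in Set.Ici (0 : ℝ), f x * (conj (X (x + s)) * Y s) =
      ∑ α ∈ F, ∑ β ∈ F, ∫ x in Set.Ici (0 : ℝ), G α β s x := by
    intro s
    have e : ∀ x, f x * (conj (X (x + s)) * Y s) = ∑ α ∈ F, ∑ β ∈ F, G α β s x := fun x => by
      rw [hX, hY, map_sum, Finset.sum_mul_sum, Finset.mul_sum]
      simp only [Finset.mul_sum, hG]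
    simp only [e]
    rw [integral_finsetSum _ fun α _ => integrable_finsetSum _ fun β _ => hGi α β s]
    exact Finset.sum_congr rfl fun α _ => integral_finsetSum _ fun β _ => hGi α β s
  have hav : ∀ δ : ℝ, (1 / (2 * δ)) • ∫ s in (-δ)..δ, ∫ x in Set.Ici (0 : ℝ),
      f x * (conj (X (x + s)) * Y s) =
      ∑ α ∈ F, ∑ β ∈ F, (1 / (2 * δ)) • ∫ s in (-δ)..δ, ∫ x in Set.Ici (0 : ℝ), G α β s x := by
    intro δ
    simp only [hsum]
    rw [intervalIntegral.integral_finsetSum fun α _ =>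
      (continuous_finsetSum _ fun β _ => hGc α β).intervalIntegrable _ _, Finset.smul_sum]
    refine Finset.sum_congr rfl fun α _ => ?_
    rw [intervalIntegral.integral_finsetSum fun β _ => (hGc α β).intervalIntegrable _ _,
      Finset.smul_sum]
  simp only [hav]
  have hlim := tendsto_finsetSum F fun α hα => tendsto_finsetSum F fun β hβ =>
      tendsto_average_memory hΩ hf (φ α) (ψ β) (hF α hα β hβ)
  have e : ∑ α ∈ F, ∑ β ∈ F, (if α = β then ∑' n, conj (mFourierCoeff (φ α) n) *
      mFourierCoeff (ψ β) n * halfFourier f (α + intDot n Ω) else 0) =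
      ∑ ω ∈ F, ∑' n, conj (mFourierCoeff (φ ω) n) * mFourierCoeff (ψ ω) n *
        halfFourier f (ω + intDot n Ω) :=
    Finset.sum_congr rfl fun α hα => by rw [Finset.sum_ite_eq, if_pos hα]
  rw [← e]
  exact hlim

end MemoryAverage

/-! ### Bohr components and reducibility for all times -/

section SpectralDecomposition
variable {d : ℕ} {Hbar : Matrix (Fin d) (Fin d) ℂ} (hH : Hbar.IsHermitian)

theorem mul_spectralProj (k : Fin d) :
    Hbar * spectralProj hH k = (hH.eigenvalues k : ℂ) • spectralProj hH k := by
  rw [spectralProj, Matrix.mul_vecMulVec, hH.mulVec_eigenvectorBasis, Matrix.smul_vecMulVec]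
  rfl

theorem conjTranspose_spectralProj (k : Fin d) :
    (spectralProj hH k).conjTranspose = spectralProj hH k := by
  rw [spectralProj, Matrix.conjTranspose_vecMulVec, star_star]

theorem spectralProj_mul (k : Fin d) :
    spectralProj hH k * Hbar = (hH.eigenvalues k : ℂ) • spectralProj hH k := by
  have h := congrArg Matrix.conjTranspose (mul_spectralProj hH k)
  rw [Matrix.conjTranspose_mul, hH.eq, conjTranspose_spectralProj, Matrix.conjTranspose_smul,
    conjTranspose_spectralProj] at h
  simpa using h

theorem sum_spectralProj : ∑ k, spectralProj hH k = 1 := by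
  have h : (hH.eigenvectorUnitary : Matrix (Fin d) (Fin d) ℂ) *
      star (hH.eigenvectorUnitary : Matrix (Fin d) (Fin d) ℂ) = 1 :=
    Unitary.coe_mul_star_self _
  rw [← h]
  ext i j
  rw [Matrix.sum_apply, Matrix.mul_apply]
  refine Finset.sum_congr rfl fun k _ => ?_
  rw [spectralProj, Matrix.vecMulVec_apply, Matrix.star_apply, hH.eigenvectorUnitary_apply,
    hH.eigenvectorUnitary_apply]
  rfl

/-- `bohrComponent hH ω` as a bounded linear map. -/
noncomputable def bohrComponentCLM (ω : ℝ) :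
    Matrix (Fin d) (Fin d) ℂ →L[ℂ] Matrix (Fin d) (Fin d) ℂ :=
  LinearMap.toContinuousLinearMap
    { toFun := bohrComponent hH ω
      map_add' := fun m n => by
        simp only [bohrComponent, ← Finset.sum_add_distrib]
        refine Finset.sum_congr rfl fun k _ => Finset.sum_congr rfl fun l _ => ?_
        split_ifs <;> simp [mul_add, add_mul]
      map_smul' := fun c m => by
        simp only [bohrComponent, Finset.smul_sum]
        refine Finset.sum_congr rfl fun k _ => Finset.sum_congr rfl fun l _ => ?_
        split_ifs <;> simp }

/-- `e^{iH̄t} m e^{-iH̄t}` decomposed into the Bohr components of `m`. -/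
theorem exp_mul_mul_exp_eq_sum_bohrComponent (t : ℝ) (m : Matrix (Fin d) (Fin d) ℂ) :
    NormedSpace.exp ((Complex.I * t) • Hbar) * m * NormedSpace.exp ((-(Complex.I * t)) • Hbar) =
      ∑ ω ∈ bohrFreq hH, Complex.exp (Complex.I * ω * t) • bohrComponent hH ω m := by
  have h1 : ∀ k, spectralProj hH k * NormedSpace.exp ((Complex.I * t) • Hbar) =
      Complex.exp (Complex.I * t * hH.eigenvalues k) • spectralProj hH k := fun k =>
    mul_exp_of_mul_eq_smul (by rw [mul_smul_comm, spectralProj_mul, smul_smul])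
  have h2 : ∀ k, NormedSpace.exp ((-(Complex.I * t)) • Hbar) * spectralProj hH k =
      Complex.exp (-(Complex.I * t) * hH.eigenvalues k) • spectralProj hH k := fun k =>
    exp_mul_of_mul_eq_smul (by rw [smul_mul_assoc, mul_spectralProj, smul_smul])
  have hL : NormedSpace.exp ((Complex.I * t) • Hbar) * m *
      NormedSpace.exp ((-(Complex.I * t)) • Hbar) =
      ∑ k, ∑ l, Complex.exp (Complex.I * ((hH.eigenvalues k - hH.eigenvalues l : ℝ) : ℂ) * t) •
        (spectralProj hH k * m * spectralProj hH l) := by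
    set X := NormedSpace.exp ((Complex.I * t) • Hbar)
    set Y := NormedSpace.exp ((-(Complex.I * t)) • Hbar)
    calc X * m * Y = (∑ k, spectralProj hH k) * (X * m * Y) * ∑ l, spectralProj hH l := by
          rw [sum_spectralProj, one_mul, mul_one]
      _ = ∑ k, ∑ l, (spectralProj hH k * X) * m * (Y * spectralProj hH l) := by
          simp only [Finset.sum_mul, Finset.mul_sum, mul_assoc]
          exact Finset.sum_comm
      _ = _ := by
          refine Finset.sum_congr rfl fun k _ => Finset.sum_congr rfl fun l _ => ?_
          rw [h1, h2, smul_mul_assoc, smul_mul_assoc, mul_smul_comm, smul_smul, ← Complex.exp_add]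
          congr 2
          push_cast
          ring
  rw [hL]
  simp only [bohrComponent, Finset.smul_sum]
  rw [Finset.sum_comm' (s := bohrFreq hH) (t := fun _ => Finset.univ) (t' := Finset.univ)
    (s' := fun _ => bohrFreq hH) (by simp)]
  refine Finset.sum_congr rfl fun k _ => ?_
  rw [Finset.sum_comm' (s := bohrFreq hH) (t := fun _ => Finset.univ) (t' := Finset.univ)
    (s' := fun _ => bohrFreq hH) (by simp)]
  refine Finset.sum_congr rfl fun l _ => ?_
  have hmem : hH.eigenvalues k - hH.eigenvalues l ∈ bohrFreq hH :=
    Finset.mem_image.2 ⟨(k, l), Finset.mem_univ _, rfl⟩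
  rw [Finset.sum_eq_single_of_mem _ hmem fun ω _ hω => by rw [if_neg hω.symm, smul_zero],
    if_pos rfl]

end SpectralDecomposition

namespace OpenSystem
open TraceClass MeasureTheory Filter Topology

variable {d r : ℕ} {ι : Type*} [Fintype ι] {E : Type*} [NormedAddCommGroup E]
  [InnerProductSpace ℂ E] [CompleteSpace E] {M : OpenSystem d r ι E}
  {p : C(UnitAddTorus (Fin r), Matrix (Fin d) (Fin d) ℂ)} {Hbar : Matrix (Fin d) (Fin d) ℂ}

/-- Along the winding line, `p` obeys the integrated equation `p' = -i (H p - p H̄)`. By hypothesis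
this is known for `t ≥ 0`; it is a relation between continuous functions on the torus, and the forward
winding line is dense. -/
theorem IsReducedBy.sub_eq_integral (hred : M.IsReducedBy p Hbar)
    (hΩ : RationallyIndependent M.freq) (t : ℝ) {h : ℝ} (hh : 0 ≤ h) :
    p (winding M.freq (t + h)) - p (winding M.freq t) = ∫ τ in t..(t + h),
      (-Complex.I) • (M.sysHam τ * p (winding M.freq τ) - p (winding M.freq τ) * Hbar) := by
  set G : UnitAddTorus (Fin r) → Matrix (Fin d) (Fin d) ℂ := fun θ =>
    (-Complex.I) • (M.ham θ * p θ - p θ * Hbar) with hG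
  have hGc : Continuous G := by
    have h1 : Continuous fun θ => M.ham θ * p θ := M.ham.continuous.mul p.continuous
    have h2 : Continuous fun θ => p θ * Hbar := p.continuous.mul continuous_const
    exact (continuous_const_smul (-Complex.I)).comp (h1.sub h2)
  have hw := continuous_winding M.freq
  have hshift : ∀ t : ℝ, ∫ τ in (0 : ℝ)..h, G (winding M.freq t + winding M.freq τ) =
      ∫ τ in t..(t + h), G (winding M.freq τ) := by
    intro t
    have := intervalIntegral.integral_comp_add_left (a := 0) (b := h)
      (fun τ => G (winding M.freq τ)) t
    simpa only [winding_add, add_zero] using this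
  -- the relation on the forward line
  have hfor : ∀ t : ℝ, 0 ≤ t → p (winding M.freq (t + h)) - p (winding M.freq t) =
      ∫ τ in t..(t + h), G (winding M.freq τ) := by
    intro t ht
    set v : ℝ → Matrix (Fin d) (Fin d) ℂ := fun τ =>
      M.sysEvolution τ * NormedSpace.exp ((Complex.I * τ) • Hbar) with hv
    have hpv : ∀ τ : ℝ, 0 ≤ τ → p (winding M.freq τ) = v τ := fun τ hτ => by
      rw [hv]
      simp only
      rw [hred.eq_mul_exp τ hτ, mul_assoc, exp_neg_mul_exp_I_smul, mul_one]
    have hder : ∀ τ, HasDerivAt v ((-Complex.I) • (M.sysHam τ * v τ - v τ * Hbar)) τ := by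
      intro τ
      have h1 := M.sysEvolution_spec.2 τ
      have h2 := hasDerivAt_exp_neg_I_smul (-Hbar) τ
      simp only [smul_neg, neg_smul, neg_neg, neg_mul] at h2
      have hcomm : Hbar * NormedSpace.exp ((Complex.I * (τ : ℂ)) • Hbar) =
          NormedSpace.exp ((Complex.I * (τ : ℂ)) • Hbar) * Hbar :=
        (((Commute.refl Hbar).smul_right _).exp_right).eq
      rw [hcomm] at h2
      refine (h1.mul h2).congr_deriv ?_
      simp only [hv, smul_mul_assoc, mul_smul_comm, smul_sub, mul_assoc, neg_smul, sub_neg_eq_add,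
        neg_mul]
    have hle : t ≤ t + h := by linarith
    rw [hpv _ ht, hpv _ (by linarith), ← intervalIntegral.integral_eq_sub_of_hasDerivAt
      (fun τ _ => hder τ) ?_]
    · refine intervalIntegral.integral_congr fun τ hτ => ?_
      rw [Set.uIcc_of_le hle] at hτ
      simp only [hG, hpv τ (ht.trans hτ.1)]
      rfl
    · have hvc : Continuous v := continuous_iff_continuousAt.2 fun τ => (hder τ).continuousAt
      exact ((continuous_const_smul (-Complex.I)).comp ((M.continuous_sysHam.mul hvc).sub
        (hvc.mul continuous_const))).intervalIntegrable _ _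
  have hD : Continuous fun θ => p (θ + winding M.freq h) - p θ -
      ∫ τ in (0 : ℝ)..h, G (θ + winding M.freq τ) := by
    refine ((p.continuous.comp (by fun_prop)).sub p.continuous).sub ?_
    refine intervalIntegral.continuous_parametric_intervalIntegral_of_continuous' ?_ _ _
    exact hGc.comp (continuous_fst.add (hw.comp continuous_snd))
  have h0 := eq_zero_of_winding_eq_zero hΩ hD (fun t ht => by
    rw [hshift, ← winding_add, hfor t ht, sub_self]) (winding M.freq t)
  rw [hshift, ← winding_add] at h0
  exact sub_eq_zero.1 h0

/-- For rationally independent frequencies the reduction `u_t = p_t e^{-iH̄t}` holds for all real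
times. -/
theorem IsReducedBy.sysEvolution_eq (hred : M.IsReducedBy p Hbar)
    (hΩ : RationallyIndependent M.freq) (t : ℝ) :
    M.sysEvolution t =
      p (winding M.freq t) * NormedSpace.exp ((-(Complex.I * t)) • Hbar) := by
  set q : ℝ → Matrix (Fin d) (Fin d) ℂ := fun τ => p (winding M.freq τ) with hq
  have hqc : Continuous q := p.continuous.comp (continuous_winding M.freq)
  set g : ℝ → Matrix (Fin d) (Fin d) ℂ := fun τ =>
    (-Complex.I) • (M.sysHam τ * q τ - q τ * Hbar) with hg
  have hgc : Continuous g :=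
    (continuous_const_smul (-Complex.I)).comp
      ((M.continuous_sysHam.mul hqc).sub (hqc.mul continuous_const))
  have hq0 : q 0 = 1 := by rw [hq]; simp only; rw [winding_zero, hred.map_zero]
  have hint : ∀ t, q t = 1 + ∫ τ in (0 : ℝ)..t, g τ := by
    intro t
    rcases le_total 0 t with ht | ht
    · have := hred.sub_eq_integral hΩ 0 ht
      rw [zero_add] at this
      rw [← hq0, ← sub_eq_iff_eq_add']
      exact this
    · have := hred.sub_eq_integral hΩ t (h := -t) (by linarith)
      rw [add_neg_cancel] at this
      rw [intervalIntegral.integral_symm, ← hq0, ← sub_eq_add_neg, eq_sub_iff_add_eq,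
        ← eq_sub_iff_add_eq']
      exact this.symm
  have hqd : ∀ t, HasDerivAt q (g t) t := by
    intro t
    have h := (intervalIntegral.integral_hasDerivAt_right (hgc.intervalIntegrable 0 t)
      hgc.stronglyMeasurable.stronglyMeasurableAtFilter hgc.continuousAt).const_add
        (1 : Matrix (Fin d) (Fin d) ℂ)
    exact h.congr_of_eventuallyEq (Eventually.of_forall hint)
  have hsol : IsPrincipalSolution (fun t => (-Complex.I) • M.sysHam t)
      fun t : ℝ => q t * NormedSpace.exp ((-(Complex.I * t)) • Hbar) := by
    refine ⟨?_, fun t => ?_⟩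
    · simp [hq0]
    · refine ((hqd t).mul (hasDerivAt_exp_neg_I_smul Hbar t)).congr_deriv ?_
      simp only [hg, smul_mul_assoc, mul_smul_comm, sub_mul, smul_sub, mul_assoc]
      abel
  have h := IsPrincipalSolution.unique (M := ‖M.ham‖)
    (fun t => by simpa [norm_smul] using M.norm_sysHam_le t) M.sysEvolution_spec hsol
  exact congrFun h t

/-- The entries of the `ω`-component of `p* S_μ p`, as functions on the torus. -/
noncomputable def couplingEntry (M : OpenSystem d r ι E)
    (p : C(UnitAddTorus (Fin r), Matrix (Fin d) (Fin d) ℂ)) (hH : Hbar.IsHermitian) (μ : ι) (ω : ℝ)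
    (i j : Fin d) : C(UnitAddTorus (Fin r), ℂ) where
  toFun θ := bohrComponent hH ω ((p θ).conjTranspose * M.S μ * p θ) i j
  continuous_toFun := by
    have h : Continuous fun θ => star (p θ) * M.S μ * p θ :=
      (p.continuous.star.mul continuous_const).mul p.continuous
    exact ((bohrComponentCLM hH ω).continuous.comp h).matrix_elem i j

theorem mFourierCoeff_couplingEntry (hH : Hbar.IsHermitian) (μ : ι) (ω : ℝ) (i j : Fin d)
    (n : Fin r → ℤ) :
    UnitAddTorus.mFourierCoeff (M.couplingEntry p hH μ ω i j) n = M.jump p hH μ n ω i j := by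
  have hc : Continuous fun θ => UnitAddTorus.mFourier (-n) θ •
      ((p θ).conjTranspose * M.S μ * p θ) := by
    have h : Continuous fun θ => star (p θ) * M.S μ * p θ :=
      (p.continuous.star.mul continuous_const).mul p.continuous
    exact (UnitAddTorus.mFourier (-n)).continuous.smul h
  have h := ((LinearMap.toContinuousLinearMap (Matrix.entryLinearMap ℂ ℂ i j)) ∘L
    bohrComponentCLM hH ω).integral_comp_comm (integrable_torusHaar hc)
  rw [jump, mFourierCoeff_eq_integral_torusHaar, mFourierCoeff_eq_integral_torusHaar]
  refine Eq.trans (integral_congr_ae (Eventually.of_forall fun θ => ?_)) h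
  simp only [map_smul]
  rfl

/-- The coupling in the interaction picture is quasiperiodic up to the phases of the Bohr
quasi-frequencies. -/
theorem IsReducedBy.sysCoupling_apply (hred : M.IsReducedBy p Hbar)
    (hΩ : RationallyIndependent M.freq) (μ : ι) (t : ℝ) (i j : Fin d) :
    M.sysCoupling μ t i j = ∑ ω ∈ bohrFreq hred.isHermitian, Complex.exp (Complex.I * ω * t) *
      M.couplingEntry p hred.isHermitian μ ω i j (winding M.freq t) := by
  set θ := winding M.freq t
  have hstar : star (NormedSpace.exp ((-(Complex.I * t)) • Hbar)) =
      NormedSpace.exp ((Complex.I * t) • Hbar) := by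
    rw [NormedSpace.star_exp, star_smul, (show star Hbar = Hbar from hred.isHermitian)]
    simp
  have e : M.sysCoupling μ t = NormedSpace.exp ((Complex.I * t) • Hbar) *
      ((p θ).conjTranspose * M.S μ * p θ) * NormedSpace.exp ((-(Complex.I * t)) • Hbar) := by
    rw [sysCoupling, hred.sysEvolution_eq hΩ, star_mul, hstar]
    simp only [mul_assoc]
    rfl
  rw [e, exp_mul_mul_exp_eq_sum_bohrComponent hred.isHermitian, Matrix.sum_apply]
  rfl

end OpenSystem

/-! ### Existence and continuity of the operators `K̃` -/

section MatrixEntries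
variable {d : ℕ}

theorem exists_norm_entry_le : ∃ C : ℝ, 0 ≤ C ∧
    ∀ (X : Matrix (Fin d) (Fin d) ℂ) (i j : Fin d), ‖X i j‖ ≤ C * ‖X‖ := by
  set L : Fin d → Fin d → Matrix (Fin d) (Fin d) ℂ →L[ℂ] ℂ := fun i j =>
    LinearMap.toContinuousLinearMap (Matrix.entryLinearMap ℂ ℂ i j)
  refine ⟨∑ i, ∑ j, ‖L i j‖, by positivity, fun X i j => ((L i j).le_opNorm X).trans ?_⟩
  refine mul_le_mul_of_nonneg_right ?_ (norm_nonneg X)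
  exact (Finset.single_le_sum (f := fun j => ‖L i j‖) (fun _ _ => norm_nonneg _)
    (Finset.mem_univ j)).trans (Finset.single_le_sum (f := fun i => ∑ j, ‖L i j‖)
      (fun _ _ => by positivity) (Finset.mem_univ i))

theorem Continuous.entryProducts {T : Type*} [TopologicalSpace T]
    {X Y : T → Matrix (Fin d) (Fin d) ℂ} (hX : Continuous X) (hY : Continuous Y) :
    Continuous fun t => entryProducts (X t) (Y t) :=
  continuous_pi fun _ => (Complex.continuous_conj.comp (hX.matrix_elem _ _)).mul
    (hY.matrix_elem _ _)

end MatrixEntries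

namespace OpenSystem
open TraceClass MeasureTheory Filter Topology

variable {d r : ℕ} {ι : Type*} [Fintype ι] {E : Type*} [NormedAddCommGroup E]
  [InnerProductSpace ℂ E] [CompleteSpace E] (M : OpenSystem d r ι E)

theorem norm_sysCoupling_le (μ : ι) (t : ℝ) : ‖M.sysCoupling μ t‖ ≤ ‖M.S μ‖ := by
  have h1 : ‖(1 : Matrix (Fin d) (Fin d) ℂ)‖ ≤ 1 := by
    rcases subsingleton_or_nontrivial (Matrix (Fin d) (Fin d) ℂ) with h | h
    · rw [Subsingleton.elim (1 : Matrix (Fin d) (Fin d) ℂ) 0, norm_zero]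
      exact zero_le_one
    · exact CStarRing.norm_one.le
  have hu : ‖M.sysEvolution t‖ ≤ 1 := by
    have h := CStarRing.norm_star_mul_self (x := M.sysEvolution t)
    rw [star_sysEvolution_mul] at h
    nlinarith [norm_nonneg (M.sysEvolution t)]
  have hu' : ‖star (M.sysEvolution t)‖ ≤ 1 := by rwa [norm_star]
  refine (norm_mul_le _ _).trans ?_
  refine (mul_le_of_le_one_right (norm_nonneg _) hu).trans ((norm_mul_le _ _).trans ?_)
  exact mul_le_of_le_one_left (norm_nonneg _) hu'

theorem continuous_sysCoupling (μ : ι) : Continuous (M.sysCoupling μ) :=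
  (M.continuous_sysEvolution.star.mul continuous_const).mul M.continuous_sysEvolution

/-- The integrand of the memory integral, in coordinates. -/
noncomputable def memoryIntegrand (μ ν : ι) (s x : ℝ) :
    (Fin d × Fin d) × (Fin d × Fin d) → ℂ :=
  M.autocorr μ ν x • entryProducts (M.sysCoupling μ (x + s)) (M.sysCoupling ν s)

/-- The memory integral `∫_0^∞ f_{μν}(x) conj σ_μ(s + x) ⊗ σ_ν(s) dx`, in coordinates, for the
couplings `σ_μ(s) = u_s* S_μ u_s`. -/
noncomputable def memoryIntegral (μ ν : ι) (s : ℝ) : (Fin d × Fin d) × (Fin d × Fin d) → ℂ :=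
  ∫ x in Set.Ici (0 : ℝ), M.memoryIntegrand μ ν s x

theorem exists_norm_memoryIntegrand_le (μ ν : ι) :
    ∃ C, ∀ s x, ‖M.memoryIntegrand μ ν s x‖ ≤ ‖M.autocorr μ ν x‖ * C := by
  obtain ⟨C, hC0, hC⟩ := exists_norm_entry_le (d := d)
  refine ⟨(C * ‖M.S μ‖) * (C * ‖M.S ν‖), fun s x => ?_⟩
  rw [memoryIntegrand, norm_smul]
  refine mul_le_mul_of_nonneg_left ?_ (norm_nonneg _)
  refine (pi_norm_le_iff_of_nonneg (by positivity)).2 fun q => ?_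
  have hb : ∀ μ t i j, ‖M.sysCoupling μ t i j‖ ≤ C * ‖M.S μ‖ := fun μ t i j =>
    (hC _ i j).trans (mul_le_mul_of_nonneg_left (M.norm_sysCoupling_le μ t) hC0)
  rw [entryProducts, norm_mul, RCLike.norm_conj]
  exact mul_le_mul (hb _ _ _ _) (hb _ _ _ _) (norm_nonneg _) (by positivity)

variable {M} in
theorem aestronglyMeasurable_memoryIntegrand {μ ν : ι}
    (hf : IntegrableOn (M.autocorr μ ν) (Set.Ici 0)) (s : ℝ) :
    AEStronglyMeasurable (M.memoryIntegrand μ ν s) (volume.restrict (Set.Ici 0)) := by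
  refine hf.aestronglyMeasurable.smul ?_
  exact (((M.continuous_sysCoupling μ).comp (continuous_id.add continuous_const)).entryProducts
    continuous_const).aestronglyMeasurable

variable {M} in
theorem integrableOn_memoryIntegrand {μ ν : ι} (hf : IntegrableOn (M.autocorr μ ν) (Set.Ici 0))
    (s : ℝ) : IntegrableOn (M.memoryIntegrand μ ν s) (Set.Ici 0) := by
  obtain ⟨C, hC⟩ := M.exists_norm_memoryIntegrand_le μ ν
  exact Integrable.mono' (hf.norm.mul_const C) (aestronglyMeasurable_memoryIntegrand hf s)
    (Eventually.of_forall (hC s))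

variable {M} in
theorem continuous_memoryIntegral {μ ν : ι} (hf : IntegrableOn (M.autocorr μ ν) (Set.Ici 0)) :
    Continuous (M.memoryIntegral μ ν) := by
  obtain ⟨C, hC⟩ := M.exists_norm_memoryIntegrand_le μ ν
  have hx : ∀ x, Continuous fun s => M.memoryIntegrand μ ν s x := fun x => by
    have h := ((M.continuous_sysCoupling μ).comp
      (continuous_const.add continuous_id : Continuous fun s : ℝ => x + s)).entryProducts
        (M.continuous_sysCoupling ν)
    exact h.const_smul (M.autocorr μ ν x)
  have hI : Integrable (fun x => ‖M.autocorr μ ν x‖ * C) (volume.restrict (Set.Ici (0 : ℝ))) :=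
    hf.norm.mul_const C
  exact continuous_of_dominated (F := M.memoryIntegrand μ ν)
    (bound := fun x => ‖M.autocorr μ ν x‖ * C)
    (fun s => aestronglyMeasurable_memoryIntegrand hf s) (fun s => Eventually.of_forall (hC s))
    hI (Eventually.of_forall hx)

/-- `memoryForm`, extended to operators on `𝓑` by `lift`. -/
noncomputable def liftedForm : ((Fin d × Fin d) × (Fin d × Fin d) → ℂ) →L[ℝ]
    (M.Space →L[ℂ] M.Space) :=
  LinearMap.toContinuousLinearMap ((M.lift.restrictScalars ℝ) ∘ₗ memoryForm.toLinearMap)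

theorem liftedForm_apply (c : (Fin d × Fin d) × (Fin d × Fin d) → ℂ) (a : M.Space) :
    M.liftedForm c a = tensorState M.envState (memoryForm c (partialTrace a)) := rfl

theorem inverse_evolution_mul_kernel_mul_eq_liftedForm (s x : ℝ) :
    Ring.inverse (M.evolution s) * M.kernel s x * M.evolution s =
      -M.liftedForm (∑ μ, ∑ ν, M.memoryIntegrand μ ν s x) := by
  rw [inverse_evolution_mul_kernel_mul]
  simp only [map_sum]
  rfl

theorem kernel_eq (s x : ℝ) : M.kernel s x = M.evolution s *
    (-M.liftedForm (∑ μ, ∑ ν, M.memoryIntegrand μ ν s x)) * Ring.inverse (M.evolution s) := by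
  rw [← inverse_evolution_mul_kernel_mul_eq_liftedForm]
  obtain ⟨u, hu⟩ := M.isUnit_evolution s
  rw [← hu, Ring.inverse_unit]
  simp only [mul_assoc, Units.mul_inv, mul_one, Units.mul_inv_cancel_left]

section Integrable
variable {M}

theorem integrableOn_sum_memoryIntegrand
    (hf : ∀ μ ν, IntegrableOn (M.autocorr μ ν) (Set.Ici 0)) (s : ℝ) :
    IntegrableOn (fun x => ∑ μ, ∑ ν, M.memoryIntegrand μ ν s x) (Set.Ici 0) :=
  integrable_finsetSum _ fun μ _ => integrable_finsetSum _ fun ν _ =>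
    integrableOn_memoryIntegrand (hf μ ν) s

theorem integrableOn_kernel
    (hf : ∀ μ ν, IntegrableOn (M.autocorr μ ν) (Set.Ici 0)) (s : ℝ) :
    IntegrableOn (M.kernel s) (Set.Ici 0) := by
  have h := M.liftedForm.integrable_comp (integrableOn_sum_memoryIntegrand hf s)
  have h2 := ((h.neg.const_mul (M.evolution s)).mul_const (Ring.inverse (M.evolution s)))
  exact h2.congr (Eventually.of_forall fun x => (M.kernel_eq s x).symm)

theorem integral_kernel
    (hf : ∀ μ ν, IntegrableOn (M.autocorr μ ν) (Set.Ici 0)) (s : ℝ) :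
    ∫ x in Set.Ici (0 : ℝ), M.kernel s x = M.evolution s *
    (-M.liftedForm (∑ μ, ∑ ν, M.memoryIntegral μ ν s)) * Ring.inverse (M.evolution s) := by
  have h : IntegrableOn (fun x => -M.liftedForm (∑ μ, ∑ ν, M.memoryIntegrand μ ν s x))
      (Set.Ici 0) := (M.liftedForm.integrable_comp (integrableOn_sum_memoryIntegrand hf s)).neg
  have e : ∑ μ, ∑ ν, M.memoryIntegral μ ν s =
      ∫ x in Set.Ici (0 : ℝ), ∑ μ, ∑ ν, M.memoryIntegrand μ ν s x := by
    rw [integral_finsetSum _ fun μ _ => integrable_finsetSum _ fun ν _ =>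
      integrableOn_memoryIntegrand (hf μ ν) s]
    refine Finset.sum_congr rfl fun μ _ => ?_
    rw [integral_finsetSum _ fun ν _ => integrableOn_memoryIntegrand (hf μ ν) s]
    rfl
  rw [e, ← M.liftedForm.integral_comp_comm (integrableOn_sum_memoryIntegrand hf s), ← integral_neg,
    ← integral_const_mul_of_integrable h, ← integral_mul_const_of_integrable (h.const_mul _)]
  exact integral_congr_ae (Eventually.of_forall fun x => M.kernel_eq s x)

theorem continuous_sum_memoryIntegral
    (hf : ∀ μ ν, IntegrableOn (M.autocorr μ ν) (Set.Ici 0)) :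
    Continuous fun s => ∑ μ, ∑ ν, M.memoryIntegral μ ν s :=
  continuous_finsetSum _ fun μ _ => continuous_finsetSum _ fun ν _ =>
    continuous_memoryIntegral (hf μ ν)

theorem continuous_Ktilde
    (hf : ∀ μ ν, IntegrableOn (M.autocorr μ ν) (Set.Ici 0)) (lam : ℝ) :
    Continuous (M.Ktilde lam) := by
  have hs : Continuous fun t : ℝ => (lam ^ 2)⁻¹ * t := by fun_prop
  have h1 : Continuous fun s => -M.liftedForm (∑ μ, ∑ ν, M.memoryIntegral μ ν s) :=
    (M.liftedForm.continuous.comp (continuous_sum_memoryIntegral hf)).neg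
  have h2 := (((M.continuous_evolution.mul h1).mul M.continuous_inverse_evolution).comp hs)
  refine h2.congr fun t => ?_
  rw [Ktilde, integral_kernel hf]
  rfl

theorem inverse_evolution_mul_Ktilde_mul
    (hf : ∀ μ ν, IntegrableOn (M.autocorr μ ν) (Set.Ici 0)) (lam t : ℝ) :
    Ring.inverse (M.evolution ((lam ^ 2)⁻¹ * t)) * M.Ktilde lam t *
      M.evolution ((lam ^ 2)⁻¹ * t) =
    -M.liftedForm (∑ μ, ∑ ν, M.memoryIntegral μ ν ((lam ^ 2)⁻¹ * t)) := by
  obtain ⟨u, hu⟩ := M.isUnit_evolution ((lam ^ 2)⁻¹ * t)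
  rw [Ktilde, integral_kernel hf, ← hu, Ring.inverse_unit]
  simp only [mul_assoc, Units.inv_mul, mul_one, Units.inv_mul_cancel_left]

end Integrable

theorem proj0_Ktilde (hf : ∀ μ ν, IntegrableOn (M.autocorr μ ν) (Set.Ici 0)) (lam t : ℝ)
    (a : M.Space) : M.proj0 (M.Ktilde lam t a) = M.Ktilde lam t a := by
  have h : ∀ c, M.proj0 * M.liftedForm c = M.liftedForm c := fun c =>
    ContinuousLinearMap.ext fun a => by
      rw [mul_apply_eq_comp, liftedForm_apply, proj0_apply, partialTrace_tensorState,
        M.trace_envState, one_smul]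
  have e : M.proj0 * M.Ktilde lam t = M.Ktilde lam t := by
    rw [Ktilde, integral_kernel hf, ← mul_assoc, ← mul_assoc,
      ← (M.commute_evolution_proj0 _).eq, mul_assoc (M.evolution _) M.proj0, mul_neg, h]
  exact DFunLike.congr_fun e a

theorem Ktilde_restrict (hf : ∀ μ ν, IntegrableOn (M.autocorr μ ν) (Set.Ici 0)) (lam : ℝ) :
    ∃ K₀ : ℝ → M.space0 →L[ℂ] M.space0, Continuous K₀ ∧
        ∀ t (a : M.space0), (K₀ t a : M.Space) = M.Ktilde lam t a := by
  set P : M.Space →L[ℂ] M.space0 := M.proj0.codRestrict M.space0 fun a => ⟨a, rfl⟩ with hP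
  refine ⟨fun t => P ∘L M.Ktilde lam t ∘L M.space0.subtypeL, ?_, fun t a => ?_⟩
  · exact continuous_const.clm_comp ((continuous_Ktilde hf lam).clm_comp continuous_const)
  · exact M.proj0_Ktilde hf lam t a

end OpenSystem

/-! ### The averaged memory integral -/

namespace OpenSystem
open TraceClass MeasureTheory Filter Topology
open scoped ComplexConjugate

variable {d r : ℕ} {ι : Type*} [Fintype ι] {E : Type*} [NormedAddCommGroup E]
  [InnerProductSpace ℂ E] [CompleteSpace E] {M : OpenSystem d r ι E}
  {p : C(UnitAddTorus (Fin r), Matrix (Fin d) (Fin d) ℂ)} {Hbar : Matrix (Fin d) (Fin d) ℂ}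

theorem memoryIntegral_apply {μ ν : ι} (hf : IntegrableOn (M.autocorr μ ν) (Set.Ici 0)) (s : ℝ)
    (q : (Fin d × Fin d) × (Fin d × Fin d)) :
    M.memoryIntegral μ ν s q = ∫ x in Set.Ici (0 : ℝ), M.autocorr μ ν x *
      (conj (M.sysCoupling μ (x + s) q.1.1 q.1.2) * M.sysCoupling ν s q.2.1 q.2.2) :=
  ((ContinuousLinearMap.proj (R := ℂ) (φ := fun _ => ℂ) q).integral_comp_comm
    (integrableOn_memoryIntegrand hf s)).symm

/-- The limit of the averages of `memoryIntegral`, in coordinates. It is a series over the Fourier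
modes `n`, in which only pairs with the same `n` and the same Bohr quasi-frequency occur. -/
noncomputable def limitCoeff (M : OpenSystem d r ι E)
    (p : C(UnitAddTorus (Fin r), Matrix (Fin d) (Fin d) ℂ)) (hH : Hbar.IsHermitian) (μ ν : ι) :
    (Fin d × Fin d) × (Fin d × Fin d) → ℂ := fun q =>
  ∑ ω ∈ bohrFreq hH, ∑' n, conj (M.jump p hH μ n ω q.1.1 q.1.2) * M.jump p hH ν n ω q.2.1 q.2.2 *
    halfFourier (M.autocorr μ ν) (ω + intDot n M.freq)

/-- The averages of the memory integral converge: congruence freedom removes all pairs of distinct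
Bohr quasi-frequencies. -/
theorem IsReducedBy.tendsto_average_memoryIntegral (hred : M.IsReducedBy p Hbar)
    (hΩ : RationallyIndependent M.freq) (hB : CongruenceFree M.freq hred.isHermitian) {μ ν : ι}
    (hf : IntegrableOn (M.autocorr μ ν) (Set.Ici 0)) :
    Tendsto (fun δ : ℝ => (1 / (2 * δ)) • ∫ s in (-δ)..δ, M.memoryIntegral μ ν s) atTop
      (𝓝 (M.limitCoeff p hred.isHermitian μ ν)) := by
  have hαβ : ∀ α ∈ bohrFreq hred.isHermitian, ∀ β ∈ bohrFreq hred.isHermitian,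
      α = β ∨ ∀ k, β - α + intDot k M.freq ≠ 0 := by
    intro α hα β hβ
    by_cases h : α = β
    · exact Or.inl h
    · refine Or.inr fun k hk => ?_
      by_cases hk0 : k = 0
      · rw [hk0, intDot_zero, add_zero, sub_eq_zero] at hk
        exact h hk.symm
      · exact hB α hα β hβ k hk0 (by linarith)
  refine tendsto_pi_nhds.2 fun q => ?_
  have h := tendsto_average_memory_sum hΩ hf (bohrFreq hred.isHermitian)
    (fun ω => M.couplingEntry p hred.isHermitian μ ω q.1.1 q.1.2)
    (fun ω => M.couplingEntry p hred.isHermitian ν ω q.2.1 q.2.2) hαβ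
    (X := fun t => M.sysCoupling μ t q.1.1 q.1.2) (Y := fun t => M.sysCoupling ν t q.2.1 q.2.2)
    (fun t => hred.sysCoupling_apply hΩ μ t _ _) (fun t => hred.sysCoupling_apply hΩ ν t _ _)
  simp only [mFourierCoeff_couplingEntry] at h
  have e : ∀ δ : ℝ, (∫ s in (-δ)..δ, M.memoryIntegral μ ν s) q =
      ∫ s in (-δ)..δ, M.memoryIntegral μ ν s q := fun δ =>
    ((ContinuousLinearMap.proj (R := ℂ) (φ := fun _ => ℂ) q).intervalIntegral_comp_comm
      ((continuous_memoryIntegral hf).intervalIntegrable (μ := volume) (-δ) δ)).symm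
  simp only [Pi.smul_apply, e, memoryIntegral_apply hf]
  exact h

theorem summable_norm_jump_entry_mul (hH : Hbar.IsHermitian) (μ ν : ι) (ω : ℝ)
    (q : (Fin d × Fin d) × (Fin d × Fin d)) :
    Summable fun n => ‖M.jump p hH μ n ω q.1.1 q.1.2‖ * ‖M.jump p hH ν n ω q.2.1 q.2.2‖ := by
  simpa only [mFourierCoeff_couplingEntry] using summable_norm_mFourierCoeff_mul
    (M.couplingEntry p hH μ ω q.1.1 q.1.2) (M.couplingEntry p hH ν ω q.2.1 q.2.2)

theorem norm_le_sum_norm_entry (X : Matrix (Fin d) (Fin d) ℂ) :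
    ‖X‖ ≤ ∑ q : Fin d × Fin d, ‖X q.1 q.2‖ * ‖Matrix.single q.1 q.2 (1 : ℂ)‖ := by
  conv_lhs => rw [← sum_smul_single X]
  refine (norm_sum_le _ _).trans (Finset.sum_le_sum fun q _ => (norm_smul_le _ _))

/-- The Fourier coefficients of continuous functions are square summable; this gives the absolute
convergence of all the series over `n`. -/
theorem summable_norm_jump_mul (hH : Hbar.IsHermitian) (μ ν : ι) (ω : ℝ) :
    Summable fun n => ‖M.jump p hH μ n ω‖ * ‖M.jump p hH ν n ω‖ := by
  have h : Summable fun n => ∑ q : (Fin d × Fin d) × (Fin d × Fin d),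
      (‖M.jump p hH μ n ω q.1.1 q.1.2‖ * ‖M.jump p hH ν n ω q.2.1 q.2.2‖) *
      (‖Matrix.single q.1.1 q.1.2 (1 : ℂ)‖ * ‖Matrix.single q.2.1 q.2.2 (1 : ℂ)‖) :=
    summable_sum fun q _ => (summable_norm_jump_entry_mul hH μ ν ω q).mul_right _
  refine Summable.of_nonneg_of_le (fun _ => by positivity) (fun n => ?_) h
  refine (mul_le_mul (norm_le_sum_norm_entry _) (norm_le_sum_norm_entry _) (norm_nonneg _)
    (by positivity)).trans (le_of_eq ?_)
  rw [Finset.sum_mul_sum, Fintype.sum_prod_type (f := fun q : (Fin d × Fin d) × (Fin d × Fin d) => _)]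
  exact Finset.sum_congr rfl fun i _ => Finset.sum_congr rfl fun j _ => by ring

/-- A series with bounded coefficients in products of Fourier coefficients converges. -/
theorem summable_sum_smul_jump {V : Type*} [NormedAddCommGroup V] [NormedSpace ℂ V]
    [CompleteSpace V] (hH : Hbar.IsHermitian) (μ ν : ι) {g : ℝ → ℂ} {C : ℝ} (hg : ∀ ω, ‖g ω‖ ≤ C)
    {T : Matrix (Fin d) (Fin d) ℂ → Matrix (Fin d) (Fin d) ℂ → V} {D : ℝ}
    (hT : ∀ X Y, ‖T X Y‖ ≤ D * (‖X‖ * ‖Y‖)) :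
    Summable fun n => ∑ ω ∈ bohrFreq hH, g (ω + intDot n M.freq) •
      T (M.jump p hH μ n ω) (M.jump p hH ν n ω) := by
  have hC : 0 ≤ C := (norm_nonneg _).trans (hg 0)
  refine summable_sum fun ω _ => Summable.of_norm_bounded
    ((summable_norm_jump_mul (M := M) (p := p) hH μ ν ω).mul_left (C * D)) fun n => ?_
  rw [norm_smul, mul_assoc]
  exact mul_le_mul (hg _) (hT _ _) (norm_nonneg _) hC

theorem hasSum_limitCoeff (hH : Hbar.IsHermitian) (μ ν : ι) :
    HasSum (fun n => ∑ ω ∈ bohrFreq hH, halfFourier (M.autocorr μ ν) (ω + intDot n M.freq) •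
      entryProducts (M.jump p hH μ n ω) (M.jump p hH ν n ω)) (M.limitCoeff p hH μ ν) := by
  refine Pi.hasSum.2 fun q => ?_
  simp only [Finset.sum_apply]
  refine hasSum_sum fun ω _ => ?_
  have hs : Summable fun n => conj (M.jump p hH μ n ω q.1.1 q.1.2) *
      M.jump p hH ν n ω q.2.1 q.2.2 *
      halfFourier (M.autocorr μ ν) (ω + intDot n M.freq) := by
    refine Summable.of_norm_bounded ((summable_norm_jump_entry_mul (M := M) (p := p) hH μ ν ω
      q).mul_right (∫ x in Set.Ici (0 : ℝ), ‖M.autocorr μ ν x‖)) fun n => ?_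
    rw [norm_mul, norm_mul, RCLike.norm_conj]
    exact mul_le_mul_of_nonneg_left (norm_halfFourier_le _ _) (by positivity)
  refine hs.hasSum.congr_fun fun n => ?_
  rw [Pi.smul_apply, entryProducts, smul_eq_mul, mul_comm]

theorem integrableOn_autocorr_Iio (hf : ∀ μ ν, IntegrableOn (M.autocorr μ ν) (Set.Ici 0))
    (μ ν : ι) : IntegrableOn (M.autocorr μ ν) (Set.Iio 0) := by
  have h1 : IntegrableOn (fun x => M.autocorr ν μ (-x)) (Neg.neg ⁻¹' Set.Ioi 0) :=
    ((Measure.measurePreserving_neg (volume : Measure ℝ)).integrableOn_comp_preimage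
      (MeasurableEquiv.neg ℝ).measurableEmbedding).2 ((hf ν μ).mono_set Set.Ioi_subset_Ici_self)
  have h2 : Neg.neg ⁻¹' Set.Ioi (0 : ℝ) = Set.Iio 0 := by
    ext x
    simp
  rw [h2] at h1
  refine ((RCLike.conjLIE (K := ℂ)).integrable_comp_iff.2 h1).congr
    (Eventually.of_forall fun x => ?_)
  change conj (M.autocorr ν μ (-x)) = _
  rw [autocorr_neg, Complex.conj_conj]

theorem integrable_autocorr (hf : ∀ μ ν, IntegrableOn (M.autocorr μ ν) (Set.Ici 0)) (μ ν : ι) :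
    Integrable (M.autocorr μ ν) := by
  rw [← integrableOn_univ, ← Set.Iio_union_Ici (a := (0 : ℝ))]
  exact (integrableOn_autocorr_Iio hf μ ν).union (hf μ ν)

/-- `h_{μν} = Γ_{μν} + conj Γ_{νμ}` for the one-sided transforms `Γ`, as
`f_{μν}(-x) = conj f_{νμ}(x)`. -/
theorem fourierH_eq (hf : ∀ μ ν, IntegrableOn (M.autocorr μ ν) (Set.Ici 0)) (μ ν : ι) (ω : ℝ) :
    M.fourierH μ ν ω = halfFourier (M.autocorr μ ν) ω + conj (halfFourier (M.autocorr ν μ) ω) := by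
  have h := (intervalIntegral.integral_Iic_add_Ioi (b := (0 : ℝ))
    ((integrable_autocorr hf μ ν).integrableOn.mul_exp (s := Set.Iic 0) ω)
    ((integrable_autocorr hf μ ν).integrableOn.mul_exp (s := Set.Ioi 0) ω)).symm
  rw [fourierH, h, add_comm, halfFourier, halfFourier, integral_Ici_eq_integral_Ioi,
    integral_Ici_eq_integral_Ioi, ← integral_conj]
  congr 1
  have e := integral_comp_neg_Ioi (0 : ℝ) fun x : ℝ =>
    M.autocorr μ ν x * Complex.exp (-(Complex.I * ω * x))
  rw [neg_zero] at e
  rw [← e]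
  refine integral_congr_ae (Eventually.of_forall fun x => ?_)
  simp only [autocorr_neg, map_mul, ← Complex.exp_conj]
  simp

end OpenSystem

/-! ### The local average and its generator -/

open MeasureTheory Filter Topology in
/-- A symmetric average does not change under a rescaling of time. -/
theorem tendsto_average_comp_mul {V : Type*} [NormedAddCommGroup V] [NormedSpace ℝ V]
    {g : ℝ → V} {L : V}
    (h : Tendsto (fun δ : ℝ => (1 / (2 * δ)) • ∫ s in (-δ)..δ, g s) atTop (𝓝 L)) {c : ℝ}
    (hc : 0 < c) :
    Tendsto (fun δ : ℝ => (1 / (2 * δ)) • ∫ s in (-δ)..δ, g (c * s)) atTop (𝓝 L) := by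
  refine (h.comp (tendsto_id.const_mul_atTop hc)).congr fun δ => ?_
  rw [intervalIntegral.integral_comp_mul_left g hc.ne', smul_smul, Function.comp_apply, id, mul_neg]
  congr 1
  field_simp

namespace OpenSystem
open TraceClass MeasureTheory Filter Topology
open scoped ComplexConjugate

variable {d r : ℕ} {ι : Type*} [Fintype ι] {E : Type*} [NormedAddCommGroup E]
  [InnerProductSpace ℂ E] [CompleteSpace E] {M : OpenSystem d r ι E}
  {p : C(UnitAddTorus (Fin r), Matrix (Fin d) (Fin d) ℂ)} {Hbar : Matrix (Fin d) (Fin d) ℂ}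

/-- The local average of `K̃` is the lift of the limit of the averaged memory integrals. -/
theorem IsReducedBy.isLocalAverage (hred : M.IsReducedBy p Hbar)
    (hΩ : RationallyIndependent M.freq) (hB : CongruenceFree M.freq hred.isHermitian)
    (hf : ∀ μ ν, IntegrableOn (M.autocorr μ ν) (Set.Ici 0)) {lam : ℝ} (hlam : 0 < lam) :
    M.IsLocalAverage lam (M.Ktilde lam)
      (-M.liftedForm (∑ μ, ∑ ν, M.limitCoeff p hred.isHermitian μ ν)) := by
  have hc : 0 < (lam ^ 2)⁻¹ := by positivity
  have hcont := continuous_sum_memoryIntegral hf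
  have hlim : Tendsto (fun δ : ℝ => (1 / (2 * δ)) •
      ∫ s in (-δ)..δ, ∑ μ, ∑ ν, M.memoryIntegral μ ν s) atTop
      (𝓝 (∑ μ, ∑ ν, M.limitCoeff p hred.isHermitian μ ν)) := by
    refine (tendsto_finsetSum Finset.univ fun μ _ => tendsto_finsetSum Finset.univ fun ν _ =>
      hred.tendsto_average_memoryIntegral hΩ hB (hf μ ν)).congr fun δ => ?_
    rw [intervalIntegral.integral_finsetSum fun μ _ => (continuous_finsetSum _ fun ν _ =>
      continuous_memoryIntegral (hf μ ν)).intervalIntegrable _ _, Finset.smul_sum]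
    refine Finset.sum_congr rfl fun μ _ => ?_
    rw [intervalIntegral.integral_finsetSum fun ν _ =>
      (continuous_memoryIntegral (hf μ ν)).intervalIntegrable _ _, Finset.smul_sum]
  have hcl : Continuous fun t : ℝ => ∑ μ, ∑ ν, M.memoryIntegral μ ν ((lam ^ 2)⁻¹ * t) :=
    hcont.comp (continuous_const.mul continuous_id)
  simp only [IsLocalAverage, inverse_evolution_mul_Ktilde_mul hf]
  refine ⟨fun δ => ((M.liftedForm.continuous.comp hcl).neg).intervalIntegrable _ _, ?_⟩
  refine (((M.liftedForm.continuous.tendsto _).comp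
    (tendsto_average_comp_mul hlim hc)).neg).congr fun δ => ?_
  rw [intervalIntegral.integral_neg, smul_neg, Function.comp_apply, map_smul]
  have e := M.liftedForm.intervalIntegral_comp_comm (hcl.intervalIntegrable (μ := volume) (-δ) δ)
  rw [e]

theorem exists_norm_fourierH_le (hf : ∀ μ ν, IntegrableOn (M.autocorr μ ν) (Set.Ici 0)) (μ ν : ι) :
    ∃ C, ∀ ω, ‖M.fourierH μ ν ω‖ ≤ C :=
  ⟨(∫ x in Set.Ici (0 : ℝ), ‖M.autocorr μ ν x‖) + ∫ x in Set.Ici (0 : ℝ), ‖M.autocorr ν μ x‖,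
    fun ω => by
    rw [fourierH_eq hf]
    refine (norm_add_le _ _).trans (add_le_add (norm_halfFourier_le _ _) ?_)
    rw [RCLike.norm_conj]
    exact norm_halfFourier_le _ _⟩

theorem fourierZeta_eq (hf : ∀ μ ν, IntegrableOn (M.autocorr μ ν) (Set.Ici 0)) (μ ν : ι) (ω : ℝ) :
    M.fourierZeta μ ν ω = (halfFourier (M.autocorr μ ν) ω -
      conj (halfFourier (M.autocorr ν μ) ω)) / (2 * Complex.I) := by
  rw [fourierZeta, fourierH_eq hf, ← halfFourier]
  field_simp
  ring

theorem exists_norm_fourierZeta_le (hf : ∀ μ ν, IntegrableOn (M.autocorr μ ν) (Set.Ici 0))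
    (μ ν : ι) :
    ∃ C, ∀ ω, ‖M.fourierZeta μ ν ω‖ ≤ C :=
  ⟨((∫ x in Set.Ici (0 : ℝ), ‖M.autocorr μ ν x‖) +
      ∫ x in Set.Ici (0 : ℝ), ‖M.autocorr ν μ x‖) / ‖2 * Complex.I‖, fun ω => by
    rw [fourierZeta_eq hf, norm_div]
    refine div_le_div_of_nonneg_right ((norm_sub_le _ _).trans
      (add_le_add (norm_halfFourier_le _ _) ?_)) (norm_nonneg _)
    rw [RCLike.norm_conj]
    exact norm_halfFourier_le _ _⟩

theorem conj_fourierZeta (hf : ∀ μ ν, IntegrableOn (M.autocorr μ ν) (Set.Ici 0)) (μ ν : ι) (ω : ℝ) :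
    conj (M.fourierZeta μ ν ω) = M.fourierZeta ν μ ω := by
  rw [fourierZeta_eq hf, fourierZeta_eq hf]
  simp only [map_div₀, map_sub, map_mul, Complex.conj_conj, Complex.conj_I, map_ofNat]
  field_simp
  ring

theorem halfFourier_autocorr (hf : ∀ μ ν, IntegrableOn (M.autocorr μ ν) (Set.Ici 0)) (μ ν : ι)
    (ω : ℝ) : halfFourier (M.autocorr μ ν) ω =
      M.fourierH μ ν ω / 2 + Complex.I * M.fourierZeta μ ν ω := by
  rw [fourierZeta_eq hf, fourierH_eq hf]
  field_simp
  ring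

theorem conj_halfFourier_autocorr (hf : ∀ μ ν, IntegrableOn (M.autocorr μ ν) (Set.Ici 0))
    (μ ν : ι) (ω : ℝ) : conj (halfFourier (M.autocorr ν μ) ω) =
      M.fourierH μ ν ω / 2 - Complex.I * M.fourierZeta μ ν ω := by
  rw [fourierZeta_eq hf, fourierH_eq hf]
  field_simp
  ring

theorem summable_lambShiftTerm (hf : ∀ μ ν, IntegrableOn (M.autocorr μ ν) (Set.Ici 0))
    (hH : Hbar.IsHermitian) (μ ν : ι) : Summable (M.lambShiftTerm p hH μ ν) := by
  obtain ⟨C, hC⟩ := exists_norm_fourierZeta_le hf μ ν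
  refine summable_sum_smul_jump hH μ ν hC (T := fun X Y => X.conjTranspose * Y) (D := 1)
    fun X Y => ?_
  rw [one_mul, ← Matrix.l2_opNorm_conjTranspose X]
  exact norm_mul_le _ _

theorem summable_dissipatorTerm (hf : ∀ μ ν, IntegrableOn (M.autocorr μ ν) (Set.Ici 0))
    (hH : Hbar.IsHermitian) (ρ : Matrix (Fin d) (Fin d) ℂ) (μ ν : ι) :
    Summable (M.dissipatorTerm p hH ρ μ ν) := by
  obtain ⟨C, hC⟩ := exists_norm_fourierH_le hf μ ν
  refine summable_sum_smul_jump hH μ ν hC (T := fun X Y => Y * ρ * X.conjTranspose -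
    (1 / 2 : ℂ) • (X.conjTranspose * Y * ρ + ρ * (X.conjTranspose * Y))) (D := 2 * ‖ρ‖)
    fun X Y => ?_
  have hX := Matrix.l2_opNorm_conjTranspose X
  have hXY : ‖X.conjTranspose * Y‖ ≤ ‖X‖ * ‖Y‖ := (norm_mul_le _ _).trans (by rw [hX])
  have h1 : ‖Y * ρ * X.conjTranspose‖ ≤ ‖Y‖ * ‖ρ‖ * ‖X‖ :=
    (norm_mul_le _ _).trans (by rw [hX]; gcongr; exact norm_mul_le _ _)
  have h2 : ‖X.conjTranspose * Y * ρ‖ ≤ ‖X‖ * ‖Y‖ * ‖ρ‖ := (norm_mul_le _ _).trans (by gcongr)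
  have h3 : ‖ρ * (X.conjTranspose * Y)‖ ≤ ‖ρ‖ * (‖X‖ * ‖Y‖) := (norm_mul_le _ _).trans (by gcongr)
  have h4 : ‖(1 / 2 : ℂ) • (X.conjTranspose * Y * ρ + ρ * (X.conjTranspose * Y))‖ ≤
      1 / 2 * (‖X‖ * ‖Y‖ * ‖ρ‖ + ‖ρ‖ * (‖X‖ * ‖Y‖)) := by
    rw [norm_smul]
    refine mul_le_mul (by norm_num) ((norm_add_le _ _).trans (add_le_add h2 h3)) (norm_nonneg _)
      (by norm_num)
  refine (norm_sub_le _ _).trans ((add_le_add h1 h4).trans (le_of_eq ?_))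
  ring

theorem conjTranspose_lambShiftTerm (hf : ∀ μ ν, IntegrableOn (M.autocorr μ ν) (Set.Ici 0))
    (hH : Hbar.IsHermitian) (μ ν : ι) (n : Fin r → ℤ) :
    (M.lambShiftTerm p hH μ ν n).conjTranspose = M.lambShiftTerm p hH ν μ n := by
  simp only [lambShiftTerm, Matrix.conjTranspose_sum, Matrix.conjTranspose_smul,
    Matrix.conjTranspose_mul, Matrix.conjTranspose_conjTranspose]
  refine Finset.sum_congr rfl fun ω _ => ?_
  rw [← conj_fourierZeta hf μ ν]
  rfl

theorem isHermitian_lambShift (hf : ∀ μ ν, IntegrableOn (M.autocorr μ ν) (Set.Ici 0))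
    (hH : Hbar.IsHermitian) : (M.lambShift p hH).IsHermitian := by
  rw [Matrix.IsHermitian, lambShift]
  simp only [Matrix.conjTranspose_sum, Matrix.conjTranspose_tsum, conjTranspose_lambShiftTerm hf]
  exact Finset.sum_comm

/-- The averaged memory integral generates `-i[ΔH, ·] + D̄`. -/
theorem neg_memoryForm_limitCoeff (hf : ∀ μ ν, IntegrableOn (M.autocorr μ ν) (Set.Ici 0))
    (hH : Hbar.IsHermitian) (ρ : Matrix (Fin d) (Fin d) ℂ) :
    -memoryForm (∑ μ, ∑ ν, M.limitCoeff p hH μ ν) ρ =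
      (-Complex.I) • (M.lambShift p hH * ρ - ρ * M.lambShift p hH) + M.dissipator p hH ρ := by
  -- the two sides are sums over `n`, compared term by term
  set Φ : ((Fin d × Fin d) × (Fin d × Fin d) → ℂ) → Matrix (Fin d) (Fin d) ℂ :=
    fun c => memoryForm c ρ with hΦ
  have hΦadd : ∀ c c', Φ (c + c') = Φ c + Φ c' := fun c c' => by simp [hΦ]
  have hΦc : Continuous Φ := (ContinuousLinearMap.apply ℂ _ ρ).continuous.comp
    memoryForm.continuous
  let Ψ : ((Fin d × Fin d) × (Fin d × Fin d) → ℂ) →+ Matrix (Fin d) (Fin d) ℂ :=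
    AddMonoidHom.mk' Φ hΦadd
  have hlim : HasSum (fun n => ∑ μ, ∑ ν, ∑ ω ∈ bohrFreq hH,
      Φ (halfFourier (M.autocorr μ ν) (ω + intDot n M.freq) •
        entryProducts (M.jump p hH μ n ω) (M.jump p hH ν n ω)))
      (Φ (∑ μ, ∑ ν, M.limitCoeff p hH μ ν)) := by
    have h := (hasSum_sum fun μ (_ : μ ∈ Finset.univ) => hasSum_sum fun ν (_ : ν ∈ Finset.univ) =>
      hasSum_limitCoeff (M := M) (p := p) hH μ ν).map Ψ hΦc
    refine h.congr_fun fun n => ?_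
    simp only [Function.comp_apply, map_sum]
    rfl
  have hL : HasSum (fun n => ∑ μ, ∑ ν, M.lambShiftTerm p hH μ ν n) (M.lambShift p hH) :=
    hasSum_sum fun μ _ => hasSum_sum fun ν _ => (summable_lambShiftTerm hf hH μ ν).hasSum
  have hD : HasSum (fun n => ∑ μ, ∑ ν, M.dissipatorTerm p hH ρ μ ν n) (M.dissipator p hH ρ) :=
    hasSum_sum fun μ _ => hasSum_sum fun ν _ => (summable_dissipatorTerm hf hH ρ μ ν).hasSum
  have hR := (((hL.mul_right ρ).sub (hL.mul_left ρ)).const_smul (-Complex.I)).add hD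
  refine hlim.neg.unique (hR.congr_fun fun n => ?_)
  have hterm : ∀ μ ν ω, Φ (halfFourier (M.autocorr μ ν) (ω + intDot n M.freq) •
        entryProducts (M.jump p hH μ n ω) (M.jump p hH ν n ω)) =
      halfFourier (M.autocorr μ ν) (ω + intDot n M.freq) •
        leftForm (M.jump p hH μ n ω) (M.jump p hH ν n ω) ρ +
      conj (halfFourier (M.autocorr μ ν) (ω + intDot n M.freq)) •
        rightForm (M.jump p hH μ n ω) (M.jump p hH ν n ω) ρ := fun μ ν ω => by
    simp only [hΦ, memoryForm_smul_entryProducts]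
    rfl
  -- exchange `μ` and `ν` in the conjugate terms
  have hswap : ∑ μ, ∑ ν, ∑ ω ∈ bohrFreq hH,
      conj (halfFourier (M.autocorr μ ν) (ω + intDot n M.freq)) •
        rightForm (M.jump p hH μ n ω) (M.jump p hH ν n ω) ρ =
      ∑ μ, ∑ ν, ∑ ω ∈ bohrFreq hH,
      conj (halfFourier (M.autocorr ν μ) (ω + intDot n M.freq)) •
        rightForm (M.jump p hH ν n ω) (M.jump p hH μ n ω) ρ := Finset.sum_comm
  simp only [hterm, Finset.sum_add_distrib]
  rw [hswap]
  simp only [lambShiftTerm, dissipatorTerm, Finset.sum_mul, Finset.mul_sum, Finset.smul_sum,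
    ← Finset.sum_add_distrib, ← Finset.sum_sub_distrib, ← Finset.sum_neg_distrib]
  refine Finset.sum_congr rfl fun μ _ => Finset.sum_congr rfl fun ν _ =>
    Finset.sum_congr rfl fun ω _ => ?_
  rw [halfFourier_autocorr hf, conj_halfFourier_autocorr hf, leftForm_apply, rightForm_apply]
  simp only [smul_mul_assoc, mul_smul_comm]
  module

end OpenSystem

theorem mainTheorem4 {d r : ℕ} {ι : Type*} [Fintype ι] {E : Type*} [NormedAddCommGroup E]
    [InnerProductSpace ℂ E] [CompleteSpace E] (M : OpenSystem d r ι E)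
    (hf : ∀ μ ν, MeasureTheory.IntegrableOn (M.autocorr μ ν) (Set.Ici 0)) :
    (∀ lam : ℝ, 0 < lam →
      (∀ t, MeasureTheory.IntegrableOn (M.kernel ((lam ^ 2)⁻¹ * t)) (Set.Ici 0)) ∧
      Continuous (M.Ktilde lam) ∧
      ∃ K₀ : ℝ → M.space0 →L[ℂ] M.space0, Continuous K₀ ∧
        ∀ t (a : M.space0), (K₀ t a : M.Space) = M.Ktilde lam t a) ∧
    (∀ (p : C(UnitAddTorus (Fin r), Matrix (Fin d) (Fin d) ℂ)) (Hbar : Matrix (Fin d) (Fin d) ℂ)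
      (hred : M.IsReducedBy p Hbar),
      RationallyIndependent M.freq → CongruenceFree M.freq hred.isHermitian →
      (∀ μ ν, MeasureTheory.Integrable (M.autocorr μ ν)) ∧
      (∀ μ ν, Summable (M.lambShiftTerm p hred.isHermitian μ ν)) ∧
      (∀ ρ μ ν, Summable (M.dissipatorTerm p hred.isHermitian ρ μ ν)) ∧
      (M.lambShift p hred.isHermitian).IsHermitian ∧
      ∃ K : M.Space →L[ℂ] M.Space,
        (∀ lam : ℝ, 0 < lam → M.IsLocalAverage lam (M.Ktilde lam) K) ∧
        ∀ (a : M.Space) (ρ : Matrix (Fin d) (Fin d) ℂ), ρ = partialTrace a →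
          K a = tensorState M.envState
            ((-Complex.I) • (M.lambShift p hred.isHermitian * ρ -
                ρ * M.lambShift p hred.isHermitian) +
              M.dissipator p hred.isHermitian ρ)) := by

  refine ⟨fun lam _ => ⟨fun t => OpenSystem.integrableOn_kernel hf _,
    OpenSystem.continuous_Ktilde hf lam, M.Ktilde_restrict hf lam⟩,
    fun p Hbar hred hΩ hB => ⟨OpenSystem.integrable_autocorr hf,
      OpenSystem.summable_lambShiftTerm hf hred.isHermitian,
      OpenSystem.summable_dissipatorTerm hf hred.isHermitian,
      OpenSystem.isHermitian_lambShift hf hred.isHermitian,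
      -M.liftedForm (∑ μ, ∑ ν, M.limitCoeff p hred.isHermitian μ ν),
      fun lam hlam => hred.isLocalAverage hΩ hB hf hlam, fun a ρ hρ => ?_⟩⟩
  rw [← OpenSystem.neg_memoryForm_limitCoeff hf hred.isHermitian ρ, map_neg, hρ]
  rfl
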